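/- Let $D$ be a planar diagram of a knot $K$ with crossings $c_1,\dots,c_n$ and edges $e_1,\dots,e_m$ (the diagram is viewed as a $4$-valent plane graph; the crossingless circle has one edge). Let $$R'=\mathbb{Q}[X_1,\dots,X_m,t]/(X_1^2=\cdots=X_m^2=t).$$ For $v\in\{0,1\}^n$ let $D_v$ be the collection of circles obtained by replacing each $c_i$ by its $v_i$-resolution, and let $R_v$ be the quotient of $R'$ by the relations $X_p=X_q$ for all edges $e_p,e_q$ lying on the same circle of $D_v$. If $u,v$ differ only in that $u_i=0$, $v_i=1$, let $\delta_{u,v}\colon R_u\to R_v$ be the projection if $D_v$ arises from $D_u$ by merging two circles, and multiplication by $X_j+X_k$ if $D_v$ arises by splitting a circle, where $e_j,e_k$ are diagonally opposite edges at $c_i$; put $\epsilon_{u,v}=\sum_{j<i}u_j$. The $t$-lifted Lee complex is $$C_{Lee}(D)=\bigoplus_{v}R_v,\qquad \delta=\sum_{u\lessdot v}(-1)^{\epsilon_{u,v}}\delta_{u,v},$$ and $H_{Lee}(D)$ is its homology, an $R'$-module. Each edge $e$ of $D$ makes it a module over $\mathbb{Q}[X,t]/(X^2=t)$, with $X$ acting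 as $X_e$. Let $\mathfrak{u}_X(D,e)$ be the maximal order of $X$-torsion in it, that is, the supremum, over all $a\in H_{Lee}(D)$ killed by some power of $X_e$, of the least $k\ge 0$ with $X_e^k a=0$. (This is $\mathfrak{u}_X(K)$; up to isomorphism and the sign of $X$ the module depends only on $K$.) Let $u(K)$ be the unknotting number of $K$: the least number of crossing changes that turn $K$ into the unknot, where isotopies are allowed between the crossing changes. **Theorem.** For every knot $K$, every planar diagram $D$ of $K$ and every edge $e$ of $D$, $$\mathfrak{u}_X(D,e)\le u(K).$$ In other words, $\mathfrak{u}_X(K)\le u(K)$ for every knot $K$. -/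

import Mathlib

noncomputable section

/-! ### Planar diagram codes -/

/-- A planar diagram code: `n` crossings and `m` edges. At every crossing `c` the four edges met are
listed counterclockwise as `ends c 0, …, ends c 3`, the positions `0, 2` belonging to the strand that
passes under and the positions `1, 3` to the strand that passes over. An edge that is met by no
crossing stands for a closed curve without crossings. -/
structure PDCode where
  /-- number of crossings -/
  n : ℕ
  /-- number of edges -/
  m : ℕ
  /-- the edge at a given position of a given crossing -/
  ends : Fin n → Fin 4 → Fin m

namespace PDCode

/-- Two edges are opposite each other at a crossing: a strand continues from one to the other. -/
def Opposite (D : PDCode) (e f : Fin D.m) : Prop :=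
  ∃ c i, D.ends c i = e ∧ D.ends c (i + 2) = f

/-- Adjacency of corners along an edge. The corner `(c, i)` is the sector at the crossing `c` between
the positions `i` and `i + 1`. If the edge that leaves `c` at position `i` arrives at position `j`
of `d`, then the region to its left contains the corners `(c, i)` and `(d, j - 1)`. -/
def CornerAdj (D : PDCode) (x y : Fin D.n × Fin 4) : Prop :=
  ∃ j : Fin 4, (y.1, j) ≠ x ∧ D.ends y.1 j = D.ends x.1 x.2 ∧ y.2 = j - 1

/-- The regions (faces) of the surface that is made from the diagram by gluing a disc along each
boundary walk. -/
def Face (D : PDCode) : Type := Quot D.CornerAdj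

/-- The code is a diagram of a knot in the plane (equivalently, on the sphere): every edge has two
ends or is a closed curve, there is exactly one component, and the surface carrying the diagram is
a sphere, by Euler's formula `n - 2 n + #faces = 2` (the crossingless circle is planar). -/
structure IsKnotDiagram (D : PDCode) : Prop where
  card_ends : ∀ e : Fin D.m,
    Nat.card {x : Fin D.n × Fin 4 // D.ends x.1 x.2 = e} = 0 ∨
    Nat.card {x : Fin D.n × Fin 4 // D.ends x.1 x.2 = e} = 2
  nonempty : 0 < D.m
  one_component : ∀ e f : Fin D.m, Relation.EqvGen D.Opposite e f
  planar : D.n = 0 ∨ Nat.card D.Face = D.n + 2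

/-- Changing the crossing `c`: the under-strand and the over-strand are exchanged, that is, the
positions at `c` are rotated by one step. -/
def crossingChange (D : PDCode) (c : Fin D.n) : PDCode where
  n := D.n
  m := D.m
  ends := fun d i => if d = c then D.ends d (i + 1) else D.ends d i

/-- The same diagram up to orientation-preserving homeomorphism of the sphere: the codes differ by a
renumbering of the crossings and of the edges, and by the choice, at each crossing, of which of the
two ends of the under-strand is listed first. -/
def Iso (D D' : PDCode) : Prop :=
  ∃ (κ : Fin D.n ≃ Fin D'.n) (ε : Fin D.m ≃ Fin D'.m) (r : Fin D.n → Fin 4),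
    (∀ c, r c = 0 ∨ r c = 2) ∧ ∀ c i, D'.ends (κ c) (i + r c) = ε (D.ends c i)

/-- `D'` arises from `D` by erasing the crossings in `S` and the edges in `G`, and joining the
remaining edges to each other as generated by the relation `r`. -/
def Erases (D D' : PDCode) (S : Set (Fin D.n)) (G : Set (Fin D.m))
    (r : Fin D.m → Fin D.m → Prop) : Prop :=
  ∃ (κ : Fin D'.n → Fin D.n) (f : Fin D.m → Fin D'.m),
    Function.Injective κ ∧ Set.range κ = Sᶜ ∧
    (∀ e', ∃ e, e ∉ G ∧ f e = e') ∧
    (∀ a b, a ∉ G → b ∉ G → (f a = f b ↔ Relation.EqvGen r a b)) ∧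
    ∀ c i, D'.ends c i = f (D.ends (κ c) i)

/-- First Reidemeister move (undoing a kink of either sign): the edge `g` bounds a monogon at the
crossing `c`; `c` and `g` are erased and the two other edges at `c` are joined. -/
def Reidemeister1 (D D' : PDCode) : Prop :=
  ∃ (c : Fin D.n) (g p q : Fin D.m),
    (D.ends c = ![g, g, p, q] ∨ D.ends c = ![p, g, g, q]) ∧
    D.Erases D' {c} {g} (fun a b => a = p ∧ b = q)

/-- Second Reidemeister move (pulling apart two strands): the edges `g` and `h` bound a bigon with
corners at `c` and `d`; the strand `p₁, g, p₂` passes over the strand `q₁, h, q₂` at both. -/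
def Reidemeister2 (D D' : PDCode) : Prop :=
  ∃ (c d : Fin D.n) (g h p₁ p₂ q₁ q₂ : Fin D.m), c ≠ d ∧
    D.ends c = ![h, p₁, q₁, g] ∧ D.ends d = ![q₂, p₂, h, g] ∧
    D.Erases D' {c, d} {g, h} (fun a b => (a = p₁ ∧ b = p₂) ∨ (a = q₁ ∧ b = q₂))

/-- Third Reidemeister move. Inside a disc whose boundary meets the edges `b 0, …, b 5` in
counterclockwise order, the strands `T` from `b 0` to `b 3`, `L` from `b 1` to `b 4` and `N` from
`b 2` to `b 5` meet in three crossings `x = T ∩ L`, `y = T ∩ N`, `z = L ∩ N`; the sides of the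
triangle are `s 0` (between `x` and `y`), `s 1` (between `x` and `z`), `s 2` (between `y` and `z`).
The strand `T` is on top and is moved across `z`; at `z` either of `L`, `N` may be the upper one. -/
def Reidemeister3 (D D' : PDCode) : Prop :=
  ∃ (κ : Fin D.n ≃ Fin D'.n) (ε : Fin D.m ≃ Fin D'.m) (x y z : Fin D.n)
    (b : Fin 6 → Fin D.m) (s : Fin 3 → Fin D.m),
    x ≠ y ∧ x ≠ z ∧ y ≠ z ∧
    D.ends x = ![b 1, s 0, s 1, b 0] ∧ D'.ends (κ x) = ε ∘ ![s 1, b 3, b 4, s 0] ∧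
    D.ends y = ![b 2, b 3, s 2, s 0] ∧ D'.ends (κ y) = ε ∘ ![s 2, s 0, b 5, b 0] ∧
    ((D.ends z = ![s 2, b 4, b 5, s 1] ∧ D'.ends (κ z) = ε ∘ ![b 2, s 1, s 2, b 1]) ∨
     (D.ends z = ![s 1, s 2, b 4, b 5] ∧ D'.ends (κ z) = ε ∘ ![b 1, b 2, s 1, s 2])) ∧
    ∀ w, w ≠ x → w ≠ y → w ≠ z → D'.ends (κ w) = ε ∘ D.ends w

end PDCode

/-! ### Knots and the unknotting number -/

/-- A planar diagram of a knot. -/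
structure KnotDiagram where
  /-- the underlying code -/
  code : PDCode
  isKnotDiagram : code.IsKnotDiagram

/-- Elementary moves between knot diagrams. -/
inductive ReidemeisterMove (D D' : KnotDiagram) : Prop
  | iso : D.code.Iso D'.code → ReidemeisterMove D D'
  | move1 : D.code.Reidemeister1 D'.code → ReidemeisterMove D D'
  | move2 : D.code.Reidemeister2 D'.code → ReidemeisterMove D D'
  | move3 : D.code.Reidemeister3 D'.code → ReidemeisterMove D D'

/-- A knot: planar knot diagrams modulo the equivalence relation generated by the Reidemeister
moves. -/
def Knot : Type := Quot ReidemeisterMove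

/-- The knot that a diagram represents. -/
def KnotDiagram.knot (D : KnotDiagram) : Knot := Quot.mk ReidemeisterMove D

/-- The diagram of the unknot without crossings. -/
def KnotDiagram.circle : KnotDiagram where
  code := { n := 0, m := 1, ends := fun c => c.elim0 }
  isKnotDiagram :=
    { card_ends := fun _ => Or.inl (Nat.card_eq_zero.2 (Or.inl ⟨fun x => x.1.1.elim0⟩))
      nonempty := Nat.one_pos
      one_component := fun e f => by
        rw [Fin.fin_one_eq_zero e, Fin.fin_one_eq_zero f]
        exact Relation.EqvGen.refl _
      planar := Or.inl rfl }

namespace Knot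

/-- The unknot. -/
def unknot : Knot := KnotDiagram.circle.knot

/-- `K'` is obtained from `K` by one crossing change in some diagram of `K`. -/
def CrossingChange (K K' : Knot) : Prop :=
  ∃ (D D' : KnotDiagram) (c : Fin D.code.n),
    D.knot = K ∧ D'.knot = K' ∧ D'.code = D.code.crossingChange c

/-- `K` can be turned into the unknot by `k` crossing changes (with isotopies in between, so that
each crossing change may take place in a different diagram). -/
def UnknotsIn (K : Knot) (k : ℕ) : Prop :=
  ∃ s : ℕ → Knot, s 0 = K ∧ s k = unknot ∧ ∀ i < k, CrossingChange (s i) (s (i + 1))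

/-- The unknotting number: the least number of crossing changes that turn `K` into the unknot. -/
def unknottingNumber (K : Knot) : ℕ∞ := ⨅ (k : ℕ) (_ : K.UnknotsIn k), (k : ℕ∞)

end Knot

/-! ### The `t`-lifted Lee complex -/

namespace PDCode

open Polynomial

variable (D : PDCode)

/-- The ideal of the relations `X_e ^ 2 = t`, in the polynomial ring in the variables `X_e` (one for
each edge) over `ℚ[t]`. -/
def squareIdeal : Ideal (MvPolynomial (Fin D.m) ℚ[X]) :=
  Ideal.span {p | ∃ e, p = MvPolynomial.X e ^ 2 - MvPolynomial.C Polynomial.X}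

/-- The edge ring `ℚ[X₁, …, X_m, t] / (X₁² = ⋯ = X_m² = t)`. -/
def EdgeRing : Type := MvPolynomial (Fin D.m) ℚ[X] ⧸ D.squareIdeal

instance : CommRing D.EdgeRing :=
  inferInstanceAs (CommRing (MvPolynomial (Fin D.m) ℚ[X] ⧸ D.squareIdeal))

/-- The class of the variable `X_e` in the edge ring. -/
def x (e : Fin D.m) : D.EdgeRing :=
  Ideal.Quotient.mk D.squareIdeal (MvPolynomial.X e)

/-- A vertex of the cube of resolutions; `false` is the `0`-resolution, `true` the `1`-resolution. -/
abbrev Vertex : Type := Fin D.n → Bool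

/-- The two arcs that replace the crossing `c`: the `0`-resolution joins the positions `0, 1` and
`2, 3`, and the `1`-resolution joins `0, 3` and `1, 2`. -/
def ResolutionArc (b : Bool) (c : Fin D.n) (e f : Fin D.m) : Prop :=
  match b with
  | false => (e = D.ends c 0 ∧ f = D.ends c 1) ∨ (e = D.ends c 2 ∧ f = D.ends c 3)
  | true => (e = D.ends c 0 ∧ f = D.ends c 3) ∨ (e = D.ends c 1 ∧ f = D.ends c 2)

/-- Two edges lie on the same circle of the resolved diagram `D_v`. -/
def SameCircle (v : D.Vertex) : Fin D.m → Fin D.m → Prop :=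
  Relation.EqvGen fun e f => ∃ c, D.ResolutionArc (v c) c e f

/-- The ideal of the relations `X_p = X_q` for edges `p`, `q` on the same circle of `D_v`. -/
def circleIdeal (v : D.Vertex) : Ideal D.EdgeRing :=
  Ideal.span {a | ∃ p q, D.SameCircle v p q ∧ a = D.x p - D.x q}

/-- The module `R_v` at the vertex `v` of the cube. -/
abbrev VertexModule (v : D.Vertex) : Type := D.EdgeRing ⧸ D.circleIdeal v

/-- The cobordism from `D_u` to `D_v` is a merge: every circle of `D_u` goes into one of `D_v`. -/
def IsMerge (u v : D.Vertex) : Prop := ∀ p q, D.SameCircle u p q → D.SameCircle v p q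

variable {D}

theorem x_sq_eq (e f : Fin D.m) : D.x e ^ 2 = D.x f ^ 2 := by
  have h : ∀ g, Ideal.Quotient.mk D.squareIdeal (MvPolynomial.X g ^ 2) =
      Ideal.Quotient.mk D.squareIdeal (MvPolynomial.C Polynomial.X) := fun g =>
    Ideal.Quotient.eq.2 (Ideal.subset_span ⟨g, rfl⟩)
  exact (h e).trans (h f).symm

theorem x_sub_mem {v : D.Vertex} {p q : Fin D.m} (h : D.SameCircle v p q) :
    D.x p - D.x q ∈ D.circleIdeal v :=
  Ideal.subset_span ⟨p, q, h, rfl⟩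

theorem merge_wellDefined {u v : D.Vertex} (h : D.IsMerge u v) :
    D.circleIdeal u ≤ Submodule.comap LinearMap.id (D.circleIdeal v) := by
  refine Ideal.span_le.2 ?_
  rintro _ ⟨p, q, hpq, rfl⟩
  exact x_sub_mem (h p q hpq)

theorem split_wellDefined {u v : D.Vertex} (c : Fin D.n) (hu : u c = false) (hv : v c = true)
    (huv : ∀ d, d ≠ c → u d = v d) :
    D.circleIdeal u ≤ Submodule.comap
      (LinearMap.mulLeft D.EdgeRing (D.x (D.ends c 0) + D.x (D.ends c 2))) (D.circleIdeal v) := by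
  refine Ideal.span_le.2 ?_
  rintro _ ⟨p, q, hpq, rfl⟩
  show (D.x (D.ends c 0) + D.x (D.ends c 2)) * (D.x p - D.x q) ∈ D.circleIdeal v
  have h03 : D.x (D.ends c 0) - D.x (D.ends c 3) ∈ D.circleIdeal v :=
    x_sub_mem (Relation.EqvGen.rel _ _ ⟨c, by rw [hv]; exact Or.inl ⟨rfl, rfl⟩⟩)
  have h12 : D.x (D.ends c 1) - D.x (D.ends c 2) ∈ D.circleIdeal v :=
    x_sub_mem (Relation.EqvGen.rel _ _ ⟨c, by rw [hv]; exact Or.inr ⟨rfl, rfl⟩⟩)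
  have hsq := x_sq_eq (D := D) (D.ends c 0) (D.ends c 2)
  induction hpq with
  | rel p q h =>
    obtain ⟨d, hd⟩ := h
    by_cases hdc : d = c
    · subst hdc
      rw [hu] at hd
      rcases hd with ⟨rfl, rfl⟩ | ⟨rfl, rfl⟩
      · have e : (D.x (D.ends d 0) + D.x (D.ends d 2)) * (D.x (D.ends d 0) - D.x (D.ends d 1)) =
            -(D.x (D.ends d 0) + D.x (D.ends d 2)) *
              (D.x (D.ends d 1) - D.x (D.ends d 2)) := by
          linear_combination hsq
        rw [e]
        exact Ideal.mul_mem_left _ _ h12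
      · have e : (D.x (D.ends d 0) + D.x (D.ends d 2)) * (D.x (D.ends d 2) - D.x (D.ends d 3)) =
            (D.x (D.ends d 0) + D.x (D.ends d 2)) *
              (D.x (D.ends d 0) - D.x (D.ends d 3)) := by
          linear_combination -hsq
        rw [e]
        exact Ideal.mul_mem_left _ _ h03
    · exact Ideal.mul_mem_left _ _
        (x_sub_mem (Relation.EqvGen.rel _ _ ⟨d, by rw [← huv d hdc]; exact hd⟩))
  | refl p => simp
  | symm p q _ ih =>
    have e : (D.x (D.ends c 0) + D.x (D.ends c 2)) * (D.x q - D.x p) =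
        -((D.x (D.ends c 0) + D.x (D.ends c 2)) * (D.x p - D.x q)) := by ring
    rw [e]
    exact neg_mem ih
  | trans p q r _ _ ih₁ ih₂ =>
    have e : (D.x (D.ends c 0) + D.x (D.ends c 2)) * (D.x p - D.x r) =
        (D.x (D.ends c 0) + D.x (D.ends c 2)) * (D.x p - D.x q) +
          (D.x (D.ends c 0) + D.x (D.ends c 2)) * (D.x q - D.x r) := by ring
    rw [e]
    exact add_mem ih₁ ih₂

open Classical in
/-- The map `R_u → R_v` of an edge of the cube, where `u` and `v` differ only in that `u` has the
`0`-resolution and `v` the `1`-resolution at `c`: for a merge the projection, for a split the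
multiplication by `X_j + X_k`, where `e_j` and `e_k` are diagonally opposite edges at `c`. -/
def edgeMap (c : Fin D.n) (u v : D.Vertex) (hu : u c = false) (hv : v c = true)
    (huv : ∀ d, d ≠ c → u d = v d) : D.VertexModule u →ₗ[D.EdgeRing] D.VertexModule v :=
  if h : D.IsMerge u v then
    Submodule.mapQ (D.circleIdeal u) (D.circleIdeal v) LinearMap.id (merge_wellDefined h)
  else
    Submodule.mapQ (D.circleIdeal u) (D.circleIdeal v)
      (LinearMap.mulLeft D.EdgeRing (D.x (D.ends c 0) + D.x (D.ends c 2)))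
      (split_wellDefined c hu hv huv)

variable (D)

/-- The `t`-lifted Lee complex `C_Lee(D)`: the direct sum of the modules `R_v`. -/
abbrev LeeComplex : Type := (v : D.Vertex) → D.VertexModule v

/-- The sign exponent: the number of crossings before `c` that have the `1`-resolution in `v`. -/
def signExponent (v : D.Vertex) (c : Fin D.n) : ℕ :=
  (Finset.univ.filter fun d : Fin D.n => d < c ∧ v d = true).card

/-- The differential: the component at `v` is the signed sum of the edge maps into `R_v`, one for
each crossing `c` with `v c = 1`, from the vertex that has `0` at `c` instead. -/
def differential : D.LeeComplex →ₗ[D.EdgeRing] D.LeeComplex :=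
  LinearMap.pi fun v => ∑ c : Fin D.n,
    if hv : v c = true then
      (-1 : D.EdgeRing) ^ D.signExponent v c •
        (edgeMap c (Function.update v c false) v (by simp) hv
          (fun d hd => by simp [hd])) ∘ₗ LinearMap.proj (Function.update v c false)
    else 0

/-- The Lee homology `H_Lee(D) = ker δ / im δ`, a module over the edge ring. -/
abbrev LeeHomology : Type :=
  LinearMap.ker D.differential ⧸
    (LinearMap.range D.differential).submoduleOf (LinearMap.ker D.differential)

end PDCode

/-! ### The maximal order of `X`-torsion -/

/-- The maximal order of `x`-torsion in a module: the supremum, over all elements `a` that are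
killed by a power of `x`, of the least `k` with `x ^ k • a = 0`. -/
def maxTorsionOrder {R : Type*} [CommRing R] (M : Type*) [AddCommGroup M] [Module R M] (x : R) :
    ℕ∞ :=
  ⨆ (a : M) (_ : ∃ k : ℕ, x ^ k • a = 0), ((sInf {k : ℕ | x ^ k • a = 0} : ℕ) : ℕ∞)

/-- `𝔲_X` computed from the diagram `D`, where `X` acts on the Lee homology as the variable of the
edge `e`. -/
def KnotDiagram.uX (D : KnotDiagram) (e : Fin D.code.m) : ℕ∞ :=
  maxTorsionOrder D.code.LeeHomology (D.code.x e)

end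

/-! The heart of the matter is the effect of a single crossing change. Split the cube of resolutions
at a crossing `c`. The complex of the diagram is then the cone of a saddle map `s : A → B`, and the
complex after the change is the cone of the reverse saddle `s' : B → A`. If `p`, `q` are opposite
edges at `c`, both composites of `s` and `s'` are multiplication by `X_p + X_q`, so the reverse
saddle is a null-homotopy of `X_p + X_q` on the cone. The difference `X_p - X_q` annihilates the
saddles, hence `(a, b) ↦ ((X_p - X_q) b, a)` maps either cone to the other (up to sign), and going
back and forth is multiplication by `X_p - X_q`, which is homotopic to `2 X_p`. If `X ^ k` kills all
`X`-torsion after the change, then `X ^ (k + 1)` kills it before (`Cube.torsionBound_of_rotate`).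
The crossingless circle has zero differential and a torsion-free chain module, so its bound is `0`,
and induction along an unknotting sequence gives the theorem, once the bound is known not to depend
on the edge or on the diagram.

Independence of the edge is the same homotopy: `X_p` and `-X_q` agree on homology, and a knot has
one component. For the Reidemeister moves, a circle that meets no remaining crossing allows a merge
or split to be cancelled by an explicit strong deformation retraction compatible with `X`
(`Cube.IsAttached` and its maps). This settles the first two moves. For the third, one resolution of
the crossing `z` creates a bigon in both diagrams, while the other makes the two faces of the cube
isomorphic. Removing both bigons leaves isomorphic corners, and the induced maps between corner and
face correspond (`cornerEquiv_retr`, `faceEquiv_incl`).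

All computations take place in a model. Evaluating each `X_e` as `±√t` turns `R_v` into the
polynomial functions on the sign vectors constant on the circles of `D_v` (`mem_circleIdeal_iff`).
Every edge of the cube becomes multiplication by a weight: `1` for a merge and `2 X_e` for a split,
on the sign vectors admissible at both ends (`vertexFun_edgeMap`). Planarity enters only to ensure
that each edge is exactly one of merge and split. A checkerboard colouring orients the edges
alternately around every crossing, the circles become cycles of a permutation of the edges, and
changing one resolution multiplies it by a transposition. -/

/-! ### Torsion bounds for differential modules -/

section DifferentialModule

variable {M N A B K : Type*} [AddCommGroup M] [Module ℚ M] [AddCommGroup N] [Module ℚ N]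
  [AddCommGroup A] [Module ℚ A] [AddCommGroup B] [Module ℚ B] [AddCommGroup K] [Module ℚ K]

/-- In the homology of `d`, every class killed by a power of `x` is killed by `x ^ k`. -/
def TorsionBound (d x : M →ₗ[ℚ] M) (k : ℕ) : Prop :=
  ∀ a, d a = 0 → (∃ n b, (x ^ n) a = d b) → ∃ b, (x ^ k) a = d b

theorem LinearMap.pow_apply_comm_of {f : M →ₗ[ℚ] N} {x : M →ₗ[ℚ] M} {y : N →ₗ[ℚ] N}
    (h : ∀ a, f (x a) = y (f a)) (n : ℕ) (a : M) : f ((x ^ n) a) = (y ^ n) (f a) := by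
  induction n generalizing a with
  | zero => simp
  | succ n ih => rw [pow_succ, pow_succ, Module.End.mul_apply, Module.End.mul_apply, ih, h]

/-- Maps back and forth whose composite is, on homology, multiplication by `r * x ^ j`. -/
theorem TorsionBound.of_maps {d x : M →ₗ[ℚ] M} {d' x' : N →ₗ[ℚ] N} {k j : ℕ}
    (h : TorsionBound d' x' k) (f : M →ₗ[ℚ] N) (g : N →ₗ[ℚ] M) (r : ℚ) (hr : r ≠ 0)
    (hdx : ∀ a, d (x a) = x (d a))
    (hfc : ∀ a, d a = 0 → d' (f a) = 0) (hfb : ∀ b, ∃ b', f (d b) = d' b')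
    (hgb : ∀ b, ∃ b', g (d' b) = d b')
    (hfx : ∀ a, f (x a) = x' (f a)) (hgx : ∀ a, g (x' a) = x (g a))
    (hgf : ∀ a, d a = 0 → ∃ b, g (f a) = r • (x ^ j) a + d b) :
    TorsionBound d x (k + j) := by
  rintro a ha ⟨n, b, hb⟩
  obtain ⟨b₁, hb₁⟩ := hfb b
  obtain ⟨b₂, hb₂⟩ := h (f a) (hfc a ha)
    ⟨n, b₁, by rw [← LinearMap.pow_apply_comm_of hfx, hb, hb₁]⟩
  obtain ⟨b₃, hb₃⟩ := hgb b₂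
  obtain ⟨b₄, hb₄⟩ := hgf a ha
  have h1 : (x ^ k) (g (f a)) = d b₃ := by
    rw [← LinearMap.pow_apply_comm_of hgx, hb₂, hb₃]
  rw [hb₄, map_add, ← LinearMap.pow_apply_comm_of hdx, map_smul] at h1
  -- Applying `x ^ k` to `g (f a) = r x ^ j a + d b₄` gives `d b₃ = r x ^ (k + j) a + d (x ^ k b₄)`,
  -- which is solved for `x ^ (k + j) a`.
  refine ⟨r⁻¹ • (b₃ - (x ^ k) b₄), ?_⟩
  rw [map_smul, map_sub, ← h1, pow_add, Module.End.mul_apply, add_sub_cancel_right,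
    smul_smul, inv_mul_cancel₀ hr, one_smul]

theorem TorsionBound.of_equiv {d x : M →ₗ[ℚ] M} {d' x' : N →ₗ[ℚ] N} {k : ℕ}
    (h : TorsionBound d' x' k) (f : M ≃ₗ[ℚ] N) (hd : ∀ a, f (d a) = d' (f a))
    (hx : ∀ a, f (x a) = x' (f a)) : TorsionBound d x k := by
  rintro a ha ⟨n, b, hb⟩
  obtain ⟨b₂, hb₂⟩ := h (f a) (by rw [← hd, ha, map_zero])
    ⟨n, f b, by rw [← hd, ← hb]; exact (LinearMap.pow_apply_comm_of (f := f.toLinearMap) hx n a).symm⟩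
  refine ⟨f.symm b₂, f.injective ?_⟩
  rw [hd, f.apply_symm_apply, ← hb₂]
  exact LinearMap.pow_apply_comm_of (f := f.toLinearMap) hx k a

theorem TorsionBound.equiv_iff {d x : M →ₗ[ℚ] M} {d' x' : N →ₗ[ℚ] N} {k : ℕ}
    (f : M ≃ₗ[ℚ] N) (hd : ∀ a, f (d a) = d' (f a))
    (hx : ∀ a, f (x a) = x' (f a)) : TorsionBound d x k ↔ TorsionBound d' x' k := by
  refine ⟨fun h => h.of_equiv f.symm (fun a => ?_) fun a => ?_, fun h => h.of_equiv f hd hx⟩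
  · apply f.injective; rw [hd]; simp
  · apply f.injective; rw [hx]; simp

/-- Cancelling part of a cone often leaves `-d` as the differential. It has the same cycles and
boundaries as `d`. -/
theorem TorsionBound.neg_iff {d x : M →ₗ[ℚ] M} {k : ℕ} :
    TorsionBound (-d) x k ↔ TorsionBound d x k := by
  have key : ∀ {e : M →ₗ[ℚ] M}, TorsionBound e x k → TorsionBound (-e) x k := by
    rintro e h a ha ⟨n, b, hb⟩
    obtain ⟨c, hc⟩ := h a (by simpa using ha) ⟨n, -b, by simpa using hb⟩
    exact ⟨-c, by simpa using hc⟩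
  exact ⟨fun h => by simpa using key h, key⟩

/-- Two operators with homotopic sum zero have the same torsion bounds. -/
theorem TorsionBound.of_add_homotopic {d x y h : M →ₗ[ℚ] M} {k : ℕ} (hk : TorsionBound d x k)
    (hdx : ∀ a, d (x a) = x (d a)) (hdy : ∀ a, d (y a) = y (d a))
    (hxy : ∀ a, x a + y a = d (h a) + h (d a)) : TorsionBound d y k := by
  -- On homology `y = -x`, so `y ^ n = (-1) ^ n x ^ n`. The term `h (d a)` drops out because powers
  -- of `x` preserve cycles.
  have key : ∀ (n : ℕ) (a : M), d a = 0 → ∃ b, (y ^ n) a = (-1 : ℚ) ^ n • (x ^ n) a + d b := by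
    intro n a ha
    induction n with
    | zero => exact ⟨0, by simp⟩
    | succ n ih =>
      obtain ⟨b, hb⟩ := ih
      have hc : d ((x ^ n) a) = 0 := by
        rw [LinearMap.pow_apply_comm_of hdx, ha, map_zero]
      have hz := hxy ((x ^ n) a)
      rw [hc, map_zero, add_zero] at hz
      refine ⟨y b + (-1 : ℚ) ^ n • h ((x ^ n) a), ?_⟩
      rw [pow_succ', Module.End.mul_apply, hb, map_add, map_smul, ← hdy, map_add, map_smul, ← hz,
        pow_succ' x, Module.End.mul_apply, pow_succ (-1 : ℚ)]
      module
  have sq : ∀ n : ℕ, ((-1 : ℚ) ^ n) * (-1) ^ n = 1 := fun n => by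
    rw [← mul_pow]; norm_num
  rintro a ha ⟨n, b, hb⟩
  obtain ⟨b₁, hb₁⟩ := key n a ha
  obtain ⟨b₂, hb₂⟩ := hk a ha ⟨n, (-1 : ℚ) ^ n • (b - b₁), by
    rw [map_smul, map_sub, ← hb, hb₁, add_sub_cancel_right, smul_smul, sq, one_smul]⟩
  obtain ⟨b₃, hb₃⟩ := key k a ha
  exact ⟨(-1 : ℚ) ^ k • b₂ + b₃, by rw [hb₃, hb₂, map_add, map_smul]⟩

/-- A strong deformation retraction of `(M, d, x)` onto `(K, e, y)`. -/
structure DeformationRetract (d x : M →ₗ[ℚ] M) (e y : K →ₗ[ℚ] K) where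
  /-- the inclusion -/
  incl : K →ₗ[ℚ] M
  /-- the retraction -/
  retr : M →ₗ[ℚ] K
  /-- the homotopy -/
  htpy : M →ₗ[ℚ] M
  d_incl : ∀ a, d (incl a) = incl (e a)
  retr_d : ∀ a, retr (d a) = e (retr a)
  retr_incl : ∀ a, retr (incl a) = a
  incl_retr : ∀ a, incl (retr a) + (d (htpy a) + htpy (d a)) = a
  -- The three side conditions on the homotopy make the retractions of cones below satisfy the same
  -- identities again.
  retr_htpy : ∀ a, retr (htpy a) = 0
  htpy_incl : ∀ a, htpy (incl a) = 0
  htpy_htpy : ∀ a, htpy (htpy a) = 0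
  x_incl : ∀ a, x (incl a) = incl (y a)
  retr_x : ∀ a, retr (x a) = y (retr a)
  htpy_x : ∀ a, htpy (x a) = x (htpy a)

/-- Inclusion and retraction are inverse up to homotopy and commute with the actions, so both
directions are `TorsionBound.of_maps` with `j = 0` and `r = 1`. -/
theorem DeformationRetract.torsionBound_iff {d x : M →ₗ[ℚ] M} {e y : K →ₗ[ℚ] K}
    (R : DeformationRetract d x e y) (hdx : ∀ a, d (x a) = x (d a)) (hey : ∀ a, e (y a) = y (e a))
    (k : ℕ) : TorsionBound d x k ↔ TorsionBound e y k := by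
  constructor
  · intro h
    refine h.of_maps (j := 0) R.incl R.retr 1 one_ne_zero hey (fun a ha => ?_)
      (fun b => ⟨_, (R.d_incl b).symm⟩) (fun b => ⟨_, R.retr_d b⟩) (fun a => (R.x_incl a).symm)
      R.retr_x (fun a _ => ⟨0, by simp [R.retr_incl]⟩)
    rw [R.d_incl, ha, map_zero]
  · intro h
    refine h.of_maps (j := 0) R.retr R.incl 1 one_ne_zero hdx (fun a ha => ?_)
      (fun b => ⟨_, R.retr_d b⟩) (fun b => ⟨_, (R.d_incl b).symm⟩) R.retr_x
      (fun a => (R.x_incl a).symm) (fun a ha => ⟨-R.htpy a, ?_⟩)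
    · rw [← R.retr_d, ha, map_zero]
    · have := R.incl_retr a
      rw [ha, map_zero, add_zero] at this
      rw [pow_zero, one_smul, Module.End.one_apply, map_neg]
      nth_rewrite 2 [← this]
      abel

/-- Transport of a deformation retraction along an isomorphism. -/
def DeformationRetract.congr {d x : M →ₗ[ℚ] M} {d' x' : N →ₗ[ℚ] N} {e y : K →ₗ[ℚ] K}
    (R : DeformationRetract d' x' e y) (f : M ≃ₗ[ℚ] N) (hd : ∀ a, f (d a) = d' (f a))
    (hx : ∀ a, f (x a) = x' (f a)) : DeformationRetract d x e y where
  incl := f.symm.toLinearMap ∘ₗ R.incl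
  retr := R.retr ∘ₗ f.toLinearMap
  htpy := f.symm.toLinearMap ∘ₗ R.htpy ∘ₗ f.toLinearMap
  d_incl a := f.injective (by simp [hd, R.d_incl])
  retr_d a := by simp [hd, R.retr_d]
  retr_incl a := by simp [R.retr_incl]
  incl_retr a := f.injective (by simp [hd, R.incl_retr])
  retr_htpy a := by simp [R.retr_htpy]
  htpy_incl a := by simp [R.htpy_incl]
  htpy_htpy a := by simp [R.htpy_htpy]
  x_incl a := f.injective (by simp [hx, R.x_incl])
  retr_x a := by simp [hx, R.retr_x]
  htpy_x a := f.injective (by simp [hx, R.htpy_x])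

/-- The differential of the cone of `δ`. -/
def coneD (d : A →ₗ[ℚ] A) (d' : B →ₗ[ℚ] B) (δ : A →ₗ[ℚ] B) : A × B →ₗ[ℚ] A × B :=
  -- The minus sign on the target is the one that the sign rule of the cube produces when the
  -- direction of `δ` comes first.
  (d ∘ₗ LinearMap.fst ℚ A B).prod (δ ∘ₗ LinearMap.fst ℚ A B - d' ∘ₗ LinearMap.snd ℚ A B)

@[simp]
theorem coneD_apply (d : A →ₗ[ℚ] A) (d' : B →ₗ[ℚ] B) (δ : A →ₗ[ℚ] B) (a : A × B) :
    coneD d d' δ a = (d a.1, δ a.1 - d' a.2) := rfl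

theorem coneD_comm {d x : A →ₗ[ℚ] A} {d' x' : B →ₗ[ℚ] B} {δ : A →ₗ[ℚ] B}
    (hd : ∀ a, d (x a) = x (d a)) (hd' : ∀ a, d' (x' a) = x' (d' a)) (hδ : ∀ a, δ (x a) = x' (δ a))
    (a : A × B) : coneD d d' δ (x.prodMap x' a) = x.prodMap x' (coneD d d' δ a) := by
  simp [hd, hd', hδ]

/-- Replacing the target of a cone by a deformation retract. -/
def DeformationRetract.coneRight {d x : M →ₗ[ℚ] M} {e y : K →ₗ[ℚ] K}
    (R : DeformationRetract d x e y) (dA xA : A →ₗ[ℚ] A) (δ : A →ₗ[ℚ] M)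
    (hδ : ∀ a, δ (dA a) = d (δ a)) (hδx : ∀ a, δ (xA a) = x (δ a)) :
    DeformationRetract (coneD dA d δ) (xA.prodMap x) (coneD dA e (R.retr ∘ₗ δ)) (xA.prodMap y) where
  -- The inclusion of `K` alone is not a chain map on the cone, since `δ` need not land in the image
  -- of `R.incl`. The term `R.htpy ∘ δ` corrects this.
  incl := (LinearMap.fst ℚ A K).prod
    (R.incl ∘ₗ LinearMap.snd ℚ A K + R.htpy ∘ₗ δ ∘ₗ LinearMap.fst ℚ A K)
  retr := LinearMap.id.prodMap R.retr
  htpy := (0 : A →ₗ[ℚ] A).prodMap (-R.htpy)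
  d_incl a := by
    have h := R.incl_retr (δ a.1)
    simp only [coneD_apply, LinearMap.prod_apply, Function.prod, LinearMap.fst_apply,
      LinearMap.add_apply, LinearMap.comp_apply, LinearMap.snd_apply, map_add, map_sub,
      R.d_incl, hδ]
    refine Prod.ext rfl ?_
    simp only
    nth_rewrite 1 [← h]
    abel
  retr_d a := by simp [R.retr_d]
  retr_incl a := by simp [R.retr_incl, R.retr_htpy]
  incl_retr a := by
    have h := R.incl_retr a.2
    simp only [coneD_apply, LinearMap.prod_apply, Function.prod, LinearMap.fst_apply,
      LinearMap.prodMap_apply, LinearMap.id_apply, LinearMap.zero_apply, LinearMap.neg_apply,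
      LinearMap.add_apply, LinearMap.comp_apply, LinearMap.snd_apply, map_sub, map_zero, map_neg]
    refine Prod.ext (by simp) ?_
    simp only [Prod.snd_add]
    nth_rewrite 4 [← h]
    abel
  retr_htpy a := by simp [R.retr_htpy]
  htpy_incl a := by simp [R.htpy_incl, R.htpy_htpy]
  htpy_htpy a := by simp [R.htpy_htpy]
  x_incl a := by simp [R.x_incl, hδx, R.htpy_x]
  retr_x a := by simp [R.retr_x]
  htpy_x a := by simp [R.htpy_x]

/-- Replacing the source of a cone by a deformation retract. -/
def DeformationRetract.coneLeft {d x : M →ₗ[ℚ] M} {e y : K →ₗ[ℚ] K}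
    (R : DeformationRetract d x e y) (dA xA : A →ₗ[ℚ] A) (δ : M →ₗ[ℚ] A)
    (hδ : ∀ a, δ (d a) = dA (δ a)) (hδx : ∀ a, δ (x a) = xA (δ a)) :
    DeformationRetract (coneD d dA δ) (x.prodMap xA) (coneD e dA (δ ∘ₗ R.incl)) (y.prodMap xA) where
  incl := R.incl.prodMap LinearMap.id
  -- Dually, the retraction needs the correction `δ ∘ R.htpy`, because `δ` need not factor through
  -- `R.retr`.
  retr := (R.retr ∘ₗ LinearMap.fst ℚ M A).prod
    (LinearMap.snd ℚ M A - δ ∘ₗ R.htpy ∘ₗ LinearMap.fst ℚ M A)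
  htpy := R.htpy.prodMap (0 : A →ₗ[ℚ] A)
  d_incl a := by simp [R.d_incl]
  retr_d a := by
    have h := congrArg δ (R.incl_retr a.1)
    simp only [map_add, hδ] at h
    simp only [coneD_apply, LinearMap.prod_apply, Function.prod, LinearMap.fst_apply,
      LinearMap.sub_apply, LinearMap.comp_apply, LinearMap.snd_apply, map_sub,
      R.retr_d]
    refine Prod.ext rfl ?_
    simp only
    rw [← h]
    abel
  retr_incl a := by simp [R.retr_incl, R.htpy_incl]
  incl_retr a := by
    have h := R.incl_retr a.1
    simp only [coneD_apply, LinearMap.prod_apply, Function.prod, LinearMap.fst_apply,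
      LinearMap.prodMap_apply, LinearMap.id_apply, LinearMap.zero_apply,
      LinearMap.sub_apply, LinearMap.comp_apply, LinearMap.snd_apply, map_zero]
    refine Prod.ext ?_ (by simp)
    simp only [Prod.fst_add]
    exact h
  retr_htpy a := by simp [R.retr_htpy, R.htpy_htpy]
  htpy_incl a := by simp [R.htpy_incl]
  htpy_htpy a := by simp [R.htpy_htpy]
  x_incl a := by simp [R.x_incl]
  retr_x a := by simp [R.retr_x, R.htpy_x, hδx]
  htpy_x a := by simp [R.htpy_x]

/-- A cone whose map `m` has a section `i`, as for a merge; `k` is a kernel of `m`. -/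
def DeformationRetract.ofMerge {d₀ x₀ : M →ₗ[ℚ] M} {d₁ x₁ : N →ₗ[ℚ] N}
    (m : M →ₗ[ℚ] N) (i k : N →ₗ[ℚ] M) (r : M →ₗ[ℚ] N)
    (hi : ∀ a, d₀ (i a) = i (d₁ a)) (hk : ∀ a, d₀ (k a) = k (d₁ a))
    (hr : ∀ a, r (d₀ a) = d₁ (r a)) (xi : ∀ a, x₀ (i a) = i (x₁ a))
    (xk : ∀ a, x₀ (k a) = k (x₁ a)) (xr : ∀ a, r (x₀ a) = x₁ (r a))
    (mi : ∀ a, m (i a) = a) (mk : ∀ a, m (k a) = 0) (rk : ∀ a, r (k a) = a)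
    (ri : ∀ a, r (i a) = 0) (h : ∀ a, k (r a) + i (m a) = a) :
    DeformationRetract (coneD d₀ d₁ m) (x₀.prodMap x₁) d₁ x₁ where
  incl := LinearMap.inl ℚ M N ∘ₗ k
  retr := r ∘ₗ LinearMap.fst ℚ M N
  htpy := LinearMap.inl ℚ M N ∘ₗ i ∘ₗ LinearMap.snd ℚ M N
  d_incl a := by simp [hk, mk]
  retr_d a := by simp [hr]
  retr_incl a := by simp [rk]
  incl_retr a := by
    refine Prod.ext ?_ ?_
    · simpa [hi] using h a.1
    · simp [mi]
  retr_htpy a := by simp [ri]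
  htpy_incl a := by simp
  htpy_htpy a := by simp
  x_incl a := by simp [xk]
  retr_x a := by simp [xr]
  htpy_x a := by simp [xi]

/-- A cone whose map `b` has a retraction `e`, as for a split; `p` is a cokernel of `b`. -/
def DeformationRetract.ofSplit {d₀ x₀ : M →ₗ[ℚ] M} {d₁ x₁ : N →ₗ[ℚ] N}
    (b i : M →ₗ[ℚ] N) (e p : N →ₗ[ℚ] M)
    (hi : ∀ a, d₁ (i a) = i (d₀ a)) (he : ∀ a, e (d₁ a) = d₀ (e a))
    (hp : ∀ a, p (d₁ a) = d₀ (p a)) (xi : ∀ a, x₁ (i a) = i (x₀ a))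
    (xe : ∀ a, e (x₁ a) = x₀ (e a)) (xp : ∀ a, p (x₁ a) = x₀ (p a))
    (eb : ∀ a, e (b a) = a) (pb : ∀ a, p (b a) = 0) (pi : ∀ a, p (i a) = a)
    (ei : ∀ a, e (i a) = 0) (h : ∀ a, b (e a) + i (p a) = a) :
    DeformationRetract (coneD d₀ d₁ b) (x₀.prodMap x₁) (-d₀) x₀ where
  -- The cokernel of `b` survives in the target of the cone, where the differential carries a minus
  -- sign; hence `-d₀`.
  incl := LinearMap.inr ℚ M N ∘ₗ i
  retr := p ∘ₗ LinearMap.snd ℚ M N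
  htpy := LinearMap.inl ℚ M N ∘ₗ e ∘ₗ LinearMap.snd ℚ M N
  d_incl a := by simp [hi]
  retr_d a := by simp [hp, pb]
  retr_incl a := by simp [pi]
  incl_retr a := by
    refine Prod.ext ?_ ?_
    · simp [eb, he]
    · simpa [add_comm] using h a.2
  retr_htpy a := by simp
  htpy_incl a := by simp [ei]
  htpy_htpy a := by simp
  x_incl a := by simp [xi]
  retr_x a := by simp [xp]
  htpy_x a := by simp [xe]

variable {M₀₀ M₀₁ M₁₀ M₁₁ : Type*} [AddCommGroup M₀₀] [Module ℚ M₀₀] [AddCommGroup M₀₁]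
  [Module ℚ M₀₁] [AddCommGroup M₁₀] [Module ℚ M₁₀] [AddCommGroup M₁₁] [Module ℚ M₁₁]

/-- The differential of the total complex of a commutative square. -/
abbrev squareD (d₀₀ : M₀₀ →ₗ[ℚ] M₀₀) (d₀₁ : M₀₁ →ₗ[ℚ] M₀₁) (d₁₀ : M₁₀ →ₗ[ℚ] M₁₀)
    (d₁₁ : M₁₁ →ₗ[ℚ] M₁₁) (s : M₀₀ →ₗ[ℚ] M₀₁) (b : M₀₀ →ₗ[ℚ] M₁₀) (b' : M₀₁ →ₗ[ℚ] M₁₁)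
    (m : M₁₀ →ₗ[ℚ] M₁₁) : (M₀₀ × M₀₁) × M₁₀ × M₁₁ →ₗ[ℚ] (M₀₀ × M₀₁) × M₁₀ × M₁₁ :=
  coneD (coneD d₀₀ d₀₁ s) (coneD d₁₀ d₁₁ m) (b.prodMap b')

/-- Cancelling a split `b` and a merge `m` in the total complex of a square. -/
def DeformationRetract.ofSquare {d₀₀ x₀₀ : M₀₀ →ₗ[ℚ] M₀₀} {d₀₁ x₀₁ : M₀₁ →ₗ[ℚ] M₀₁}
    {d₁₀ x₁₀ : M₁₀ →ₗ[ℚ] M₁₀} {d₁₁ x₁₁ : M₁₁ →ₗ[ℚ] M₁₁}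
    {s : M₀₀ →ₗ[ℚ] M₀₁} {b : M₀₀ →ₗ[ℚ] M₁₀} {b' : M₀₁ →ₗ[ℚ] M₁₁} {m : M₁₀ →ₗ[ℚ] M₁₁}
    (i : M₁₁ →ₗ[ℚ] M₁₀) (e : M₁₀ →ₗ[ℚ] M₀₀)
    (hs : ∀ a, s (d₀₀ a) = d₀₁ (s a)) (hb' : ∀ a, b' (d₀₁ a) = d₁₁ (b' a))
    (hi : ∀ a, d₁₀ (i a) = i (d₁₁ a)) (he : ∀ a, e (d₁₀ a) = d₀₀ (e a))
    (xs : ∀ a, s (x₀₀ a) = x₀₁ (s a)) (xb' : ∀ a, b' (x₀₁ a) = x₁₁ (b' a))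
    (xi : ∀ a, x₁₀ (i a) = i (x₁₁ a)) (xe : ∀ a, e (x₁₀ a) = x₀₀ (e a))
    (mi : ∀ a, m (i a) = a) (eb : ∀ a, e (b a) = a) (ei : ∀ a, e (i a) = 0)
    (comm : ∀ a, b' (s a) = m (b a))
    (h : ∀ a, b (e a) + i (m a) = a + i (m (b (e a)))) :
    DeformationRetract (squareD d₀₀ d₀₁ d₁₀ d₁₁ s b b' m)
      ((x₀₀.prodMap x₀₁).prodMap (x₁₀.prodMap x₁₁)) (-d₀₁) x₀₁ where
  -- The survivor is `M₀₁`. An element of it is completed by `i (b' a)` so that the components in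
  -- `M₁₁` cancel. The retraction subtracts the zigzag from `M₁₀` back along `e` and then along `s`.
  incl := (LinearMap.inr ℚ M₀₀ M₀₁).prod (LinearMap.inl ℚ M₁₀ M₁₁ ∘ₗ i ∘ₗ b')
  retr := LinearMap.snd ℚ M₀₀ M₀₁ ∘ₗ LinearMap.fst ℚ _ _ -
    s ∘ₗ e ∘ₗ LinearMap.fst ℚ M₁₀ M₁₁ ∘ₗ LinearMap.snd ℚ _ _
  htpy := (LinearMap.inl ℚ M₀₀ M₀₁ ∘ₗ e ∘ₗ LinearMap.fst ℚ M₁₀ M₁₁ ∘ₗ LinearMap.snd ℚ _ _).prod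
    (LinearMap.inl ℚ M₁₀ M₁₁ ∘ₗ (-i) ∘ₗ LinearMap.snd ℚ M₁₀ M₁₁ ∘ₗ LinearMap.snd ℚ _ _)
  d_incl a := by simp [hi, hb', mi]
  retr_d a := by simp [he, hs, eb]
  retr_incl a := by simp [ei]
  -- The hypothesis `h` reads `(1 - i m)(1 - b e) = 0`. Together with `e b = 1` and `e i = 0` it
  -- says that `M₁₀` is the direct sum of the images of `b` and `i`, the two pieces being cancelled.
  incl_retr a := by
    obtain ⟨⟨a00, a01⟩, a10, a11⟩ := a
    refine Prod.ext (Prod.ext ?_ ?_) (Prod.ext ?_ ?_)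
    · simp [he, eb]
    · simp
    · have := h a10
      simp [comm, hi]
      rw [← sub_eq_zero] at this ⊢
      rw [← this]
      abel
    · simp [mi]
  retr_htpy a := by simp [ei]
  htpy_incl a := by simp [ei]
  htpy_htpy a := by simp [ei]
  x_incl a := by simp [xi, xb']
  retr_x a := by simp [xe, xs]
  htpy_x a := by simp [xi, xe]

/-- The total complex of a square does not depend on which direction comes first. -/
def squareSwap : ((M₀₀ × M₀₁) × M₁₀ × M₁₁) ≃ₗ[ℚ] (M₀₀ × M₁₀) × M₀₁ × M₁₁ where
  -- The sign on the last corner compensates for exchanging the order of the two directions.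
  toFun a := ((a.1.1, a.2.1), (a.1.2, -a.2.2))
  invFun a := ((a.1.1, a.2.1), (a.1.2, -a.2.2))
  left_inv a := by simp
  right_inv a := by simp
  map_add' a b := by simp [add_comm]
  map_smul' r a := by simp

theorem squareSwap_squareD {d₀₀ : M₀₀ →ₗ[ℚ] M₀₀} {d₀₁ : M₀₁ →ₗ[ℚ] M₀₁}
    {d₁₀ : M₁₀ →ₗ[ℚ] M₁₀} {d₁₁ : M₁₁ →ₗ[ℚ] M₁₁}
    {s : M₀₀ →ₗ[ℚ] M₀₁} {b : M₀₀ →ₗ[ℚ] M₁₀} {b' : M₀₁ →ₗ[ℚ] M₁₁} {m : M₁₀ →ₗ[ℚ] M₁₁}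
    (a : (M₀₀ × M₀₁) × M₁₀ × M₁₁) :
    squareSwap (squareD d₀₀ d₀₁ d₁₀ d₁₁ s b b' m a) =
      squareD d₀₀ d₁₀ d₀₁ d₁₁ b s m b' (squareSwap a) := by
  refine Prod.ext (Prod.ext ?_ ?_) (Prod.ext ?_ ?_) <;> simp [squareSwap]
  abel

end DifferentialModule

/-! ### Functions of sign vectors -/

noncomputable section SignVectors

open scoped Polynomial

variable {E E' : Type*}

/-- Functions of a sign for every edge, with values in `ℚ[√t]`. -/
abbrev SignFun (E : Type*) : Type _ := (E → Bool) → ℚ[X]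

/-- The sign of a Boolean. -/
def boolSign (b : Bool) : ℚ[X] := if b then 1 else -1

@[simp] theorem boolSign_true : boolSign true = 1 := rfl

@[simp] theorem boolSign_false : boolSign false = -1 := rfl

theorem boolSign_not (b : Bool) : boolSign (!b) = -boolSign b := by cases b <;> simp

theorem boolSign_mul_self (b : Bool) : boolSign b * boolSign b = 1 := by cases b <;> simp

/-- The variable of an edge as a function of the signs. -/
def edgeVar (e : E) : SignFun E := fun σ => boolSign (σ e) * Polynomial.X

variable (E) in
/-- The functions that are polynomials in `t` and the variables of the edges. -/
def edgePoly : Subalgebra ℚ (SignFun E) :=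
  Algebra.adjoin ℚ (insert (fun _ => Polynomial.X ^ 2) (Set.range edgeVar))

theorem edgeVar_mem_edgePoly (e : E) : edgeVar e ∈ edgePoly E :=
  Algebra.subset_adjoin (Or.inr ⟨e, rfl⟩)

theorem X_sq_mem_edgePoly : (fun _ => Polynomial.X ^ 2 : SignFun E) ∈ edgePoly E :=
  Algebra.subset_adjoin (Or.inl rfl)

/-- A map of sign vectors every coordinate of which is a coordinate up to sign. -/
def IsSignSubst (φ : (E' → Bool) → E → Bool) : Prop :=
  ∀ e, ∃ (e' : E') (b : Bool), ∀ σ, φ σ e = xor b (σ e')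

/-- Precomposition sends the variable of an edge to plus or minus the variable of an edge and fixes
`t`, so it preserves the generated algebra. -/
theorem IsSignSubst.comp_mem_edgePoly {φ : (E' → Bool) → E → Bool} (hφ : IsSignSubst φ)
    {p : SignFun E} (hp : p ∈ edgePoly E) : p ∘ φ ∈ edgePoly E' := by
  induction hp using Algebra.adjoin_induction with
  | mem p hp =>
    rcases hp with rfl | ⟨e, rfl⟩
    · exact X_sq_mem_edgePoly
    · obtain ⟨e', b, h⟩ := hφ e
      cases b
      · have : edgeVar e ∘ φ = edgeVar e' := by
          funext σ; simp [edgeVar, h]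
        rw [this]; exact edgeVar_mem_edgePoly e'
      · have : edgeVar e ∘ φ = -edgeVar e' := by
          funext σ; simp [edgeVar, h, boolSign_not]
        rw [this]; exact neg_mem (edgeVar_mem_edgePoly e')
  | algebraMap r => exact (edgePoly E').algebraMap_mem r
  | add p q _ _ h1 h2 => exact add_mem h1 h2
  | mul p q _ _ h1 h2 => exact mul_mem h1 h2

open Classical in
/-- Polynomials in the variables of the edges, as functions on a set of sign vectors. -/
def vertexSpace (U : Set (E → Bool)) : Submodule ℚ (SignFun E) where
  carrier := {f | ∃ p ∈ edgePoly E, f = U.indicator p}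
  add_mem' := by
    rintro _ _ ⟨p, hp, rfl⟩ ⟨q, hq, rfl⟩
    exact ⟨p + q, add_mem hp hq, (Set.indicator_add' U p q).symm⟩
  zero_mem' := ⟨0, zero_mem _, by simp⟩
  smul_mem' := by
    rintro r _ ⟨p, hp, rfl⟩
    exact ⟨r • p, (edgePoly E).smul_mem hp r, (Set.indicator_const_smul U r p).symm⟩

theorem eq_zero_of_mem_vertexSpace {U : Set (E → Bool)} {f : SignFun E} (hf : f ∈ vertexSpace U)
    {σ : E → Bool} (hσ : σ ∉ U) : f σ = 0 := by
  obtain ⟨p, -, rfl⟩ := hf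
  exact Set.indicator_of_notMem hσ p

theorem mul_mem_vertexSpace {U : Set (E → Bool)} {p f : SignFun E} (hp : p ∈ edgePoly E)
    (hf : f ∈ vertexSpace U) : p * f ∈ vertexSpace U := by
  obtain ⟨q, hq, rfl⟩ := hf
  exact ⟨p * q, mul_mem hp hq, by funext σ; by_cases hσ : σ ∈ U <;> simp [hσ]⟩

theorem indicator_comp_mem_vertexSpace {U : Set (E → Bool)} {U' : Set (E' → Bool)}
    {φ : (E' → Bool) → E → Bool} (hφ : IsSignSubst φ) (hU : ∀ σ ∈ U', φ σ ∈ U) {f : SignFun E}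
    (hf : f ∈ vertexSpace U) : U'.indicator (f ∘ φ) ∈ vertexSpace U' := by
  obtain ⟨p, hp, rfl⟩ := hf
  refine ⟨p ∘ φ, hφ.comp_mem_edgePoly hp, ?_⟩
  funext σ
  by_cases hσ : σ ∈ U'
  · simp [hσ, hU σ hσ]
  · simp [hσ]

/-- The sign vector is constant on the arcs of the `b`-resolution of a crossing with ends `q`. -/
def Respects (b : Bool) (q : Fin 4 → E) (σ : E → Bool) : Prop :=
  match b with
  | false => σ (q 0) = σ (q 1) ∧ σ (q 2) = σ (q 3)
  | true => σ (q 0) = σ (q 3) ∧ σ (q 1) = σ (q 2)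

/-- The arcs of the two resolutions together connect all four ends. -/
theorem Respects.eq_of_not {b : Bool} {q : Fin 4 → E} {σ : E → Bool} (h : Respects b q σ)
    (h' : Respects (!b) q σ) (i : Fin 4) : σ (q i) = σ (q 0) := by
  cases b <;> simp only [Respects, Bool.not_false, Bool.not_true] at h h' <;> fin_cases i <;>
    simp [*]

theorem Respects.of_const {b : Bool} {q : Fin 4 → E} {σ : E → Bool}
    (h : ∀ i, σ (q i) = σ (q 0)) : Respects b q σ := by
  cases b <;> simp [Respects, h 1, h 2, h 3]

/-- Either resolution puts the ends `0` and `2` on different arcs. Given one resolution, the other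
therefore amounts to a single further equation. -/
theorem Respects.not_iff {b : Bool} {q : Fin 4 → E} {σ : E → Bool} (h : Respects b q σ) :
    Respects (!b) q σ ↔ σ (q 0) = σ (q 2) := by
  refine ⟨fun h' => (h.eq_of_not h' 2).symm, fun h02 => ?_⟩
  cases b <;> simp only [Respects, Bool.not_false, Bool.not_true] at h ⊢
  · exact ⟨by rw [h02, h.2], by rw [← h.1, h02]⟩
  · exact ⟨by rw [h.2, h02], by rw [← h.1, h02]⟩

theorem Respects.congr {b : Bool} {q : Fin 4 → E} {q' : Fin 4 → E'} {σ : E → Bool}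
    {σ' : E' → Bool} (h : ∀ i, σ (q i) = σ' (q' i)) : Respects b q σ ↔ Respects b q' σ' := by
  cases b <;> simp [Respects, h]

open Classical in
/-- The multiplier of the saddle map from the functions on `U` to those on `V`; at the saddle all
signs agree with that of the edge `p`. -/
def saddleWeight (U V : Set (E → Bool)) (p : E) : SignFun E := fun σ =>
  -- The inclusion `V ⊆ U` says that circles are merged. Otherwise the multiplier `X_j + X_k` of a
  -- split is `2 X_p` where the signs at the crossing agree, and it vanishes where opposite edges
  -- have opposite signs.
  if σ ∈ U ∧ σ ∈ V then (if V ⊆ U then 1 else 2 * edgeVar p σ) else 0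

open Classical in
theorem saddleWeight_of_mem {U V : Set (E → Bool)} (p : E) {σ : E → Bool} (hU : σ ∈ U)
    (hV : σ ∈ V) : saddleWeight U V p σ = if V ⊆ U then 1 else 2 * edgeVar p σ :=
  if_pos ⟨hU, hV⟩

theorem saddleWeight_eq_zero {U V : Set (E → Bool)} (p : E) {σ : E → Bool}
    (h : ¬(σ ∈ U ∧ σ ∈ V)) : saddleWeight U V p σ = 0 :=
  if_neg h

/-- The sign vectors for the four resolutions of two crossings with ends `q`, `q'`. -/
structure IsResolutionSquare (q q' : Fin 4 → E) (S : Bool → Bool → Set (E → Bool)) : Prop where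
  respects : ∀ {x y σ}, σ ∈ S x y → Respects x q σ
  respects' : ∀ {x y σ}, σ ∈ S x y → Respects y q' σ
  flip : ∀ {x y σ}, σ ∈ S x y → ∀ x', Respects x' q σ → σ ∈ S x' y
  flip' : ∀ {x y σ}, σ ∈ S x y → ∀ y', Respects y' q' σ → σ ∈ S x y'
  comb : ∀ {x y σ τ}, σ ∈ S x y → τ ∈ S x y → ∀ f : Bool → Bool → Bool,
    (fun e => f (σ e) (τ e)) ∈ S x y
  one : ∀ x y, Xor (S x y ⊆ S (!x) y) (S (!x) y ⊆ S x y)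
  one' : ∀ x y, Xor (S x y ⊆ S x (!y)) (S x (!y) ⊆ S x y)

namespace IsResolutionSquare

variable {q q' : Fin 4 → E} {S : Bool → Bool → Set (E → Bool)}

theorem symm (h : IsResolutionSquare q q' S) : IsResolutionSquare q' q (fun x y => S y x) where
  respects := h.respects'
  respects' := h.respects
  flip := h.flip'
  flip' := h.flip
  comb := h.comb
  one x y := h.one' y x
  one' x y := h.one y x

/-- Two saddles separated by an admissible sign vector `τ` do not influence each other. Multiplying
`z` by `τ` leaves `z` unchanged at the first crossing and makes it constant at the second, so the
product can change its resolution there; the hypothesis then constrains `z` at the first crossing.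
-/
theorem mask (h : IsResolutionSquare q q' S) {τ : E → Bool} (hτ : ∀ x y, τ ∈ S x y) (h1 : τ (q 0) = true)
    (h0 : τ (q' 0) = false) {x y : Bool} (hm : S (!x) y ⊆ S x y) :
    S (!x) (!y) ⊆ S x (!y) := by
  have hq : ∀ i, τ (q i) = true := fun i => by
    rw [← h1]; exact (h.respects (hτ true true)).eq_of_not (h.respects (hτ false true)) i
  have hq' : ∀ i, τ (q' i) = false := fun i => by
    rw [← h0]; exact (h.respects' (hτ true true)).eq_of_not (h.respects' (hτ true false)) i
  intro z hz
  refine h.flip hz x ?_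
  have h2 := h.comb hz (hτ (!x) (!y)) (· && ·)
  have h3 := hm (h.flip' h2 y (Respects.of_const fun i => by simp [hq']))
  exact (Respects.congr fun i => by simp [hq]).1 (h.respects h3)

theorem mask_iff (h : IsResolutionSquare q q' S) {τ : E → Bool} (hτ : ∀ x y, τ ∈ S x y)
    (h1 : τ (q 0) ≠ τ (q' 0)) {x y : Bool} : S (!x) y ⊆ S x y ↔ S (!x) (!y) ⊆ S x (!y) := by
  suffices ∃ τ : E → Bool, (∀ x y, τ ∈ S x y) ∧ τ (q 0) = true ∧ τ (q' 0) = false by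
    obtain ⟨τ, h1, h2, h3⟩ := this
    exact ⟨h.mask h1 h2 h3, fun hm => by simpa using h.mask h1 h2 h3 hm⟩
  cases h2 : τ (q 0)
  · exact ⟨fun e => !(τ e), fun x y => h.comb (hτ x y) (hτ x y) fun a _ => !a, by simp [h2],
      by cases h3 : τ (q' 0) <;> simp_all⟩
  · exact ⟨τ, hτ, h2, by cases h3 : τ (q' 0) <;> simp_all⟩

/-- A split adds one circle and so doubles the number of sign vectors. Within the larger set the
smaller one is cut out by the equation `σ (q 0) = σ (q 2)`, and its complement is its translate
under `xor` by any `z` violating that equation. -/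
theorem ncard_eq [Finite E] (h : IsResolutionSquare q q' S) {x y : Bool} (hm : ¬ S (!x) y ⊆ S x y) :
    (S (!x) y).ncard = 2 * (S x y).ncard := by
  have hle : S x y ⊆ S (!x) y := by
    rcases h.one x y with h | h
    · exact h.1
    · exact absurd h.1 hm
  obtain ⟨z, hz, hz'⟩ := Set.not_subset.1 hm
  have hzq : z (q 0) ≠ z (q 2) := fun h02 =>
    hz' (h.flip hz x (by simpa using (h.respects hz).not_iff.2 h02))
  have hmem : ∀ {σ}, σ ∈ S (!x) y → (σ ∈ S x y ↔ σ (q 0) = σ (q 2)) := fun {σ} hσ => by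
    rw [← (h.respects hσ).not_iff, Bool.not_not]
    exact ⟨fun h' => h.respects h', fun h' => h.flip hσ x h'⟩
  have himg : (fun σ e => xor (σ e) (z e)) '' S x y = S (!x) y \ S x y := by
    ext σ
    constructor
    · rintro ⟨τ, hτ, rfl⟩
      have h1 := h.comb (hle hτ) hz xor
      refine ⟨h1, fun h2 => hzq ?_⟩
      have h3 := (hmem h1).1 h2
      have h4 := (hmem (hle hτ)).1 hτ
      simp only [h4] at h3
      simpa using h3
    · rintro ⟨h1, h2⟩
      refine ⟨fun e => xor (σ e) (z e), (hmem (h.comb h1 hz xor)).2 ?_, by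
        funext e; simp⟩
      have h3 := mt (hmem h1).2 h2
      revert h3 hzq
      cases σ (q 0) <;> cases σ (q 2) <;> cases z (q 0) <;> cases z (q 2) <;> simp
  have hinj : Function.Injective (fun (σ : E → Bool) e => xor (σ e) (z e)) := fun σ τ hστ => by
    funext e
    simpa using congrFun hστ e
  have h1 := Set.ncard_sdiff_add_ncard_of_subset hle (Set.toFinite _)
  rw [← himg, Set.ncard_image_of_injective _ hinj] at h1
  omega

theorem ncard_eq_of_subset [Finite E] (h : IsResolutionSquare q q' S) {x y : Bool}
    (hm : S (!x) y ⊆ S x y) : (S x y).ncard = 2 * (S (!x) y).ncard := by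
  have h1 : ¬ S x y ⊆ S (!x) y := by
    rcases h.one x y with h | h
    · exact absurd hm h.2
    · exact h.2
  simpa using h.ncard_eq (x := !x) (by simpa using h1)

/-- This commutativity of the square replaces the usual list of configurations of two saddles. It
suffices to count the factors `2 X` along the two paths and to compare the edges whose variables
occur. -/
theorem saddleWeight_comm [Finite E] (h : IsResolutionSquare q q' S) (x y : Bool) :
    saddleWeight (S x y) (S (!x) y) (q 0) * saddleWeight (S (!x) y) (S (!x) (!y)) (q' 0) =
      saddleWeight (S x y) (S x (!y)) (q' 0) * saddleWeight (S x (!y)) (S (!x) (!y)) (q 0) := by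
  classical
  funext σ
  simp only [Pi.mul_apply]
  by_cases h00 : σ ∈ S x y
  swap
  · rw [saddleWeight_eq_zero _ (fun h => h00 h.1), zero_mul,
      saddleWeight_eq_zero _ (fun h => h00 h.1), zero_mul]
  by_cases h11 : σ ∈ S (!x) (!y)
  swap
  · rw [saddleWeight_eq_zero (q' 0) (fun h => h11 h.2), mul_zero,
      saddleWeight_eq_zero (q 0) (fun h => h11 h.2), mul_zero]
  have h10 : σ ∈ S (!x) y := h.flip h00 _ (h.respects h11)
  have h01 : σ ∈ S x (!y) := h.flip' h00 _ (h.respects' h11)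
  rw [saddleWeight_of_mem _ h00 h10, saddleWeight_of_mem _ h10 h11,
    saddleWeight_of_mem _ h00 h01, saddleWeight_of_mem _ h01 h11]
  -- If some common sign vector separates the crossings, parallel sides of the square have the same
  -- type by `mask_iff`. If none does, the two variables agree at `σ` and only the number of splits
  -- matters.
  by_cases hsep : ∃ τ ∈ S x y, τ ∈ S (!x) (!y) ∧ τ (q 0) ≠ τ (q' 0)
  · obtain ⟨τ, t00, t11, hne⟩ := hsep
    have t10 : τ ∈ S (!x) y := h.flip t00 _ (h.respects t11)
    have t01 : τ ∈ S x (!y) := h.flip' t00 _ (h.respects' t11)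
    have ht : ∀ x' y', τ ∈ S x' y' := by
      intro x' y'
      rcases Bool.eq_or_eq_not x' x with rfl | rfl <;>
        rcases Bool.eq_or_eq_not y' y with rfl | rfl <;> assumption
    rw [if_congr (h.mask_iff ht hne (x := x) (y := y)) rfl rfl,
      if_congr (h.symm.mask_iff (fun a b => ht b a) hne.symm (x := y) (y := x)) rfl rfl, mul_comm]
  · push Not at hsep
    have hp : edgeVar (q' 0) σ = edgeVar (q 0) σ := by
      simp only [edgeVar, hsep σ h00 h11]
    have hpos : 0 < (S x y).ncard := (Set.ncard_pos (Set.toFinite _)).2 ⟨σ, h00⟩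
    rw [hp]
    -- Each split doubles the number of sign vectors and each merge halves it. Both paths have the
    -- same end points and that number is positive, so they contain equally many splits.
    have c1 := h.ncard_eq (x := x) (y := y)
    have c1' := h.ncard_eq_of_subset (x := x) (y := y)
    have c2 := h.symm.ncard_eq (x := y) (y := !x)
    have c2' := h.symm.ncard_eq_of_subset (x := y) (y := !x)
    have c3 := h.symm.ncard_eq (x := y) (y := x)
    have c3' := h.symm.ncard_eq_of_subset (x := y) (y := x)
    have c4 := h.ncard_eq (x := x) (y := !y)
    have c4' := h.ncard_eq_of_subset (x := x) (y := !y)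
    split_ifs with g1 g2 g3 g4 g4 g3 g4 g4 g2 g3 g4 g4 g3 g4 g4 <;>
      simp only [g1, g2, g3, g4, not_true_eq_false, not_false_eq_true, forall_const,
        IsEmpty.forall_iff] at c1 c1' c2 c2' c3 c3' c4 c4' <;>
      first
        | (exfalso; omega)
        | ring1

end IsResolutionSquare

end SignVectors

/-! ### Cubes of resolutions -/

noncomputable section Cubes

open scoped Polynomial

variable {E E' : Type*} {n n' : ℕ}

/-- The number of coordinates before `c` at which `v` is true. -/
def signCount (v : Fin n → Bool) (c : Fin n) : ℕ :=
  (Finset.univ.filter fun d : Fin n => d < c ∧ v d = true).card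

theorem signCount_eq_sum (v : Fin n → Bool) (c : Fin n) :
    signCount v c = ∑ d, (if d < c then 1 else 0) * (v d).toNat := by
  rw [signCount, Finset.card_filter]
  refine Finset.sum_congr rfl fun d _ => ?_
  cases v d <;> simp

/-- A cube of resolutions: the ends of `n` crossings, and for every vertex the sign vectors on the
edges that are constant on the circles. -/
structure Cube (E : Type*) (n : ℕ) where
  /-- the sign vectors constant on the circles of a resolution -/
  S : (Fin n → Bool) → Set (E → Bool)
  /-- the ends of the crossings -/
  q : Fin n → Fin 4 → E
  respects : ∀ {v σ}, σ ∈ S v → ∀ c, Respects (v c) (q c) σ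
  flip : ∀ {v σ}, σ ∈ S v → ∀ c b, Respects b (q c) σ → σ ∈ S (Function.update v c b)
  comb : ∀ {v σ τ}, σ ∈ S v → τ ∈ S v → ∀ f : Bool → Bool → Bool,
    (fun e => f (σ e) (τ e)) ∈ S v
  one : ∀ v c, Xor (S v ⊆ S (Function.update v c (!v c))) (S (Function.update v c (!v c)) ⊆ S v)

namespace Cube

variable (Q : Cube E n) (Q' : Cube E' n)

variable {Q} in
theorem mem_update_iff {v : Fin n → Bool} {σ : E → Bool} (h : σ ∈ Q.S v) (c : Fin n) (b : Bool) :
    σ ∈ Q.S (Function.update v c b) ↔ Respects b (Q.q c) σ :=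
  ⟨fun h' => by simpa using Q.respects h' c, Q.flip h c b⟩

theorem isResolutionSquare (v : Fin n → Bool) {c c' : Fin n} (h : c ≠ c') :
    IsResolutionSquare (Q.q c) (Q.q c')
      fun x y => Q.S (Function.update (Function.update v c x) c' y) where
  respects {x y σ} hσ := by simpa [h] using Q.respects hσ c
  respects' {x y σ} hσ := by simpa using Q.respects hσ c'
  flip {x y σ} hσ x' h' := by
    have := Q.flip hσ c x' h'
    rwa [Function.update_comm h.symm, Function.update_idem] at this
  flip' {x y σ} hσ y' h' := by
    have := Q.flip hσ c' y' h'
    rwa [Function.update_idem] at this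
  comb hσ hτ f := Q.comb hσ hτ f
  one x y := by
    have := Q.one (Function.update (Function.update v c x) c' y) c
    rwa [Function.update_comm h.symm, Function.update_idem, Function.update_of_ne h,
      Function.update_self] at this
  one' x y := by
    have := Q.one (Function.update (Function.update v c x) c' y) c'
    rwa [Function.update_idem, Function.update_self] at this

/-- For a split the product is still polynomial, because the weight is the restriction of `X_0 +
X_2`: outside `Q.S v` the opposite ends `0` and `2` carry opposite signs, so this sum vanishes
there. -/
theorem saddleWeight_mul_mem (v : Fin n → Bool) (c : Fin n) (b : Bool) {f : SignFun E}
    (hf : f ∈ vertexSpace (Q.S v)) :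
    saddleWeight (Q.S v) (Q.S (Function.update v c b)) (Q.q c 0) * f ∈
      vertexSpace (Q.S (Function.update v c b)) := by
  classical
  obtain ⟨p, hp, rfl⟩ := hf
  by_cases hm : Q.S (Function.update v c b) ⊆ Q.S v
  · refine ⟨p, hp, ?_⟩
    funext σ
    by_cases hσ : σ ∈ Q.S (Function.update v c b)
    · simp [saddleWeight, hσ, hm hσ, hm]
    · simp [saddleWeight, hσ]
  · have hb : b = !v c := by
      rcases Bool.eq_or_eq_not b (v c) with rfl | h
      · exact absurd (by rw [Function.update_eq_self]) hm
      · exact h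
    subst hb
    have hle : Q.S v ⊆ Q.S (Function.update v c (!v c)) := by
      rcases Q.one v c with h | h
      · exact h.1
      · exact absurd h.1 hm
    refine ⟨(edgeVar (Q.q c 0) + edgeVar (Q.q c 2)) * p,
      mul_mem (add_mem (edgeVar_mem_edgePoly _) (edgeVar_mem_edgePoly _)) hp, ?_⟩
    funext σ
    by_cases hσ : σ ∈ Q.S v
    · have h02 := (Q.respects hσ c).not_iff.1 (by simpa using Q.respects (hle hσ) c)
      have : edgeVar (Q.q c 2) σ = edgeVar (Q.q c 0) σ := by simp [edgeVar, h02]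
      simp [saddleWeight, hσ, hle hσ, hm, this, two_mul]
    · by_cases hσ' : σ ∈ Q.S (Function.update v c (!v c))
      · have h02 : σ (Q.q c 0) ≠ σ (Q.q c 2) := fun h => hσ (by
          have h1 := Q.respects hσ' c
          rw [Function.update_self] at h1
          have := Q.flip hσ' c (v c) (by simpa using h1.not_iff.2 h)
          simpa using this)
        have : edgeVar (Q.q c 2) σ = -edgeVar (Q.q c 0) σ := by
          simp only [edgeVar]
          revert h02
          cases σ (Q.q c 0) <;> cases σ (Q.q c 2) <;> simp
        simp [saddleWeight, hσ, hσ', this]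
      · simp [saddleWeight, hσ, hσ']

/-- The chain module of a cube. -/
def space : Submodule ℚ ((Fin n → Bool) → SignFun E) :=
  Submodule.pi Set.univ fun v => vertexSpace (Q.S v)

variable {Q} in
theorem mem_space {F : (Fin n → Bool) → SignFun E} :
    F ∈ Q.space ↔ ∀ v, F v ∈ vertexSpace (Q.S v) := by
  simp [space, Submodule.mem_pi]

variable {Q} in
theorem space_ext {F G : Q.space} (h : ∀ v, ∀ σ ∈ Q.S v, F.1 v σ = G.1 v σ) : F = G := by
  refine Subtype.ext (funext fun v => funext fun σ => ?_)
  by_cases hσ : σ ∈ Q.S v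
  · exact h v σ hσ
  · rw [eq_zero_of_mem_vertexSpace (mem_space.1 F.2 v) hσ,
      eq_zero_of_mem_vertexSpace (mem_space.1 G.2 v) hσ]

variable {Q} in
theorem apply_of_notMem (F : Q.space) {v : Fin n → Bool} {σ : E → Bool} (h : σ ∉ Q.S v) :
    F.1 v σ = 0 :=
  eq_zero_of_mem_vertexSpace (mem_space.1 F.2 v) h

/-- The multiplier of the edge of the cube that ends at `v` in direction `c`. -/
def weight (v : Fin n → Bool) (c : Fin n) : SignFun E :=
  saddleWeight (Q.S (Function.update v c false)) (Q.S v) (Q.q c 0)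

theorem weight_mul_mem {v : Fin n → Bool} {c : Fin n} (hv : v c = true) {f : SignFun E}
    (hf : f ∈ vertexSpace (Q.S (Function.update v c false))) :
    Q.weight v c * f ∈ vertexSpace (Q.S v) := by
  have := Q.saddleWeight_mul_mem (Function.update v c false) c true hf
  rwa [Function.update_idem, Function.update_eq_self_iff.2 hv.symm] at this

/-- The differential on all families of functions. -/
def preD : ((Fin n → Bool) → SignFun E) →ₗ[ℚ] ((Fin n → Bool) → SignFun E) where
  toFun F v := ∑ c, if v c = true then
    (-1 : ℚ) ^ signCount v c • (Q.weight v c * F (Function.update v c false)) else 0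
  map_add' F G := by
    funext v
    simp only [Pi.add_apply, ← Finset.sum_add_distrib]
    refine Finset.sum_congr rfl fun c _ => ?_
    split_ifs
    · rw [mul_add, smul_add]
    · simp
  map_smul' r F := by
    funext v
    simp only [Pi.smul_apply, RingHom.id_apply, Finset.smul_sum]
    refine Finset.sum_congr rfl fun c _ => ?_
    split_ifs
    · rw [mul_smul_comm, smul_comm]
    · simp

theorem preD_apply (F : (Fin n → Bool) → SignFun E) (v : Fin n → Bool) :
    Q.preD F v = ∑ c, if v c = true then
      (-1 : ℚ) ^ signCount v c • (Q.weight v c * F (Function.update v c false)) else 0 := rfl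

/-- The differential of a cube. -/
def d : Q.space →ₗ[ℚ] Q.space :=
  Q.preD.restrict fun F hF => mem_space.2 fun v => by
    rw [preD_apply]
    refine Submodule.sum_mem _ fun c _ => ?_
    split_ifs with h
    · exact Submodule.smul_mem _ _ (Q.weight_mul_mem h (mem_space.1 hF _))
    · exact Submodule.zero_mem _

theorem d_apply (F : Q.space) (v : Fin n → Bool) :
    (Q.d F).1 v = ∑ c, if v c = true then
      (-1 : ℚ) ^ signCount v c • (Q.weight v c * F.1 (Function.update v c false)) else 0 := rfl

variable {Q Q'} in
/-- A map of chain modules given by a map at every vertex. -/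
def fiberMap (L : (Fin n → Bool) → SignFun E →ₗ[ℚ] SignFun E')
    (hL : ∀ v, ∀ f ∈ vertexSpace (Q.S v), L v f ∈ vertexSpace (Q'.S v)) : Q.space →ₗ[ℚ] Q'.space :=
  (LinearMap.pi fun v => L v ∘ₗ LinearMap.proj v).restrict fun _ hF => mem_space.2 fun v =>
    hL v _ (mem_space.1 hF v)

variable {Q Q'} in
@[simp]
theorem fiberMap_apply (L : (Fin n → Bool) → SignFun E →ₗ[ℚ] SignFun E')
    (hL : ∀ v, ∀ f ∈ vertexSpace (Q.S v), L v f ∈ vertexSpace (Q'.S v)) (F : Q.space)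
    (v : Fin n → Bool) : (fiberMap (Q' := Q') L hL F).1 v = L v (F.1 v) := rfl

variable {Q Q'} in
theorem fiberMap_d {L : (Fin n → Bool) → SignFun E →ₗ[ℚ] SignFun E'}
    (hL : ∀ v, ∀ f ∈ vertexSpace (Q.S v), L v f ∈ vertexSpace (Q'.S v))
    (h : ∀ v c, v c = true → ∀ f ∈ vertexSpace (Q.S (Function.update v c false)),
      L v (Q.weight v c * f) = Q'.weight v c * L (Function.update v c false) f) (F : Q.space) :
    fiberMap (Q' := Q') L hL (Q.d F) = Q'.d (fiberMap L hL F) := by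
  refine Subtype.ext (funext fun v => ?_)
  rw [fiberMap_apply, d_apply, d_apply, map_sum]
  refine Finset.sum_congr rfl fun c _ => ?_
  split_ifs with hv
  · rw [map_smul, h v c hv _ (mem_space.1 F.2 _), fiberMap_apply]
  · exact map_zero _

/-- Multiplication by the variable of an edge. -/
def x (e : E) : Q.space →ₗ[ℚ] Q.space :=
  fiberMap (fun _ => LinearMap.mulLeft ℚ (edgeVar e)) fun _ _ hf =>
    mul_mem_vertexSpace (edgeVar_mem_edgePoly e) hf

@[simp]
theorem x_apply (e : E) (F : Q.space) (v : Fin n → Bool) : (Q.x e F).1 v = edgeVar e * F.1 v := rfl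

theorem d_x (e : E) (F : Q.space) : Q.d (Q.x e F) = Q.x e (Q.d F) :=
  (fiberMap_d _ (fun v c _ f _ => by
    simp only [LinearMap.mulLeft_apply]; exact mul_left_comm _ _ _) F).symm

/-- The cube of the resolutions that have the value `b` at the first crossing. -/
def face (Q : Cube E (n + 1)) (b : Bool) : Cube E n where
  S w := Q.S (Fin.cons b w)
  q c := Q.q c.succ
  respects h c := by simpa using Q.respects h c.succ
  flip h c b' h' := by simpa [Fin.cons_update] using Q.flip h c.succ b' h'
  comb := Q.comb
  one w c := by simpa [Fin.cons_update] using Q.one (Fin.cons b w) c.succ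

section Face

variable (Q : Cube E (n + 1))

@[simp] theorem face_S (b : Bool) (w : Fin n → Bool) : (Q.face b).S w = Q.S (Fin.cons b w) := rfl

@[simp] theorem face_q (b : Bool) (c : Fin n) : (Q.face b).q c = Q.q c.succ := rfl

/-- The saddle maps at the first crossing. -/
def saddle (a b : Bool) : (Q.face a).space →ₗ[ℚ] (Q.face b).space :=
  fiberMap (fun w => LinearMap.mulLeft ℚ
    (saddleWeight (Q.S (Fin.cons a w)) (Q.S (Fin.cons b w)) (Q.q 0 0))) fun w f hf => by
      have := Q.saddleWeight_mul_mem (Fin.cons a w) 0 b hf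
      rwa [Fin.update_cons_zero] at this

@[simp]
theorem saddle_apply (a b : Bool) (F : (Q.face a).space) (w : Fin n → Bool) :
    (Q.saddle a b F).1 w =
      saddleWeight (Q.S (Fin.cons a w)) (Q.S (Fin.cons b w)) (Q.q 0 0) * F.1 w := rfl

/-- This is the commutativity of the two-dimensional faces spanned by the first crossing and one
other. -/
theorem saddle_d [Finite E] {a b : Bool} (hab : b = !a) (F : (Q.face a).space) :
    Q.saddle a b ((Q.face a).d F) = (Q.face b).d (Q.saddle a b F) := by
  subst hab
  refine fiberMap_d _ (fun w c hw f _ => ?_) F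
  have h := (Q.isResolutionSquare (Fin.cons a w) (Fin.succ_ne_zero c).symm).saddleWeight_comm
    a false
  have hw' : Function.update w c true = w := by rw [← hw, Function.update_eq_self]
  simp only [Fin.update_cons_zero, ← Fin.cons_update, Bool.not_false, hw'] at h
  simp only [LinearMap.mulLeft_apply, weight, face_S, face_q]
  rw [← mul_assoc, ← mul_assoc]
  congr 1
  rw [mul_comm, ← h, mul_comm]

theorem saddle_x (a b : Bool) (e : E) (F : (Q.face a).space) :
    Q.saddle a b ((Q.face a).x e F) = (Q.face b).x e (Q.saddle a b F) :=
  Subtype.ext <| funext fun w => by simp [mul_left_comm]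

/-- Splitting off the first crossing. -/
def consEquiv : Q.space ≃ₗ[ℚ] (Q.face false).space × (Q.face true).space where
  toFun F := (⟨fun w => F.1 (Fin.cons false w), mem_space.2 fun w => mem_space.1 F.2 _⟩,
    ⟨fun w => F.1 (Fin.cons true w), mem_space.2 fun w => mem_space.1 F.2 _⟩)
  invFun G := ⟨fun v => bif v 0 then G.2.1 (Fin.tail v) else G.1.1 (Fin.tail v),
    mem_space.2 fun v => by
      obtain ⟨b, w, rfl⟩ : ∃ b w, v = Fin.cons b w := ⟨v 0, Fin.tail v, (Fin.cons_self_tail v).symm⟩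
      cases b
      · exact mem_space.1 G.1.2 w
      · exact mem_space.1 G.2.2 w⟩
  left_inv F := by
    refine Subtype.ext (funext fun v => ?_)
    obtain ⟨b, w, rfl⟩ : ∃ b w, v = Fin.cons b w := ⟨v 0, Fin.tail v, (Fin.cons_self_tail v).symm⟩
    cases b <;> rfl
  right_inv G := rfl
  map_add' F G := rfl
  map_smul' r F := rfl

@[simp]
theorem consEquiv_fst (F : Q.space) (w : Fin n → Bool) :
    (Q.consEquiv F).1.1 w = F.1 (Fin.cons false w) := rfl

@[simp]
theorem consEquiv_snd (F : Q.space) (w : Fin n → Bool) :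
    (Q.consEquiv F).2.1 w = F.1 (Fin.cons true w) := rfl

theorem signCount_cons_zero (b : Bool) (w : Fin n → Bool) :
    signCount (Fin.cons b w : Fin (n + 1) → Bool) 0 = 0 := by
  simp [signCount]

theorem signCount_cons_succ (b : Bool) (w : Fin n → Bool) (c : Fin n) :
    signCount (Fin.cons b w : Fin (n + 1) → Bool) c.succ = b.toNat + signCount w c := by
  simp only [signCount_eq_sum, Fin.sum_univ_succ, Fin.cons_zero, Fin.cons_succ,
    Fin.succ_lt_succ_iff]
  simp

/-- The first crossing precedes all others: its own edges carry no sign, and it adds one sign to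
every other edge on the face where it has the `1`-resolution. This is the sign rule of a cone. -/
theorem consEquiv_d (F : Q.space) :
    Q.consEquiv (Q.d F) =
      coneD (Q.face false).d (Q.face true).d (Q.saddle false true) (Q.consEquiv F) := by
  have hw : ∀ b (w : Fin n → Bool) c, Q.weight (Fin.cons b w) c.succ = (Q.face b).weight w c :=
    fun b w c => by simp [weight, ← Fin.cons_update]
  refine Prod.ext (Subtype.ext (funext fun w => ?_)) (Subtype.ext (funext fun w => ?_))
  · rw [consEquiv_fst, d_apply, Fin.sum_univ_succ]
    simp only [Fin.cons_zero, Fin.cons_succ, signCount_cons_succ, hw, ← Fin.cons_update]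
    simp [d_apply]
  · rw [consEquiv_snd, d_apply, Fin.sum_univ_succ]
    simp only [Fin.cons_zero, Fin.cons_succ, signCount_cons_succ, signCount_cons_zero, hw,
      ← Fin.cons_update, Fin.update_cons_zero]
    change _ = (Q.saddle false true (Q.consEquiv F).1).1 w -
      ((Q.face true).d (Q.consEquiv F).2).1 w
    rw [saddle_apply, d_apply, sub_eq_add_neg, ← Finset.sum_neg_distrib]
    congr 1
    · simp [weight, Fin.update_cons_zero]
    · refine Finset.sum_congr rfl fun c _ => ?_
      split_ifs
      · simp [pow_add]
      · simp

theorem consEquiv_x (e : E) (F : Q.space) :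
    Q.consEquiv (Q.x e F) = ((Q.face false).x e).prodMap ((Q.face true).x e) (Q.consEquiv F) := rfl

theorem torsionBound_cone_iff (e : E) (k : ℕ) :
    TorsionBound Q.d (Q.x e) k ↔
      TorsionBound (coneD (Q.face false).d (Q.face true).d (Q.saddle false true))
        (((Q.face false).x e).prodMap ((Q.face true).x e)) k :=
  TorsionBound.equiv_iff Q.consEquiv Q.consEquiv_d (Q.consEquiv_x e)

end Face

theorem _root_.Function.update_comp_symm (ε : Fin n' ≃ Fin n) (v : Fin n' → Bool) (c : Fin n')
    (b : Bool) :
    Function.update v c b ∘ ε.symm = Function.update (v ∘ ε.symm) (ε c) b := by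
  rw [Function.update_comp_equiv, Equiv.symm_symm]

/-- The crossings of a cube in another order. -/
def reindex (ε : Fin n' ≃ Fin n) : Cube E n' where
  S v := Q.S (v ∘ ε.symm)
  q c := Q.q (ε c)
  respects h c := by simpa using Q.respects h (ε c)
  flip {v σ} h c b h' := by
    have := Q.flip h (ε c) b h'
    rwa [← Function.update_comp_symm] at this
  comb := Q.comb
  one v c := by
    have := Q.one (v ∘ ε.symm) (ε c)
    rw [Function.comp_apply, Equiv.symm_apply_apply] at this
    rwa [← Function.update_comp_symm] at this

/-- The number of pairs of true coordinates the order of which is reversed by `ε`. -/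
def inversionCount (ε : Fin n' ≃ Fin n) (v : Fin n' → Bool) : ℕ :=
  ∑ i, ∑ j, (if i < j ∧ ε j < ε i then 1 else 0) * ((v i).toNat * (v j).toNat)

/-- Making `c` true adds to the inversion count the number of true `j` whose order relative to `c`
is reversed by `ε`. Modulo two this is the difference between the numbers of true coordinates before
`c` in the two orders, so the twist by inversions corrects the signs of the differential. -/
theorem even_inversionCount (ε : Fin n' ≃ Fin n) {v : Fin n' → Bool} {c : Fin n'}
    (hv : v c = true) :
    Even (inversionCount ε v + inversionCount ε (Function.update v c false) +
      signCount (v ∘ ε.symm) (ε c) + signCount v c) := by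
  set u := Function.update v c false with hu
  have huv : ∀ i, (v i).toNat = (u i).toNat + if i = c then 1 else 0 := fun i => by
    by_cases h : i = c
    · subst h; simp [hu, hv]
    · simp [hu, h]
  have h1 : inversionCount ε v = inversionCount ε u +
      ∑ j, ((if j < c ∧ ε c < ε j then 1 else 0) + (if c < j ∧ ε j < ε c then 1 else 0)) *
        (u j).toNat := by
    simp only [inversionCount, huv, mul_add, add_mul, Finset.sum_add_distrib]
    simp
    ring
  have h2 : signCount (v ∘ ε.symm) (ε c) = ∑ j, (if ε j < ε c then 1 else 0) * (u j).toNat := by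
    rw [signCount_eq_sum, ← ε.sum_comp]
    refine Finset.sum_congr rfl fun j _ => ?_
    by_cases h : j = c
    · subst h; simp
    · simp [huv, h]
  have h3 : signCount v c = ∑ j, (if j < c then 1 else 0) * (u j).toNat := by
    rw [signCount_eq_sum]
    refine Finset.sum_congr rfl fun j _ => ?_
    by_cases h : j = c
    · subst h; simp
    · simp [huv, h]
  rw [h1, h2, h3]
  have h4 : ∀ a b c d : ℕ, a + b + a + c + d = 2 * a + (b + c + d) := fun a b c d => by ring
  rw [h4, ← Finset.sum_add_distrib, ← Finset.sum_add_distrib]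
  refine (even_two_mul _).add (Finset.even_sum _ fun j _ => ?_)
  rw [← add_mul, ← add_mul]
  refine Even.mul_right ?_ _
  rcases lt_trichotomy j c with h | rfl | h
  · rcases lt_trichotomy (ε j) (ε c) with h' | h' | h'
    · simp [h, h', h.not_gt, h'.not_gt]
    · exact absurd (ε.injective h') h.ne
    · simp [h, h', h.not_gt, h'.not_gt]
  · simp
  · rcases lt_trichotomy (ε j) (ε c) with h' | h' | h'
    · simp [h, h', h.not_gt, h'.not_gt]
    · exact absurd (ε.injective h') h.ne'
    · simp [h, h', h.not_gt, h'.not_gt]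

/-- Reordering the crossings, with the necessary signs. -/
def reindexEquiv (ε : Fin n' ≃ Fin n) : Q.space ≃ₗ[ℚ] (Q.reindex ε).space where
  toFun F := ⟨fun v => (-1 : ℚ) ^ inversionCount ε v • F.1 (v ∘ ε.symm), mem_space.2 fun v =>
    Submodule.smul_mem _ _ (mem_space.1 F.2 _)⟩
  invFun F := ⟨fun v => (-1 : ℚ) ^ inversionCount ε (v ∘ ε) • F.1 (v ∘ ε), mem_space.2 fun v =>
    Submodule.smul_mem _ _ (by
      have := mem_space.1 F.2 (v ∘ ε)
      change F.1 (v ∘ ε) ∈ vertexSpace (Q.S ((v ∘ ε) ∘ ε.symm)) at this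
      rwa [Function.comp_assoc, Equiv.self_comp_symm, Function.comp_id] at this)⟩
  left_inv F := by
    refine Subtype.ext (funext fun v => ?_)
    simp only [Function.comp_assoc, Equiv.self_comp_symm, Function.comp_id, smul_smul, ← mul_pow]
    simp
  right_inv F := by
    refine Subtype.ext (funext fun v => ?_)
    simp only [Function.comp_assoc, Equiv.symm_comp_self, Function.comp_id, smul_smul, ← mul_pow]
    simp
  map_add' F G := Subtype.ext (funext fun v => smul_add _ _ _)
  map_smul' r F := Subtype.ext (funext fun v => smul_comm _ r _)

theorem reindexEquiv_apply (ε : Fin n' ≃ Fin n) (F : Q.space) (v : Fin n' → Bool) :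
    (Q.reindexEquiv ε F).1 v = (-1 : ℚ) ^ inversionCount ε v • F.1 (v ∘ ε.symm) := rfl

theorem reindexEquiv_d (ε : Fin n' ≃ Fin n) (F : Q.space) :
    Q.reindexEquiv ε (Q.d F) = (Q.reindex ε).d (Q.reindexEquiv ε F) := by
  refine Subtype.ext (funext fun v => ?_)
  rw [reindexEquiv_apply, d_apply, d_apply, ← ε.sum_comp, Finset.smul_sum]
  refine Finset.sum_congr rfl fun c _ => ?_
  simp only [Function.comp_apply, Equiv.symm_apply_apply]
  split_ifs with hv
  · have hup : Function.update v c false ∘ ε.symm = Function.update (v ∘ ε.symm) (ε c) false := 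
      Function.update_comp_symm ε v c false
    have hw : (Q.reindex ε).weight v c = Q.weight (v ∘ ε.symm) (ε c) := by
      simp only [weight, reindex, hup]
    rw [reindexEquiv_apply, hup, hw, mul_smul_comm, smul_smul, smul_smul]
    congr 1
    have h := even_inversionCount ε hv
    have h1 : ((-1 : ℚ) ^ inversionCount ε v * (-1) ^ signCount (v ∘ ε.symm) (ε c)) *
        ((-1) ^ signCount v c * (-1) ^ inversionCount ε (Function.update v c false)) = 1 := by
      refine Eq.trans ?_ (h.neg_one_pow (α := ℚ))
      ring
    have h2 : ((-1 : ℚ) ^ signCount v c * (-1) ^ inversionCount ε (Function.update v c false)) *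
        ((-1) ^ signCount v c * (-1) ^ inversionCount ε (Function.update v c false)) = 1 := by
      rw [mul_mul_mul_comm, ← mul_pow, ← mul_pow]; simp
    exact mul_right_cancel₀ (right_ne_zero_of_mul_eq_one h1) (h1.trans h2.symm)
  · simp

theorem torsionBound_reindex_iff (ε : Fin n' ≃ Fin n) (e : E) (k : ℕ) :
    TorsionBound (Q.reindex ε).d ((Q.reindex ε).x e) k ↔ TorsionBound Q.d (Q.x e) k :=
  (TorsionBound.equiv_iff (Q.reindexEquiv ε) (Q.reindexEquiv_d ε) fun F =>
    Subtype.ext (funext fun v => by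
      simp [reindexEquiv_apply])).symm

end Cube

end Cubes

/-! ### Alternating orientations -/

section AlternatingOrientation

variable {E : Type*} {n : ℕ}

/-- Composing a permutation with a transposition either merges or splits cycles. -/
theorem Equiv.Perm.xor_invariant_mul_swap [Finite E] [DecidableEq E] (π : Equiv.Perm E) {a b : E}
    (hab : a ≠ b) :
    Xor ({σ : E → Bool | ∀ e, σ (π e) = σ e} ⊆ {σ | ∀ e, σ ((π * Equiv.swap a b) e) = σ e})
      ({σ : E → Bool | ∀ e, σ ((π * Equiv.swap a b) e) = σ e} ⊆ {σ | ∀ e, σ (π e) = σ e}) := by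
  classical
  have hswap : ∀ σ : E → Bool, σ a = σ b → ∀ e, σ (Equiv.swap a b e) = σ e := by
    intro σ h e
    rcases eq_or_ne e a with rfl | ha
    · simp [h]
    rcases eq_or_ne e b with rfl | hb
    · simp [h]
    · rw [Equiv.swap_apply_of_ne_of_ne ha hb]
  have hpow : ∀ σ : E → Bool, (∀ e, σ (π e) = σ e) → ∀ (k : ℕ) e, σ ((π ^ k) e) = σ e := by
    intro σ h k
    induction k with
    | zero => simp
    | succ k ih => intro e; rw [pow_succ', Equiv.Perm.mul_apply, h, ih]
  -- If `a` and `b` lie on one cycle of `π`, the transposition splits it and there are more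
  -- invariant functions; otherwise it joins two cycles and there are fewer.
  by_cases hsame : ∃ k : ℕ, (π ^ k) b = a
  · refine Or.inl ⟨fun σ hσ e => ?_, fun hle => ?_⟩
    · obtain ⟨k, hk⟩ := hsame
      rw [Equiv.Perm.mul_apply, hσ, hswap σ (by rw [← hk, hpow σ hσ])]
    -- The stretch `π b, …, π ^ k b = a`, with `k` minimal, is a union of cycles of the new
    -- permutation. It contains `a` but not `b`, so its indicator is invariant under the new
    -- permutation only.
    · set k := Nat.find hsame with hk
      have hka : (π ^ k) b = a := Nat.find_spec hsame
      have hmin : ∀ i < k, (π ^ i) b ≠ a := fun i hi => Nat.find_min hsame hi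
      have hk0 : 0 < k := Nat.pos_of_ne_zero fun h0 => hab (by rw [← hka, h0]; rfl)
      set T : Set E := {e | ∃ i, 0 < i ∧ i ≤ k ∧ (π ^ i) b = e} with hT
      have hbT : b ∉ T := by
        rintro ⟨i, h1, h2, h3⟩
        have h4 : (π ^ (k - i)) b = a := by
          rw [← hka, ← Nat.sub_add_cancel h2, pow_add, Equiv.Perm.mul_apply, h3]
          simp
        exact hmin _ (by omega) h4
      have haT : a ∈ T := ⟨k, hk0, le_rfl, hka⟩
      have hmaps : ∀ e ∈ T, (π * Equiv.swap a b) e ∈ T := by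
        rintro e ⟨i, h1, h2, rfl⟩
        rcases h2.lt_or_eq with h3 | rfl
        · rw [Equiv.Perm.mul_apply, Equiv.swap_apply_of_ne_of_ne (hmin i h3)
            (fun h => hbT ⟨i, h1, h2, h⟩)]
          exact ⟨i + 1, by omega, h3, by rw [pow_succ', Equiv.Perm.mul_apply]⟩
        · rw [hka, Equiv.Perm.mul_apply, Equiv.swap_apply_left]
          exact ⟨1, one_pos, hk0, by simp⟩
      have himg : (π * Equiv.swap a b) '' T = T :=
        Set.eq_of_subset_of_ncard_le (Set.image_subset_iff.2 hmaps)
          (Set.ncard_image_of_injective _ (Equiv.injective _)).ge (Set.toFinite _)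
      have hmem : (fun e => decide (e ∈ T)) ∈
          {σ : E → Bool | ∀ e, σ ((π * Equiv.swap a b) e) = σ e} := by
        intro e
        simp only [decide_eq_decide]
        refine ⟨fun h => ?_, hmaps e⟩
        rw [← himg] at h
        obtain ⟨e', he', h⟩ := h
        rwa [← (Equiv.injective _) h]
      have := hpow _ (hle hmem) k b
      simp [hka, hbT, haT] at this
  -- The new permutation sends `a` to `π b` and then follows the old cycle of `b`, which avoids `a`,
  -- until it returns to `b`. Hence invariant functions agree at `a` and `b`.
  · have hab' : ∀ σ : E → Bool, (∀ e, σ ((π * Equiv.swap a b) e) = σ e) → σ a = σ b := by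
      intro σ hσ
      have hex : ∃ k : ℕ, 0 < k ∧ (π ^ k) b = b :=
        ⟨orderOf π, orderOf_pos π, by simp [pow_orderOf_eq_one]⟩
      set k := Nat.find hex with hk
      obtain ⟨hk0, hkb⟩ : 0 < k ∧ (π ^ k) b = b := Nat.find_spec hex
      have key : ∀ i < k, σ ((π ^ (i + 1)) b) = σ a := by
        intro i
        induction i with
        | zero =>
          intro _
          have := hσ a
          rwa [Equiv.Perm.mul_apply, Equiv.swap_apply_left] at this
        | succ i ih =>
          intro hi
          have h1 : (π ^ (i + 1)) b ≠ a := fun h => hsame ⟨_, h⟩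
          have h2 : (π ^ (i + 1)) b ≠ b := fun h => Nat.find_min hex hi ⟨by omega, h⟩
          have := hσ ((π ^ (i + 1)) b)
          rw [Equiv.Perm.mul_apply, Equiv.swap_apply_of_ne_of_ne h1 h2, ← Equiv.Perm.mul_apply,
            ← pow_succ'] at this
          rw [this, ih (by omega)]
      have := key (k - 1) (by omega)
      rw [Nat.sub_add_cancel hk0, hkb] at this
      exact this.symm
    refine Or.inr ⟨fun σ hσ e => ?_, fun hle => hsame ?_⟩
    · have := hσ (Equiv.swap a b e)
      rw [Equiv.Perm.mul_apply, Equiv.swap_apply_self] at this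
      rw [this, hswap σ (hab' σ hσ)]
    · have hmem : (fun e => decide (π.SameCycle b e)) ∈ {σ : E → Bool | ∀ e, σ (π e) = σ e} :=
        fun e => by simp [Equiv.Perm.sameCycle_apply_right]
      have h1 := hab' _ (hle hmem)
      simp only [Equiv.Perm.SameCycle.refl, decide_true, decide_eq_true_eq] at h1
      obtain ⟨i, -, h2⟩ := h1.exists_pow_eq'
      exact ⟨i, h2⟩

/-- The end to which an end is joined in a resolution of a crossing. -/
def resolutionPartner (b : Bool) (i : Fin 4) : Fin 4 :=
  bif b then 3 - i else ![1, 0, 3, 2] i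

theorem resolutionPartner_resolutionPartner (b : Bool) (i : Fin 4) :
    resolutionPartner b (resolutionPartner b i) = i := by
  revert b i; decide

/-- Changing the resolution amounts to passing to the opposite end first. This is where the
transposition in `IsAlternating.xor_resolutionSet` comes from. -/
theorem resolutionPartner_not (b : Bool) (i : Fin 4) :
    resolutionPartner (!b) i = resolutionPartner b (i + 2) := by
  revert b i; decide

theorem respects_iff_resolutionPartner {b : Bool} {q : Fin 4 → E} {σ : E → Bool} :
    Respects b q σ ↔ ∀ i, σ (q (resolutionPartner b i)) = σ (q i) := by
  rw [Fin.forall_fin_succ, Fin.forall_fin_succ, Fin.forall_fin_two]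
  cases b
  · change _ ↔ σ (q 1) = σ (q 0) ∧ σ (q 0) = σ (q 1) ∧ σ (q 3) = σ (q 2) ∧ σ (q 2) = σ (q 3)
    simp only [Respects]
    constructor
    · rintro ⟨h1, h2⟩; simp [h1, h2]
    · rintro ⟨h1, -, h2, -⟩; simp [h1, h2]
  · change _ ↔ σ (q 3) = σ (q 0) ∧ σ (q 2) = σ (q 1) ∧ σ (q 1) = σ (q 2) ∧ σ (q 0) = σ (q 3)
    simp only [Respects]
    constructor
    · rintro ⟨h1, h2⟩; simp [h1, h2]
    · rintro ⟨h1, h2, -⟩; simp [h1, h2]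

/-- An orientation of the edges that alternates around every crossing; `o c i` says whether the
edge at the position `i` points towards `c`. -/
structure IsAlternating (q : Fin n → Fin 4 → E) (o : Fin n → Fin 4 → Bool) : Prop where
  succ : ∀ c i, o c (i + 1) = !o c i
  ends : ∀ {c i d j}, (c, i) ≠ (d, j) → q c i = q d j → o c i = !o d j
  exists_ends : ∀ e, ∃ c i d j, (c, i) ≠ (d, j) ∧ q c i = e ∧ q d j = e

/-- The sign vectors that are constant on the circles of a resolution. -/
def resolutionSet (q : Fin n → Fin 4 → E) (v : Fin n → Bool) : Set (E → Bool) :=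
  {σ | ∀ c, Respects (v c) (q c) σ}

/-- An alternating orientation makes each resolution join incoming ends to outgoing ones, so the
circles are the orbits of a permutation of the edges. Changing the resolution at `c` composes it
with the transposition of the two edges entering `c`, and `Equiv.Perm.xor_invariant_mul_swap`
applies. In particular a circle is never turned into a single circle. -/
theorem IsAlternating.xor_resolutionSet [Finite E] {q : Fin n → Fin 4 → E}
    {o : Fin n → Fin 4 → Bool} (h : IsAlternating q o) (v : Fin n → Bool) (c : Fin n) :
    Xor (resolutionSet q v ⊆ resolutionSet q (Function.update v c (!v c)))
      (resolutionSet q (Function.update v c (!v c)) ⊆ resolutionSet q v) := by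
  classical
  have ho2 : ∀ c i, o c (i + 2) = o c i := fun c i => by
    have := h.succ c (i + 1)
    rwa [h.succ c i, Bool.not_not, add_assoc] at this
  have hop : ∀ b c i, o c (resolutionPartner b i) = !o c i := by
    have h0 : ∀ c, o c 1 = !o c 0 ∧ o c 2 = o c 0 ∧ o c 3 = !o c 0 := fun c =>
      ⟨h.succ c 0, ho2 c 0, by rw [← h.succ, ← ho2 c (0 + 1)]; rfl⟩
    intro b c i
    obtain ⟨h1, h2, h3⟩ := h0 c
    cases b <;> fin_cases i <;> simp [resolutionPartner, h1, h2, h3]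
  have hin : ∀ e, ∃ x : Fin n × Fin 4, q x.1 x.2 = e ∧ o x.1 x.2 = true := by
    intro e
    obtain ⟨c, i, d, j, hne, h1, h2⟩ := h.exists_ends e
    have h3 := h.ends hne (h1.trans h2.symm)
    cases h4 : o c i
    · exact ⟨(d, j), h2, by simpa [h4] using h3⟩
    · exact ⟨(c, i), h1, h4⟩
  choose inn hinq hino using hin
  have huniq : ∀ x y : Fin n × Fin 4, q x.1 x.2 = q y.1 y.2 → o x.1 x.2 = o y.1 y.2 → x = y := by
    intro x y h1 h2
    by_contra hne
    have := h.ends (c := x.1) (i := x.2) (d := y.1) (j := y.2) hne h1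
    rw [h2] at this
    cases h5 : o y.1 y.2 <;> simp [h5] at this
  have hinn : ∀ d j, o d j = true → inn (q d j) = (d, j) := fun d j hdj =>
    huniq _ _ (hinq _) (by rw [hino, hdj])
  -- The successor of an edge on its circle: enter the crossing at the head of the edge and leave
  -- along the arc of the resolution.
  let f (v : Fin n → Bool) (e : E) : E :=
    q (inn e).1 (resolutionPartner (v (inn e).1) (inn e).2)
  have hf : ∀ v, Function.Injective (f v) := by
    intro v e e' hee
    have h1 := huniq ((inn e).1, resolutionPartner (v (inn e).1) (inn e).2)
      ((inn e').1, resolutionPartner (v (inn e').1) (inn e').2) hee (by simp [hop, hino])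
    obtain ⟨h2, h3⟩ := Prod.ext_iff.1 h1
    simp only at h2 h3
    rw [← hinq e, ← hinq e']
    have h4 := congrArg (resolutionPartner (v (inn e').1)) h3
    rw [h2, resolutionPartner_resolutionPartner, resolutionPartner_resolutionPartner] at h4
    rw [h2, h4]
  have hset : ∀ v, resolutionSet q v = {σ | ∀ e, σ (f v e) = σ e} := by
    intro v
    ext σ
    simp only [resolutionSet, Set.mem_ofPred_eq, respects_iff_resolutionPartner]
    constructor
    · intro hσ e
      have := hσ (inn e).1 (inn e).2
      rwa [hinq] at this
    · intro hσ d j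
      cases hdj : o d j
      · have h1 := hσ (q d (resolutionPartner (v d) j))
        simp only [f] at h1
        rw [hinn _ _ (by rw [hop, hdj]; rfl)] at h1
        simp only [resolutionPartner_resolutionPartner] at h1
        exact h1.symm
      · have h1 := hσ (q d j)
        simp only [f] at h1
        rwa [hinn _ _ hdj] at h1
  obtain ⟨i, hi⟩ : ∃ i, o c i = true := by
    cases h0 : o c 0
    · exact ⟨0 + 1, by rw [h.succ, h0]; rfl⟩
    · exact ⟨0, h0⟩
  have hab : q c i ≠ q c (i + 2) := fun h1 => by
    have := huniq (c, i) (c, i + 2) h1 (ho2 c i).symm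
    simp at this
  let π : Equiv.Perm E := Equiv.ofBijective (f v) (Finite.injective_iff_bijective.1 (hf v))
  -- Opposite ends have the same orientation, so the two edges entering `c` are at the positions `i`
  -- and `i + 2`.
  have hπ : ∀ e, f (Function.update v c (!v c)) e = (π * Equiv.swap (q c i) (q c (i + 2))) e := by
    intro e
    rw [Equiv.Perm.mul_apply]
    change _ = f v _
    by_cases he : (inn e).1 = c
    · have hj : (inn e).2 = i ∨ (inn e).2 = i + 2 := by
        have h1 := hino e
        rw [he] at h1
        have h2 : ∀ i j : Fin 4, j = i ∨ j = i + 2 ∨ j = i + 1 ∨ j = i + 2 + 1 := by decide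
        rcases h2 i (inn e).2 with h3 | h3 | h3 | h3
        · exact Or.inl h3
        · exact Or.inr h3
        · rw [h3, h.succ, hi] at h1; simp at h1
        · rw [h3, h.succ, ho2, hi] at h1; simp at h1
      rcases hj with hj | hj
      · have h1 : e = q c i := by rw [← hinq e, he, hj]
        rw [h1, Equiv.swap_apply_left]
        simp only [f]
        rw [hinn c i hi, hinn c (i + 2) ((ho2 c i).trans hi)]
        simp [resolutionPartner_not]
      · have h1 : e = q c (i + 2) := by rw [← hinq e, he, hj]
        rw [h1, Equiv.swap_apply_right]
        simp only [f]
        rw [hinn c i hi, hinn c (i + 2) ((ho2 c i).trans hi)]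
        have h4 : i + 2 + 2 = i := by rw [add_assoc]; exact add_zero i
        simp [resolutionPartner_not, h4]
    · rw [Equiv.swap_apply_of_ne_of_ne]
      · simp [f, he]
      · rintro rfl; exact he (by rw [hinn c i hi])
      · rintro rfl; exact he (by rw [hinn c _ ((ho2 c i).trans hi)])
  rw [hset, hset]
  simp only [hπ]
  exact π.xor_invariant_mul_swap hab

end AlternatingOrientation

/-! ### Checkerboard colourings of planar diagrams -/

namespace PDCode

variable {D : PDCode}

/-- An edge without ends would be a component by itself, which is impossible if there is a crossing
and only one component. -/
theorem IsKnotDiagram.exists_two_ends (h : D.IsKnotDiagram) (hn : 0 < D.n) (e : Fin D.m) :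
    ∃ x y : Fin D.n × Fin 4, x ≠ y ∧ D.ends x.1 x.2 = e ∧ D.ends y.1 y.2 = e := by
  rcases h.card_ends e with h0 | h2
  · exfalso
    have hempty : ∀ x : Fin D.n × Fin 4, D.ends x.1 x.2 ≠ e := by
      intro x hx
      rcases Nat.card_eq_zero.1 h0 with h1 | h1
      · exact h1.elim ⟨x, hx⟩
      · exact h1.not_finite inferInstance
    have key : ∀ a b, Relation.EqvGen D.Opposite a b → (a = e ↔ b = e) := by
      intro a b hab
      induction hab with
      | rel a b h =>
        obtain ⟨c, i, rfl, rfl⟩ := h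
        simp [hempty (c, i), hempty (c, i + 2)]
      | refl a => rfl
      | symm a b _ ih => exact ih.symm
      | trans a b c _ _ ih1 ih2 => exact ih1.trans ih2
    exact hempty (⟨0, hn⟩, 0) ((key _ _ (h.one_component e _)).1 rfl)
  · obtain ⟨x, y, hne, -⟩ := Nat.card_eq_two_iff.1 h2
    exact ⟨x.1, y.1, fun h => hne (Subtype.ext h), x.2, y.2⟩

theorem IsKnotDiagram.eq_or_eq_of_ends (h : D.IsKnotDiagram) {x y z : Fin D.n × Fin 4}
    (hxy : x ≠ y) (hx : D.ends x.1 x.2 = D.ends z.1 z.2) (hy : D.ends y.1 y.2 = D.ends z.1 z.2) :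
    z = x ∨ z = y := by
  rcases h.card_ends (D.ends z.1 z.2) with h0 | h2
  · rcases Nat.card_eq_zero.1 h0 with h1 | h1
    · exact (h1.false ⟨z, rfl⟩).elim
    · exact (h1.not_finite inferInstance).elim
  · by_contra hne
    push Not at hne
    have hinj : Function.Injective
        (![⟨x, hx⟩, ⟨y, hy⟩, ⟨z, rfl⟩] : Fin 3 → {x : Fin D.n × Fin 4 // D.ends x.1 x.2 =
          D.ends z.1 z.2}) := by
      clear h2
      intro i j hij
      fin_cases i <;> fin_cases j <;> simp_all [eq_comm]
    have := Nat.card_le_card_of_injective _ hinj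
    rw [h2] at this
    simp at this

theorem IsKnotDiagram.exists_otherEnd (h : D.IsKnotDiagram) (hn : 0 < D.n) :
    ∃ τ : Fin D.n × Fin 4 → Fin D.n × Fin 4, ∀ x y,
      (y ≠ x ∧ D.ends y.1 y.2 = D.ends x.1 x.2) ↔ y = τ x := by
  have key : ∀ x : Fin D.n × Fin 4, ∃ z, ∀ y,
      (y ≠ x ∧ D.ends y.1 y.2 = D.ends x.1 x.2) ↔ y = z := by
    intro x
    obtain ⟨a, b, hab, ha, hb⟩ := h.exists_two_ends hn (D.ends x.1 x.2)
    obtain ⟨z, hzx, hz⟩ : ∃ z, z ≠ x ∧ D.ends z.1 z.2 = D.ends x.1 x.2 := by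
      by_cases hax : a = x
      · exact ⟨b, fun hbx => hab (hax.trans hbx.symm), hb⟩
      · exact ⟨a, hax, ha⟩
    refine ⟨z, fun y => ⟨fun hy => ?_, ?_⟩⟩
    · exact (h.eq_or_eq_of_ends (z := y) hzx.symm hy.2.symm (hz.trans hy.2.symm)).resolve_left hy.1
    · rintro rfl; exact ⟨hzx, hz⟩
  choose τ hτ using key
  exact ⟨τ, hτ⟩

/-- A function of the ends that is constant at crossings and along edges is constant. -/
theorem IsKnotDiagram.eq_of_const {α : Type*} (h : D.IsKnotDiagram) (hn : 0 < D.n)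
    (g : Fin D.n × Fin 4 → α) (hc : ∀ c i j, g (c, i) = g (c, j))
    (he : ∀ x y, D.ends x.1 x.2 = D.ends y.1 y.2 → g x = g y) (x y : Fin D.n × Fin 4) :
    g x = g y := by
  have key : ∀ a b, Relation.EqvGen D.Opposite a b →
      ∀ x y, D.ends x.1 x.2 = a → D.ends y.1 y.2 = b → g x = g y := by
    intro a b hab
    induction hab with
    | rel a b h =>
      obtain ⟨c, i, rfl, rfl⟩ := h
      intro x y hx hy
      rw [he x (c, i) hx, hc c i (i + 2), he (c, i + 2) y hy.symm]
    | refl a => exact fun x y hx hy => he x y (hx.trans hy.symm)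
    | symm a b _ ih => exact fun x y hx hy => (ih y x hy hx).symm
    | trans a b c _ _ ih1 ih2 =>
      intro x y hx hy
      obtain ⟨z, -, -, hz, -⟩ := h.exists_two_ends hn b
      rw [ih1 x z hx hz, ih2 z y hz hy]
  exact key _ _ (h.one_component _ _) x y rfl rfl

/-- The ends are counted by crossings and by edges: `4 n = 2 m`. -/
theorem IsKnotDiagram.m_eq (h : D.IsKnotDiagram) (hn : 0 < D.n) : D.m = 2 * D.n := by
  have h1 : Nat.card (Fin D.n × Fin 4) = ∑ e : Fin D.m,
      Nat.card {x : Fin D.n × Fin 4 // D.ends x.1 x.2 = e} := by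
    rw [← Nat.card_sigma]
    exact Nat.card_congr (Equiv.sigmaFiberEquiv fun x : Fin D.n × Fin 4 => D.ends x.1 x.2).symm
  have h2 : ∀ e : Fin D.m, Nat.card {x : Fin D.n × Fin 4 // D.ends x.1 x.2 = e} = 2 := by
    intro e
    refine (h.card_ends e).resolve_left fun h0 => ?_
    obtain ⟨x, -, -, hx, -⟩ := h.exists_two_ends hn e
    rcases Nat.card_eq_zero.1 h0 with h1 | h1
    · exact h1.elim ⟨x, hx⟩
    · exact h1.not_finite inferInstance
  simp only [h2, Nat.card_eq_fintype_card, Fintype.card_prod, Fintype.card_fin,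
    Finset.sum_const, Finset.card_univ, smul_eq_mul] at h1
  omega

/-- A planar diagram has a checkerboard colouring, obtained here by linear algebra over the field
with two elements. Euler's formula makes the sequence from face colourings to edges to crossings
exact in the middle, and the all-ones vector on the edges lies in the kernel because every crossing
has four ends. A preimage of it takes different values on the two sides of every edge. -/
theorem IsKnotDiagram.exists_isAlternating (h : D.IsKnotDiagram) (hn : 0 < D.n) :
    ∃ o, IsAlternating D.ends o := by
  classical
  obtain ⟨τ, hτ⟩ := h.exists_otherEnd hn
  have hτne : ∀ x, τ x ≠ x := fun x => ((hτ x _).2 rfl).1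
  have hτe : ∀ x, D.ends (τ x).1 (τ x).2 = D.ends x.1 x.2 := fun x => ((hτ x _).2 rfl).2
  have hττ : ∀ x, τ (τ x) = x := fun x =>
    ((hτ (τ x) x).1 ⟨(hτne x).symm, (hτe x).symm⟩).symm
  have hadj : ∀ x : Fin D.n × Fin 4, (Quot.mk _ x : D.Face) = Quot.mk _ ((τ x).1, (τ x).2 - 1) :=
    fun x => Quot.sound ⟨(τ x).2, hτne x, hτe x, rfl⟩
  -- The two sides of the edge at position `i` of `c` are the corners `(c, i)` and `(c, i - 1)`.
  have hprev : ∀ c i, (Quot.mk _ (τ (c, i)) : D.Face) = Quot.mk _ (c, i - 1) := fun c i => by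
    rw [hadj, hττ]
  have hfib : ∀ (φ : Fin D.n × Fin 4 → ZMod 2) (x : Fin D.n × Fin 4),
      ∑ y, (if D.ends y.1 y.2 = D.ends x.1 x.2 then φ y else 0) = φ x + φ (τ x) := by
    intro φ x
    rw [← Finset.sum_filter, ← Finset.sum_pair (hτne x).symm]
    refine Finset.sum_congr ?_ fun _ _ => rfl
    ext y
    simp only [Finset.mem_filter, Finset.mem_univ, true_and, Finset.mem_insert,
      Finset.mem_singleton]
    rw [← hτ x y]
    by_cases hyx : y = x
    · simp [hyx]
    · simp [hyx]
  have hadd : ∀ a b : ZMod 2, a + b = 0 → a = b := by decide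
  have : Finite D.Face := inferInstanceAs (Finite (Quot D.CornerAdj))
  let _ : Fintype D.Face := Fintype.ofFinite _
  -- The incidence matrix modulo two, with loops counted twice.
  let A : Matrix (Fin D.n) (Fin D.m) (ZMod 2) := fun c e => ∑ i, if D.ends c i = e then 1 else 0
  have hA : ∀ z c, A.mulVecLin z c = ∑ i, z (D.ends c i) := by
    intro z c
    change ∑ e, (∑ i, if D.ends c i = e then 1 else 0) * z e = _
    simp only [Finset.sum_mul]
    rw [Finset.sum_comm]
    simp
  have hAt : ∀ g (x : Fin D.n × Fin 4),
      A.transpose.mulVecLin g (D.ends x.1 x.2) = g x.1 + g (τ x).1 := by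
    intro g x
    rw [← hfib (fun y => g y.1) x, Fintype.sum_prod_type]
    change ∑ c, (∑ i, if D.ends c i = D.ends x.1 x.2 then 1 else 0) * g c = _
    simp only [Finset.sum_mul, ite_mul, one_mul, zero_mul]
  -- The map `B` sends a colouring of the faces to the sum of the colours on the two sides of each
  -- edge.
  let B : (D.Face → ZMod 2) →ₗ[ZMod 2] (Fin D.m → ZMod 2) :=
    { toFun := fun col e => ∑ y : Fin D.n × Fin 4,
        if D.ends y.1 y.2 = e then col (Quot.mk _ y) else 0
      map_add' := fun a b => by
        funext e
        refine Eq.trans (Finset.sum_congr rfl fun y _ => ?_) Finset.sum_add_distrib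
        by_cases hy : D.ends y.1 y.2 = e
        · rw [if_pos hy, if_pos hy, if_pos hy]; rfl
        · rw [if_neg hy, if_neg hy, if_neg hy]; rfl
      map_smul' := fun r a => by
        funext e
        change _ = r • ∑ y : Fin D.n × Fin 4, if D.ends y.1 y.2 = e then a (Quot.mk _ y) else 0
        rw [Finset.smul_sum]
        refine Finset.sum_congr rfl fun y _ => ?_
        by_cases hy : D.ends y.1 y.2 = e
        · rw [if_pos hy, if_pos hy]; rfl
        · rw [if_neg hy, if_neg hy, smul_zero] }
  have hB : ∀ col (x : Fin D.n × Fin 4),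
      B col (D.ends x.1 x.2) = col (Quot.mk _ x) + col (Quot.mk _ (τ x)) := fun col x =>
    hfib (fun y => col (Quot.mk _ y)) x
  have hends : ∀ e, ∃ x : Fin D.n × Fin 4, D.ends x.1 x.2 = e := fun e => by
    obtain ⟨x, -, -, hx, -⟩ := h.exists_two_ends hn e
    exact ⟨x, hx⟩
  have hgen : ∀ {ι : Type} [Fintype ι] (V : Submodule (ZMod 2) (ι → ZMod 2)),
      (∀ g ∈ V, ∀ i j, g i = g j) → Module.finrank (ZMod 2) V ≤ 1 := by
    intro ι _ V hV
    have hle : V ≤ Submodule.span (ZMod 2) {fun _ => 1} := by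
      intro g hg
      rcases isEmpty_or_nonempty ι with hι | ⟨⟨i⟩⟩
      · have : g = 0 := funext fun i => hι.elim i
        rw [this]; exact zero_mem _
      · exact Submodule.mem_span_singleton.2 ⟨g i, funext fun j => by simp [hV g hg i j]⟩
    exact (Submodule.finrank_mono hle).trans ((finrank_span_le_card _).trans (by simp))
  -- An element of the kernel takes equal values at the two crossings of each edge, so it is
  -- constant by connectedness. This gives rank at least `n - 1` for `A`.
  have hkerAt : Module.finrank (ZMod 2) (LinearMap.ker A.transpose.mulVecLin) ≤ 1 := by
    refine hgen _ fun g hg c d => ?_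
    refine h.eq_of_const hn (fun x => g x.1) (fun _ _ _ => rfl) (fun x y hxy => ?_) (c, 0) (d, 0)
    by_cases hyx : y = x
    · rw [hyx]
    · have h1 := hAt g x
      rw [LinearMap.mem_ker.1 hg, Pi.zero_apply] at h1
      rw [hadd _ _ h1.symm, (hτ x y).1 ⟨hyx, hxy.symm⟩]
  -- A colouring in the kernel does not change across edges, hence is constant. This gives rank at
  -- least `n + 1` for `B`, as there are `n + 2` faces.
  have hkerB : Module.finrank (ZMod 2) (LinearMap.ker B) ≤ 1 := by
    refine hgen _ fun g hg => ?_
    have h1 : ∀ x, g (Quot.mk _ x) = g (Quot.mk _ (τ x)) := fun x => by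
      have h2 := hB g x
      rw [LinearMap.mem_ker.1 hg, Pi.zero_apply] at h2
      exact hadd _ _ h2.symm
    have h2 : ∀ c i, g (Quot.mk _ (c, i)) = g (Quot.mk _ (c, i - 1)) := fun c i => by
      rw [h1, hprev]
    have h3 : ∀ c i, g (Quot.mk _ (c, i)) = g (Quot.mk _ (c, 0)) := by
      intro c i
      have e1 := h2 c 1
      have e2 := h2 c 2
      have e3 := h2 c 3
      have d1 : (1 : Fin 4) - 1 = 0 := rfl
      have d2 : (2 : Fin 4) - 1 = 1 := rfl
      have d3 : (3 : Fin 4) - 1 = 2 := rfl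
      rw [d1] at e1; rw [d2] at e2; rw [d3] at e3
      fin_cases i
      · rfl
      · exact e1
      · exact e2.trans e1
      · exact e3.trans (e2.trans e1)
    intro i j
    induction i using Quot.ind with | mk x =>
    induction j using Quot.ind with | mk y =>
    refine h.eq_of_const hn (fun x => g (Quot.mk _ x)) (fun c i j => (h3 c i).trans (h3 c j).symm)
      (fun x y hxy => ?_) x y
    by_cases hyx : y = x
    · rw [hyx]
    · rw [(hτ x y).1 ⟨hyx, hxy.symm⟩, h1 x]
  have hface : Fintype.card D.Face = D.n + 2 := by
    rw [← Nat.card_eq_fintype_card]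
    exact h.planar.resolve_left hn.ne'
  -- Around a crossing every corner occurs in two of the four sums.
  have hle : LinearMap.range B ≤ LinearMap.ker A.mulVecLin := by
    rintro _ ⟨col, rfl⟩
    rw [LinearMap.mem_ker]
    funext c
    rw [hA]
    have h1 : ∀ i, B col (D.ends c i) = col (Quot.mk _ (c, i)) + col (Quot.mk _ (c, i - 1)) :=
      fun i => by rw [hB col (c, i), hprev]
    simp only [h1, Finset.sum_add_distrib]
    have h2 := (Equiv.subRight (1 : Fin 4)).sum_comp fun i => col (Quot.mk _ (c, i))
    simp only [Equiv.subRight_apply] at h2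
    rw [h2]
    exact CharTwo.add_self_eq_zero _
  have r1 := LinearMap.finrank_range_add_finrank_ker B
  have r2 := LinearMap.finrank_range_add_finrank_ker A.mulVecLin
  have r3 := LinearMap.finrank_range_add_finrank_ker A.transpose.mulVecLin
  have r4 := A.rank_transpose
  simp only [Matrix.rank] at r4
  simp only [Module.finrank_pi, hface, Fintype.card_fin] at r1 r2 r3
  have hm := h.m_eq hn
  -- The kernel of `A` has dimension at most `2 n - (n - 1) = n + 1`, which the range of `B` already
  -- attains.
  have heq : LinearMap.range B = LinearMap.ker A.mulVecLin :=
    Submodule.eq_of_le_of_finrank_le hle (by omega)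
  have hone : (fun _ => 1 : Fin D.m → ZMod 2) ∈ LinearMap.range B := by
    rw [heq, LinearMap.mem_ker]
    funext c
    rw [hA]
    simp; rfl
  obtain ⟨col, hcol⟩ := hone
  have hs : ∀ x, col (Quot.mk _ x) + col (Quot.mk _ (τ x)) = 1 := fun x => by
    rw [← hB, hcol]
  have hbool : ∀ a b : ZMod 2, a + b = 1 → decide (a = 1) = !decide (b = 1) := by decide
  -- The orientation of an edge is read off from the colour of the region on its left as seen when
  -- leaving the crossing. Colours alternate around a crossing and differ on the two sides of an
  -- edge.
  refine ⟨fun c i => decide (col (Quot.mk _ (c, i)) = 1), ⟨fun c i => ?_, ?_, fun e => ?_⟩⟩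
  · have := hs (c, i + 1)
    rw [hprev, add_sub_cancel_right] at this
    exact hbool _ _ this
  · intro c i d j hne heq
    have := hs (c, i)
    rw [← (hτ (c, i) (d, j)).1 ⟨hne.symm, heq.symm⟩] at this
    exact hbool _ _ this
  · obtain ⟨x, y, hne, hx, hy⟩ := h.exists_two_ends hn e
    exact ⟨x.1, x.2, y.1, y.2, hne, hx, hy⟩

end PDCode

/-- The cube of resolutions of a knot diagram. -/
def PDCode.IsKnotDiagram.cube {D : PDCode} (h : D.IsKnotDiagram) : Cube (Fin D.m) D.n where
  S := resolutionSet D.ends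
  q := D.ends
  respects h c := h c
  flip {v σ} h c b hb d := by
    by_cases hd : d = c
    · subst hd; simpa using hb
    · simpa [hd] using h d
  comb {v σ τ} hσ hτ f c := by
    rw [respects_iff_resolutionPartner]
    intro i
    simp only [respects_iff_resolutionPartner.1 (hσ c) i, respects_iff_resolutionPartner.1 (hτ c) i]
  one v c := by
    obtain ⟨o, ho⟩ := h.exists_isAlternating c.pos
    exact ho.xor_resolutionSet v c

/-! ### The Lee complex in terms of functions of sign vectors -/

noncomputable section

namespace PDCode

open scoped Polynomial

variable (D : PDCode)

/-- The coefficients in the edge ring. -/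
def coeffHom : ℚ[X] →+* D.EdgeRing :=
  (Ideal.Quotient.mk D.squareIdeal).comp MvPolynomial.C

variable {D} in
theorem edgeRing_induction {P : D.EdgeRing → Prop} (hC : ∀ p, P (D.coeffHom p))
    (hadd : ∀ a b, P a → P b → P (a + b)) (hx : ∀ a e, P a → P (a * D.x e)) (a : D.EdgeRing) :
    P a := by
  obtain ⟨p, rfl⟩ : ∃ p, Ideal.Quotient.mk D.squareIdeal p = a := Ideal.Quotient.mk_surjective a
  induction p using MvPolynomial.induction_on with
  | C a => exact hC a
  | add p q hp hq => exact hadd _ _ hp hq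
  | mul_X p e hp => exact hx _ e hp

theorem x_sq (e : Fin D.m) : D.x e ^ 2 = D.coeffHom Polynomial.X :=
  Ideal.Quotient.eq.2 (Ideal.subset_span ⟨e, rfl⟩)

/-- Evaluation of the elements of the edge ring at sign vectors. -/
def evalSign : D.EdgeRing →+* SignFun (Fin D.m) :=
  (Ideal.Quotient.lift D.squareIdeal
    (MvPolynomial.eval₂Hom (RingHom.pi fun _ => (Polynomial.expand ℚ 2).toRingHom) edgeVar) (by
      intro a ha
      refine (Ideal.span_le (I := RingHom.ker _)).2 ?_ ha
      rintro _ ⟨e, rfl⟩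
      refine RingHom.mem_ker.2 (funext fun σ => ?_)
      have : Polynomial.expand ℚ 2 Polynomial.X = Polynomial.X ^ 2 := Polynomial.expand_X _
      simp [edgeVar, mul_pow, sq (boolSign _), boolSign_mul_self, RingHom.pi, this]) :
    MvPolynomial (Fin D.m) ℚ[X] ⧸ D.squareIdeal →+* SignFun (Fin D.m))

theorem evalSign_x (e : Fin D.m) : D.evalSign (D.x e) = edgeVar e :=
  MvPolynomial.eval₂Hom_X' _ _ e

theorem evalSign_coeffHom (p : ℚ[X]) (σ : Fin D.m → Bool) :
    D.evalSign (D.coeffHom p) σ = Polynomial.expand ℚ 2 p :=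
  congrFun (MvPolynomial.eval₂Hom_C _ _ p) σ

theorem evalSign_mem_edgePoly (a : D.EdgeRing) : D.evalSign a ∈ edgePoly (Fin D.m) := by
  induction a using edgeRing_induction with
  | hC p =>
    have : D.evalSign (D.coeffHom p) =
        Polynomial.aeval (fun _ => Polynomial.X ^ 2 : SignFun (Fin D.m)) p := by
      funext σ
      rw [evalSign_coeffHom, Polynomial.expand_eq_sum, Polynomial.aeval_eq_sum_range,
        Polynomial.sum_over_range _ (by simp)]
      simp [Finset.sum_apply, Polynomial.smul_eq_C_mul]
    rw [this]
    rw [Polynomial.aeval_eq_sum_range]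
    exact sum_mem fun i _ => (edgePoly _).smul_mem (pow_mem X_sq_mem_edgePoly i) _
  | hadd a b ha hb => rw [map_add]; exact add_mem ha hb
  | hx a e ha => rw [map_mul, evalSign_x]; exact mul_mem ha (edgeVar_mem_edgePoly e)

theorem exists_evalSign_eq {p : SignFun (Fin D.m)} (hp : p ∈ edgePoly (Fin D.m)) :
    ∃ a, D.evalSign a = p := by
  induction hp using Algebra.adjoin_induction with
  | mem p hp =>
    rcases hp with rfl | ⟨e, rfl⟩
    · exact ⟨D.coeffHom Polynomial.X, funext fun σ => by rw [evalSign_coeffHom]; simp⟩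
    · exact ⟨D.x e, D.evalSign_x e⟩
  | algebraMap r =>
    exact ⟨D.coeffHom (Polynomial.C r), funext fun σ => by
      rw [evalSign_coeffHom, Polynomial.expand_C]; rfl⟩
  | add p q _ _ h1 h2 =>
    obtain ⟨a, rfl⟩ := h1
    obtain ⟨b, rfl⟩ := h2
    exact ⟨a + b, map_add _ _ _⟩
  | mul p q _ _ h1 h2 =>
    obtain ⟨a, rfl⟩ := h1
    obtain ⟨b, rfl⟩ := h2
    exact ⟨a * b, map_mul _ _ _⟩

variable {D}

theorem mem_resolutionSet_iff_arc {v : D.Vertex} {σ : Fin D.m → Bool} :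
    σ ∈ resolutionSet D.ends v ↔ ∀ c e f, D.ResolutionArc (v c) c e f → σ e = σ f := by
  refine forall_congr' fun c => ?_
  cases v c <;> simp only [Respects, ResolutionArc]
  · refine ⟨?_, fun h => ⟨h _ _ (Or.inl ⟨rfl, rfl⟩), h _ _ (Or.inr ⟨rfl, rfl⟩)⟩⟩
    rintro ⟨h1, h2⟩ e f (⟨rfl, rfl⟩ | ⟨rfl, rfl⟩) <;> assumption
  · refine ⟨?_, fun h => ⟨h _ _ (Or.inl ⟨rfl, rfl⟩), h _ _ (Or.inr ⟨rfl, rfl⟩)⟩⟩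
    rintro ⟨h1, h2⟩ e f (⟨rfl, rfl⟩ | ⟨rfl, rfl⟩) <;> assumption

theorem mem_resolutionSet_iff {v : D.Vertex} {σ : Fin D.m → Bool} :
    σ ∈ resolutionSet D.ends v ↔ ∀ e f, D.SameCircle v e f → σ e = σ f := by
  rw [mem_resolutionSet_iff_arc]
  refine ⟨fun h e f hef => ?_, fun h c e f hef => h e f (Relation.EqvGen.rel _ _ ⟨c, hef⟩)⟩
  induction hef with
  | rel e f h' => obtain ⟨c, hc⟩ := h'; exact h c e f hc
  | refl e => rfl
  | symm e f _ ih => exact ih.symm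
  | trans e f g _ _ ih1 ih2 => exact ih1.trans ih2

open Classical in
theorem circle_mem_resolutionSet (v : D.Vertex) (w : Fin D.m) :
    (fun e => decide (D.SameCircle v w e)) ∈ resolutionSet D.ends v := by
  refine mem_resolutionSet_iff.2 fun e f hef => ?_
  simp only [decide_eq_decide]
  exact ⟨fun h => h.trans _ _ _ hef, fun h => h.trans _ _ _ (hef.symm _ _)⟩

/-- Fewer circles mean fewer functions constant on them. Conversely the indicator of a circle of
`D_v` detects which edges lie on it. -/
theorem isMerge_iff {u v : D.Vertex} :
    D.IsMerge u v ↔ resolutionSet D.ends v ⊆ resolutionSet D.ends u := by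
  classical
  constructor
  · exact fun h σ hσ => mem_resolutionSet_iff.2 fun e f hef =>
      mem_resolutionSet_iff.1 hσ e f (h e f hef)
  · intro h p q hpq
    have := mem_resolutionSet_iff.1 (h (circle_mem_resolutionSet v p)) p q hpq
    have hp : D.SameCircle v p p := Relation.EqvGen.refl p
    simpa [hp] using this

theorem evalSign_eq_zero_of_mem {v : D.Vertex} {a : D.EdgeRing} (ha : a ∈ D.circleIdeal v)
    {σ : Fin D.m → Bool} (hσ : σ ∈ resolutionSet D.ends v) : D.evalSign a σ = 0 := by
  have : D.circleIdeal v ≤ RingHom.ker ((Pi.evalRingHom _ σ).comp D.evalSign) := by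
    refine Ideal.span_le.2 ?_
    rintro _ ⟨p, q, hpq, rfl⟩
    refine RingHom.mem_ker.2 ?_
    simp [evalSign_x, edgeVar, mem_resolutionSet_iff.1 hσ p q hpq]
  exact RingHom.mem_ker.1 (this ha)

variable (D) in
/-- The subring of the edge ring generated by the variables in `W` over the coefficients. -/
def varSubring (W : Set (Fin D.m)) : Subring D.EdgeRing :=
  Subring.closure (Set.range D.coeffHom ∪ D.x '' W)

theorem coeffHom_mem_varSubring (W : Set (Fin D.m)) (p : ℚ[X]) :
    D.coeffHom p ∈ D.varSubring W :=
  Subring.subset_closure (Or.inl ⟨p, rfl⟩)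

theorem x_mem_varSubring {W : Set (Fin D.m)} {e : Fin D.m} (he : e ∈ W) :
    D.x e ∈ D.varSubring W :=
  Subring.subset_closure (Or.inr ⟨e, he, rfl⟩)

/-- The square of `D.x w` is the coefficient `t`, so degree one in this variable suffices. -/
theorem exists_decomposition {W : Set (Fin D.m)} {w : Fin D.m} {a : D.EdgeRing}
    (ha : a ∈ D.varSubring (insert w W)) :
    ∃ a₀ ∈ D.varSubring W, ∃ a₁ ∈ D.varSubring W, a = a₀ + a₁ * D.x w := by
  induction ha using Subring.closure_induction with
  | mem a ha =>
    rcases ha with ⟨p, rfl⟩ | ⟨e, he | he, rfl⟩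
    · exact ⟨_, coeffHom_mem_varSubring W p, 0, zero_mem _, by simp⟩
    · exact ⟨0, zero_mem _, 1, one_mem _, by simp [he]⟩
    · exact ⟨_, x_mem_varSubring he, 0, zero_mem _, by simp⟩
  | zero => exact ⟨0, zero_mem _, 0, zero_mem _, by simp⟩
  | one => exact ⟨1, one_mem _, 0, zero_mem _, by simp⟩
  | add a b _ _ ha hb =>
    obtain ⟨a₀, h0, a₁, h1, rfl⟩ := ha
    obtain ⟨b₀, h0', b₁, h1', rfl⟩ := hb
    exact ⟨_, add_mem h0 h0', _, add_mem h1 h1', by ring⟩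
  | neg a _ ha =>
    obtain ⟨a₀, h0, a₁, h1, rfl⟩ := ha
    exact ⟨_, neg_mem h0, _, neg_mem h1, by ring⟩
  | mul a b _ _ ha hb =>
    obtain ⟨a₀, h0, a₁, h1, rfl⟩ := ha
    obtain ⟨b₀, h0', b₁, h1', rfl⟩ := hb
    refine ⟨a₀ * b₀ + a₁ * b₁ * D.coeffHom Polynomial.X,
      add_mem (mul_mem h0 h0') (mul_mem (mul_mem h1 h1') (coeffHom_mem_varSubring W _)),
      a₀ * b₁ + a₁ * b₀, add_mem (mul_mem h0 h1') (mul_mem h1 h0'), ?_⟩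
    rw [← D.x_sq w]
    ring

theorem evalSign_congr {W : Set (Fin D.m)} {a : D.EdgeRing} (ha : a ∈ D.varSubring W)
    {σ τ : Fin D.m → Bool} (h : ∀ e ∈ W, σ e = τ e) : D.evalSign a σ = D.evalSign a τ := by
  induction ha using Subring.closure_induction with
  | mem a ha =>
    rcases ha with ⟨p, rfl⟩ | ⟨e, he, rfl⟩
    · rw [evalSign_coeffHom, evalSign_coeffHom]
    · rw [evalSign_x, edgeVar, edgeVar, h e he]
  | zero => simp
  | one => simp
  | add a b _ _ ha hb => simp [ha, hb]
  | neg a _ ha => simp [ha]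
  | mul a b _ _ ha hb => simp [ha, hb]

/-- The variables are eliminated one at a time. A variable whose circle already carries a retained
variable is replaced by it modulo the ideal. Otherwise the sign on its circle can be flipped
independently, which separates the two coefficients. -/
theorem mem_circleIdeal_of_varSubring (v : D.Vertex) (W : Finset (Fin D.m)) :
    ∀ a ∈ D.varSubring W, (∀ σ ∈ resolutionSet D.ends v, D.evalSign a σ = 0) →
      a ∈ D.circleIdeal v := by
  classical
  induction W using Finset.induction_on with
  | empty =>
    intro a ha h
    have hle : D.varSubring (∅ : Finset (Fin D.m)) ≤ D.coeffHom.range := by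
      refine Subring.closure_le.2 ?_
      rintro a (⟨p, rfl⟩ | ⟨e, he, rfl⟩)
      · exact ⟨p, rfl⟩
      · simp at he
    obtain ⟨p, rfl⟩ := hle ha
    -- A constant sign vector is admissible for every resolution, and substituting `X ^ 2` for `t`
    -- is injective.
    have hp := h (fun _ => true) (mem_resolutionSet_iff.2 fun _ _ _ => rfl)
    rw [evalSign_coeffHom, Polynomial.expand_eq_zero two_pos] at hp
    rw [hp, map_zero]
    exact zero_mem _
  | insert w W hw ih =>
    intro a ha h
    rw [Finset.coe_insert] at ha
    obtain ⟨a₀, h0, a₁, h1, rfl⟩ := exists_decomposition ha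
    by_cases hex : ∃ w' ∈ W, D.SameCircle v w w'
    · obtain ⟨w', hw', hc⟩ := hex
      have hd : a₁ * (D.x w - D.x w') ∈ D.circleIdeal v := Ideal.mul_mem_left _ _ (x_sub_mem hc)
      have h2 : a₀ + a₁ * D.x w' ∈ D.circleIdeal v := by
        refine ih _ (add_mem h0 (mul_mem h1 (x_mem_varSubring hw'))) fun σ hσ => ?_
        have h3 := evalSign_eq_zero_of_mem hd hσ
        have h4 := h σ hσ
        have h5 : a₀ + a₁ * D.x w' = a₀ + a₁ * D.x w - a₁ * (D.x w - D.x w') := by ring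
        rw [h5, map_sub, Pi.sub_apply, h3, h4, sub_zero]
      have h5 : a₀ + a₁ * D.x w = a₀ + a₁ * D.x w' + a₁ * (D.x w - D.x w') := by ring
      rw [h5]
      exact add_mem h2 hd
    · push Not at hex
      -- The vector `τ` is `σ` with the sign flipped on the circle of `w`. Neither coefficient sees
      -- the flip, so the sum and the difference of the two values isolate `a₀` and `a₁`.
      have key : ∀ σ ∈ resolutionSet D.ends v, D.evalSign a₀ σ = 0 ∧ D.evalSign a₁ σ = 0 := by
        intro σ hσ
        set τ : Fin D.m → Bool := fun e => xor (σ e) (decide (D.SameCircle v w e)) with hτ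
        have hτm : τ ∈ resolutionSet D.ends v := mem_resolutionSet_iff.2 fun e f hef => by
          have := mem_resolutionSet_iff.1 (circle_mem_resolutionSet v w) e f hef
          simp only [hτ, mem_resolutionSet_iff.1 hσ e f hef, this]
        have hagree : ∀ e ∈ (W : Set (Fin D.m)), τ e = σ e := fun e he => by
          simp [hτ, hex e he]
        have hτw : τ w = !σ w := by
          have : D.SameCircle v w w := Relation.EqvGen.refl w
          simp [hτ, this]
        have e1 := h σ hσ
        have e2 := h τ hτm
        simp only [map_add, map_mul, Pi.add_apply, Pi.mul_apply, evalSign_x, edgeVar] at e1 e2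
        rw [evalSign_congr h0 hagree, evalSign_congr h1 hagree, hτw, boolSign_not] at e2
        have e3 : (2 : ℚ[X]) * D.evalSign a₀ σ = 0 := by linear_combination e1 + e2
        have e4 : (2 * boolSign (σ w) * Polynomial.X) * D.evalSign a₁ σ = 0 := by
          linear_combination e1 - e2
        have hs : boolSign (σ w) ≠ 0 := fun h0 => by
          have := boolSign_mul_self (σ w)
          simp [h0] at this
        exact ⟨by simpa using e3, by simpa [hs] using e4⟩
      exact add_mem (ih _ h0 fun σ hσ => (key σ hσ).1)
        (Ideal.mul_mem_right _ _ (ih _ h1 fun σ hσ => (key σ hσ).2))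

/-- The ideal of a vertex consists of the elements that vanish on its sign vectors. -/
theorem mem_circleIdeal_iff {v : D.Vertex} {a : D.EdgeRing} :
    a ∈ D.circleIdeal v ↔ ∀ σ ∈ resolutionSet D.ends v, D.evalSign a σ = 0 := by
  refine ⟨fun ha σ hσ => evalSign_eq_zero_of_mem ha hσ, fun h =>
    mem_circleIdeal_of_varSubring v Finset.univ a ?_ h⟩
  clear h
  induction a using edgeRing_induction with
  | hC p => exact coeffHom_mem_varSubring _ p
  | hadd a b ha hb => exact add_mem ha hb
  | hx a e ha => exact mul_mem ha (x_mem_varSubring (by simp))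

/-- The elements of a vertex module as functions on the sign vectors of the vertex. -/
def vertexRestrict (v : D.Vertex) : D.VertexModule v →+* (resolutionSet D.ends v → ℚ[X]) :=
  Ideal.Quotient.lift (D.circleIdeal v)
    (RingHom.pi fun σ => (Pi.evalRingHom _ σ.1).comp D.evalSign) fun _ ha =>
      funext fun σ => evalSign_eq_zero_of_mem ha σ.2

open Classical in
/-- The elements of a vertex module as functions of the signs. -/
def vertexFun (v : D.Vertex) : D.VertexModule v →+ SignFun (Fin D.m) where
  toFun a σ := if h : σ ∈ resolutionSet D.ends v then vertexRestrict v a ⟨σ, h⟩ else 0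
  map_zero' := by funext σ; simp
  map_add' a b := by funext σ; by_cases h : σ ∈ resolutionSet D.ends v <;> simp [h]

theorem vertexFun_mk (v : D.Vertex) (a : D.EdgeRing) :
    vertexFun v (Ideal.Quotient.mk _ a) = (resolutionSet D.ends v).indicator (D.evalSign a) := by
  classical
  funext σ
  by_cases h : σ ∈ resolutionSet D.ends v
  · rw [Set.indicator_of_mem h]
    exact dif_pos h
  · rw [Set.indicator_of_notMem h]
    exact dif_neg h

theorem vertexFun_injective (v : D.Vertex) : Function.Injective (vertexFun v) := by
  rw [injective_iff_map_eq_zero]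
  intro a ha
  obtain ⟨a, rfl⟩ := Ideal.Quotient.mk_surjective a
  rw [vertexFun_mk] at ha
  refine Ideal.Quotient.eq_zero_iff_mem.2 (mem_circleIdeal_iff.2 fun σ hσ => ?_)
  have := congrFun ha σ
  rwa [Set.indicator_of_mem hσ] at this

theorem vertexFun_mem (v : D.Vertex) (a : D.VertexModule v) :
    vertexFun v a ∈ vertexSpace (resolutionSet D.ends v) := by
  obtain ⟨a, rfl⟩ := Ideal.Quotient.mk_surjective a
  exact ⟨_, D.evalSign_mem_edgePoly a, vertexFun_mk v a⟩

theorem exists_vertexFun_eq (v : D.Vertex) {f : SignFun (Fin D.m)}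
    (hf : f ∈ vertexSpace (resolutionSet D.ends v)) : ∃ a, vertexFun v a = f := by
  obtain ⟨p, hp, rfl⟩ := hf
  obtain ⟨a, rfl⟩ := D.exists_evalSign_eq hp
  exact ⟨_, vertexFun_mk v a⟩

theorem vertexFun_smul (v : D.Vertex) (r : D.EdgeRing) (a : D.VertexModule v) :
    vertexFun v (r • a) = D.evalSign r * vertexFun v a := by
  obtain ⟨a, rfl⟩ := Ideal.Quotient.mk_surjective a
  have : r • (Ideal.Quotient.mk (D.circleIdeal v) a) = Ideal.Quotient.mk _ (r * a) := rfl
  rw [this, vertexFun_mk, vertexFun_mk, map_mul]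
  funext σ
  by_cases h : σ ∈ resolutionSet D.ends v <;> simp [h]

/-- For a split, the value of `X_0 + X_2` at a sign vector of `v` is `2 X_0` if the ends `0` and `2`
agree, which is exactly admissibility for `u`, and zero if they do not. -/
theorem vertexFun_edgeMap {c : Fin D.n} {u v : D.Vertex} (hu : u c = false) (hv : v c = true)
    (huv : ∀ d, d ≠ c → u d = v d) (a : D.VertexModule u) :
    vertexFun v (edgeMap c u v hu hv huv a) =
      saddleWeight (resolutionSet D.ends u) (resolutionSet D.ends v) (D.ends c 0) *
        vertexFun u a := by
  classical
  obtain ⟨a, rfl⟩ := Ideal.Quotient.mk_surjective a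
  by_cases hm : D.IsMerge u v
  · have h1 : edgeMap c u v hu hv huv (Ideal.Quotient.mk _ a) = Ideal.Quotient.mk _ a := by
      rw [edgeMap, dif_pos hm]; rfl
    rw [h1, vertexFun_mk, vertexFun_mk]
    have hm' := isMerge_iff.1 hm
    funext σ
    by_cases h : σ ∈ resolutionSet D.ends v
    · simp [saddleWeight, h, hm' h, hm']
    · simp [saddleWeight, h]
  · have h1 : edgeMap c u v hu hv huv (Ideal.Quotient.mk _ a) =
        Ideal.Quotient.mk _ ((D.x (D.ends c 0) + D.x (D.ends c 2)) * a) := by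
      rw [edgeMap, dif_neg hm]; rfl
    rw [h1, vertexFun_mk, vertexFun_mk]
    have hm' := mt isMerge_iff.2 hm
    funext σ
    by_cases h : σ ∈ resolutionSet D.ends v
    · have hc := h c
      have hiff : σ ∈ resolutionSet D.ends u ↔ σ (D.ends c 0) = σ (D.ends c 2) := by
        rw [← hc.not_iff, hv, Bool.not_true, ← hu]
        refine ⟨fun h' => h' c, fun h' d => ?_⟩
        by_cases hd : d = c
        · subst hd; exact h'
        · rw [huv d hd]; exact h d
      by_cases h02 : σ (D.ends c 0) = σ (D.ends c 2)
      · simp [saddleWeight, h, hiff.2 h02, hm', evalSign_x, edgeVar, h02, two_mul]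
      · have h3 : edgeVar (D.ends c 2) σ = -edgeVar (D.ends c 0) σ := by
          simp only [edgeVar]
          revert h02
          cases σ (D.ends c 0) <;> cases σ (D.ends c 2) <;> simp
        simp [saddleWeight, h, mt hiff.1 h02, evalSign_x, h3]
    · simp [saddleWeight, h]

namespace IsKnotDiagram

variable (h : D.IsKnotDiagram)

/-- The comparison of the Lee complex with the chain module of the cube of resolutions. -/
def leeFun : D.LeeComplex →+ h.cube.space where
  toFun F := ⟨fun v => vertexFun v (F v), Cube.mem_space.2 fun v => vertexFun_mem v (F v)⟩
  map_zero' := Subtype.ext (funext fun _ => map_zero _)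
  map_add' _ _ := Subtype.ext (funext fun _ => map_add _ _ _)

theorem leeFun_apply (F : D.LeeComplex) (v : D.Vertex) :
    (h.leeFun F).1 v = vertexFun v (F v) := rfl

theorem leeFun_injective : Function.Injective h.leeFun := fun _ _ hFG =>
  funext fun v => vertexFun_injective v (congrFun (congrArg Subtype.val hFG) v)

theorem leeFun_surjective : Function.Surjective h.leeFun := fun F => by
  choose a ha using fun v => exists_vertexFun_eq v (Cube.mem_space.1 F.2 v)
  exact ⟨a, Subtype.ext (funext ha)⟩

theorem leeFun_differential (F : D.LeeComplex) :
    h.leeFun (D.differential F) = h.cube.d (h.leeFun F) := by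
  refine Subtype.ext (funext fun v => ?_)
  rw [leeFun_apply, Cube.d_apply]
  simp only [differential, LinearMap.pi_apply, LinearMap.sum_apply, map_sum]
  refine Finset.sum_congr rfl fun c _ => ?_
  by_cases hv : v c = true
  · rw [dif_pos hv, if_pos hv, LinearMap.smul_apply, vertexFun_smul, LinearMap.comp_apply,
      vertexFun_edgeMap, leeFun_apply, map_pow, map_neg, map_one]
    have h1 : ∀ (k : ℕ) (f : SignFun (Fin D.m)), (-1) ^ k * f = (-1 : ℚ) ^ k • f := by
      intro k f
      rcases Nat.even_or_odd k with hk | hk <;> simp [hk.neg_one_pow]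
    exact h1 _ _
  · rw [dif_neg hv, if_neg hv, LinearMap.zero_apply, map_zero]

theorem leeFun_pow_smul (e : Fin D.m) (k : ℕ) (F : D.LeeComplex) :
    h.leeFun (D.x e ^ k • F) = (h.cube.x e ^ k) (h.leeFun F) := by
  induction k generalizing F with
  | zero => simp
  | succ k ih =>
    rw [pow_succ, mul_smul, ih, pow_succ, Module.End.mul_apply]
    congr 1
    refine Subtype.ext (funext fun v => ?_)
    rw [leeFun_apply, Pi.smul_apply, vertexFun_smul, evalSign_x, Cube.x_apply, leeFun_apply]

/-- Under `leeFun` a power of the variable kills a class of the Lee homology exactly when it turns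
the representing cycle into a boundary of the cube. -/
theorem maxTorsionOrder_le {e : Fin D.m} {k : ℕ}
    (hk : TorsionBound h.cube.d (h.cube.x e) k) :
    maxTorsionOrder D.LeeHomology (D.x e) ≤ k := by
  refine iSup₂_le fun a ha => ?_
  obtain ⟨n, hn⟩ := ha
  obtain ⟨⟨F, hF⟩, rfl⟩ := Submodule.Quotient.mk_surjective _ a
  have hiff : ∀ j : ℕ, D.x e ^ j • (Submodule.Quotient.mk ⟨F, hF⟩ : D.LeeHomology) = 0 ↔
      ∃ G, (h.cube.x e ^ j) (h.leeFun F) = h.cube.d G := by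
    intro j
    rw [← Submodule.Quotient.mk_smul, Submodule.Quotient.mk_eq_zero]
    constructor
    · rintro ⟨G, hG⟩
      refine ⟨h.leeFun G, ?_⟩
      rw [← h.leeFun_differential, hG, ← h.leeFun_pow_smul]
      rfl
    · rintro ⟨G, hG⟩
      obtain ⟨G, rfl⟩ := h.leeFun_surjective G
      refine ⟨G, h.leeFun_injective ?_⟩
      rw [h.leeFun_differential, ← hG, ← h.leeFun_pow_smul]
      rfl
  obtain ⟨G, hG⟩ := (hiff n).1 hn
  have hcyc : h.cube.d (h.leeFun F) = 0 := by
    rw [← h.leeFun_differential, LinearMap.mem_ker.1 hF, map_zero]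
  have := (hiff k).2 (hk _ hcyc ⟨n, G, hG⟩)
  exact Nat.cast_le.2 (Nat.sInf_le this)

end IsKnotDiagram

end PDCode

end

/-! ### Opposite edges and crossing changes -/

noncomputable section

namespace Cube

variable {E : Type*} {n : ℕ}

theorem ext_of_eq {Q Q' : Cube E n} (hS : ∀ v, Q.S v = Q'.S v) (hq : ∀ c i, Q.q c i = Q'.q c i) :
    Q = Q' := by
  obtain ⟨S, q, _, _, _, _⟩ := Q
  obtain ⟨S', q', _, _, _, _⟩ := Q'
  obtain rfl : S = S' := funext hS
  obtain rfl : q = q' := funext fun c => funext (hq c)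
  rfl

theorem exists_equiv_zero (c : Fin n) : ∃ (n' : ℕ) (ε : Fin (n' + 1) ≃ Fin n), ε 0 = c := by
  obtain ⟨n, rfl⟩ : ∃ n', n = n' + 1 := ⟨n - 1, by have := c.pos; omega⟩
  exact ⟨n, Equiv.swap 0 c, Equiv.swap_apply_left 0 c⟩

section

variable (Q : Cube E (n + 1))

theorem saddle_mem_iff {a b : Bool} (hab : b = !a) {w : Fin n → Bool} {σ : E → Bool}
    (h : σ ∈ Q.S (Fin.cons a w)) : σ ∈ Q.S (Fin.cons b w) ↔ σ (Q.q 0 0) = σ (Q.q 0 2) := by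
  subst hab
  have h1 := Q.mem_update_iff h 0 (!a)
  rw [Fin.update_cons_zero] at h1
  have h2 := Q.respects h 0
  rw [h1, Fin.cons_zero] at *
  exact h2.not_iff

theorem eq_of_mem_saddle {a b : Bool} (hab : b = !a) {w : Fin n → Bool} {σ : E → Bool}
    (h : σ ∈ Q.S (Fin.cons a w)) (h' : σ ∈ Q.S (Fin.cons b w)) (i : Fin 4) :
    σ (Q.q 0 i) = σ (Q.q 0 0) := by
  subst hab
  have h1 := Q.respects h 0
  have h2 := Q.respects h' 0
  rw [Fin.cons_zero] at h1 h2
  exact h1.eq_of_not h2 i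

theorem saddle_xor {a b : Bool} (hab : b = !a) (w : Fin n → Bool) :
    Xor (Q.S (Fin.cons a w) ⊆ Q.S (Fin.cons b w)) (Q.S (Fin.cons b w) ⊆ Q.S (Fin.cons a w)) := by
  subst hab
  simpa [Fin.update_cons_zero] using Q.one (Fin.cons a w) 0

/-- One of the two saddles is a merge and the other a split, so the product of weights is `2 X`
where all signs at the crossing agree. Elsewhere opposite ends have opposite signs, and both sides
vanish. -/
theorem saddle_saddle {a b : Bool} (hab : b = !a) (i : Fin 4) (F : (Q.face a).space) :
    Q.saddle b a (Q.saddle a b F) =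
      (Q.face a).x (Q.q 0 i) F + (Q.face a).x (Q.q 0 (i + 2)) F := by
  classical
  refine space_ext fun w σ hσ => ?_
  rw [face_S] at hσ
  rw [saddle_apply, saddle_apply]
  change saddleWeight _ _ _ σ * (saddleWeight _ _ _ σ * F.1 w σ) =
    edgeVar _ σ * F.1 w σ + edgeVar _ σ * F.1 w σ
  rw [← mul_assoc, ← add_mul]
  congr 1
  by_cases h : σ ∈ Q.S (Fin.cons b w)
  · rw [saddleWeight_of_mem _ h hσ, saddleWeight_of_mem _ hσ h]
    simp only [edgeVar, Q.eq_of_mem_saddle hab hσ h]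
    rcases Q.saddle_xor hab w with ⟨h1, h2⟩ | ⟨h1, h2⟩ <;> simp [h1, h2, two_mul]
  · rw [saddleWeight_eq_zero _ fun h' => h h'.1, zero_mul]
    have h02 := mt (Q.saddle_mem_iff hab hσ).2 h
    have h1 := Q.respects hσ 0
    have h3 : σ (Q.q 0 (i + 2)) = !σ (Q.q 0 i) := by
      rw [Fin.cons_zero] at h1
      cases a <;> obtain ⟨h1, h2⟩ := h1 <;> fin_cases i <;>
        simp_all <;> first | exact Bool.eq_not_iff.2 h02 | exact Bool.eq_not_iff.2 (Ne.symm h02)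
    simp [edgeVar, h3, boolSign_not]

/-- The reverse saddle as a homotopy. -/
def reverseSaddle : (Q.face false).space × (Q.face true).space →ₗ[ℚ]
    (Q.face false).space × (Q.face true).space :=
  LinearMap.inl ℚ _ _ ∘ₗ Q.saddle true false ∘ₗ LinearMap.snd ℚ _ _

theorem cone_x (e : E) (a : (Q.face false).space × (Q.face true).space) :
    coneD (Q.face false).d (Q.face true).d (Q.saddle false true)
        (((Q.face false).x e).prodMap ((Q.face true).x e) a) =
      ((Q.face false).x e).prodMap ((Q.face true).x e)
        (coneD (Q.face false).d (Q.face true).d (Q.saddle false true) a) :=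
  coneD_comm ((Q.face false).d_x e) ((Q.face true).d_x e) (Q.saddle_x _ _ e) a

variable [Finite E]

/-- The diagonal terms are the two composites of the saddles. The off-diagonal terms cancel because
the reverse saddle commutes with the differentials. -/
theorem x_add_x_homotopic (i : Fin 4) (a : (Q.face false).space × (Q.face true).space) :
    ((Q.face false).x (Q.q 0 i)).prodMap ((Q.face true).x (Q.q 0 i)) a +
      ((Q.face false).x (Q.q 0 (i + 2))).prodMap ((Q.face true).x (Q.q 0 (i + 2))) a =
    coneD (Q.face false).d (Q.face true).d (Q.saddle false true) (Q.reverseSaddle a) +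
      Q.reverseSaddle (coneD (Q.face false).d (Q.face true).d (Q.saddle false true) a) := by
  have h0 := Q.saddle_saddle (a := false) (b := true) rfl i a.1
  have h1 := Q.saddle_saddle (a := true) (b := false) rfl i a.2
  refine Prod.ext ?_ ?_
  · simp [reverseSaddle, h0, Q.saddle_d (a := true) (b := false) rfl]
  · simp [reverseSaddle, h1]

end

/-- With `c` placed first, the two actions are negatives of each other up to homotopy. -/
theorem torsionBound_opposite [Finite E] (Q : Cube E n) (c : Fin n) (i : Fin 4) {k : ℕ}
    (h : TorsionBound Q.d (Q.x (Q.q c i)) k) : TorsionBound Q.d (Q.x (Q.q c (i + 2))) k := by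
  obtain ⟨n', ε, rfl⟩ := exists_equiv_zero c
  rw [← Q.torsionBound_reindex_iff ε, torsionBound_cone_iff] at h ⊢
  exact h.of_add_homotopic ((Q.reindex ε).cone_x _) ((Q.reindex ε).cone_x _)
    ((Q.reindex ε).x_add_x_homotopic i)

section

variable (Q : Cube E (n + 1))

/-- The cube with the two resolutions of the first crossing exchanged. -/
def rotate : Cube E (n + 1) where
  S v := Q.S (Fin.cons (!v 0) (Fin.tail v))
  q := Fin.cons (fun i => Q.q 0 (i + 1)) fun c => Q.q c.succ
  respects {v σ} h c := by
    have h1 := Q.respects h c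
    cases c using Fin.cases with
    | zero =>
      simp only [Fin.cons_zero] at h1 ⊢
      cases h2 : v 0 <;> rw [h2] at h1 <;> simp only [Respects, Bool.not_true, Bool.not_false] at h1 ⊢
      · exact ⟨h1.2, h1.1.symm⟩
      · exact ⟨h1.1.symm, h1.2⟩
    | succ c => simpa [Fin.tail] using h1
  flip {v σ} h c b hb := by
    cases c using Fin.cases with
    | zero =>
      have h1 := Q.flip h 0 (!b) (by
        simp only [Fin.cons_zero] at hb
        cases b <;> simp only [Respects, Bool.not_true, Bool.not_false] at hb ⊢
        · exact ⟨hb.2.symm, hb.1⟩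
        · exact ⟨hb.1.symm, hb.2⟩)
      simpa [Fin.update_cons_zero] using h1
    | succ c =>
      have h1 := Q.flip h c.succ b (by simpa using hb)
      simpa [← Fin.cons_update, Function.update_of_ne (Fin.succ_ne_zero c).symm] using h1
  comb := Q.comb
  one v c := by
    cases c using Fin.cases with
    | zero =>
      have h1 := Q.one (Fin.cons (!v 0) (Fin.tail v)) 0
      simpa [Fin.update_cons_zero] using h1
    | succ c =>
      have h1 := Q.one (Fin.cons (!v 0) (Fin.tail v)) c.succ
      simpa [← Fin.cons_update, Fin.tail, Function.update_of_ne (Fin.succ_ne_zero c).symm] using h1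

theorem torsionBound_rotate_iff (e : E) (k : ℕ) :
    TorsionBound Q.rotate.d (Q.rotate.x e) k ↔
      TorsionBound (coneD (Q.face true).d (Q.face false).d (Q.saddle true false))
        (((Q.face true).x e).prodMap ((Q.face false).x e)) k := by
  rw [torsionBound_cone_iff]
  -- The rotation moves the marked end from position `0` to position `1`, but at a saddle all four
  -- ends have the same sign.
  have h : Q.rotate.saddle false true = Q.saddle true false := by
    refine LinearMap.ext fun F => space_ext fun w σ hσ => ?_
    change saddleWeight (Q.S (Fin.cons true w)) (Q.S (Fin.cons false w)) (Q.q 0 1) σ * F.1 w σ =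
      saddleWeight (Q.S (Fin.cons true w)) (Q.S (Fin.cons false w)) (Q.q 0 0) σ * F.1 w σ
    congr 1
    by_cases h : σ ∈ Q.S (Fin.cons true w) ∧ σ ∈ Q.S (Fin.cons false w)
    · rw [saddleWeight_of_mem _ h.1 h.2, saddleWeight_of_mem _ h.1 h.2, edgeVar, edgeVar,
        Q.eq_of_mem_saddle rfl h.1 h.2]
    · rw [saddleWeight_eq_zero _ h, saddleWeight_eq_zero _ h]
  exact iff_of_eq (congrArg (fun s => TorsionBound (coneD (Q.face true).d (Q.face false).d s)
    (((Q.face true).x e).prodMap ((Q.face false).x e)) k) h)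

/-- The difference of the variables of two opposite edges. -/
def xDiff (b : Bool) : (Q.face b).space →ₗ[ℚ] (Q.face b).space :=
  (Q.face b).x (Q.q 0 0) - (Q.face b).x (Q.q 0 2)

theorem xDiff_d (b : Bool) (F : (Q.face b).space) :
    Q.xDiff b ((Q.face b).d F) = (Q.face b).d (Q.xDiff b F) := by
  simp [xDiff, d_x]

theorem x_comm {n : ℕ} (Q : Cube E n) (e f : E) (F : Q.space) : Q.x e (Q.x f F) = Q.x f (Q.x e F) :=
  Subtype.ext <| funext fun _ => mul_left_comm _ _ _

theorem xDiff_x (b : Bool) (e : E) (F : (Q.face b).space) :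
    Q.xDiff b ((Q.face b).x e F) = (Q.face b).x e (Q.xDiff b F) := by
  simp only [xDiff, LinearMap.sub_apply, map_sub, (Q.face b).x_comm _ e]

/-- The image of a saddle is supported on sign vectors that agree at all four ends, where opposite
variables coincide. -/
theorem xDiff_saddle {a b : Bool} (hab : b = !a) (F : (Q.face a).space) :
    Q.xDiff b (Q.saddle a b F) = 0 := by
  refine space_ext fun w σ hσ => ?_
  rw [face_S] at hσ
  change edgeVar _ σ * (saddleWeight _ _ _ σ * F.1 w σ) -
    edgeVar _ σ * (saddleWeight _ _ _ σ * F.1 w σ) = 0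
  by_cases h : σ ∈ Q.S (Fin.cons a w)
  · simp [edgeVar, Q.eq_of_mem_saddle hab h hσ]
  · rw [saddleWeight_eq_zero _ fun h' => h h'.1]
    ring

theorem saddle_xDiff {a b : Bool} (hab : b = !a) (F : (Q.face a).space) :
    Q.saddle a b (Q.xDiff a F) = 0 := by
  have h := Q.xDiff_saddle hab F
  rwa [xDiff, LinearMap.sub_apply, ← saddle_x, ← saddle_x, ← map_sub] at h

variable [Finite E]

/-- A crossing change raises a bound on the order of torsion at most by one. -/
theorem torsionBound_of_rotate {k : ℕ}
    (h : TorsionBound Q.rotate.d (Q.rotate.x (Q.q 0 0)) k) :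
    TorsionBound Q.d (Q.x (Q.q 0 0)) (k + 1) := by
  rw [torsionBound_rotate_iff] at h
  rw [torsionBound_cone_iff]
  have s01 := Q.saddle_xDiff (a := false) (b := true) rfl
  have s10 := Q.saddle_xDiff (a := true) (b := false) rfl
  have t01 := Q.xDiff_saddle (a := false) (b := true) rfl
  have t10 := Q.xDiff_saddle (a := true) (b := false) rfl
  -- The maps are `(a, b) ↦ (Δ b, a)` in both directions, with `Δ = X_0 - X_2`. Since `Δ`
  -- annihilates saddles, they anticommute with the cone differentials; hence the negated witnesses.
  refine h.of_maps (j := 1)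
    ((Q.xDiff true ∘ₗ LinearMap.snd ℚ _ _).prod (LinearMap.fst ℚ _ _))
    ((Q.xDiff false ∘ₗ LinearMap.snd ℚ _ _).prod (LinearMap.fst ℚ _ _)) 2 two_ne_zero (Q.cone_x _)
    (fun a ha => ?_) (fun a => ⟨-((Q.xDiff true) a.2, a.1), ?_⟩)
    (fun a => ⟨-((Q.xDiff false) a.2, a.1), ?_⟩) (fun a => ?_) (fun a => ?_) (fun a ha => ?_)
  · have h1 := congrArg Prod.fst ha
    have h2 := congrArg (Q.xDiff true ∘ Prod.snd) ha
    simp [t01, xDiff_d] at h1 h2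
    simp [s10, h1, h2]
  · rw [map_neg]; simp [t01, s10, xDiff_d]
  · rw [map_neg]; simp [t10, s01, xDiff_d]
  · simp [xDiff_x]
  · simp [xDiff_x]
  -- The composite is `Δ = 2 X_0 - (X_0 + X_2)`, and the last sum is null-homotopic.
  · have h1 := Q.x_add_x_homotopic 0 a
    rw [ha, map_zero, add_zero] at h1
    refine ⟨-Q.reverseSaddle a, ?_⟩
    rw [map_neg, ← h1, pow_one, two_smul]
    refine Prod.ext ?_ ?_ <;> simp [xDiff] <;> abel

end

end Cube

namespace PDCode.IsKnotDiagram

variable {D : PDCode} (h : D.IsKnotDiagram)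

/-- The torsion bound does not depend on the edge that defines the action. -/
theorem torsionBound_of_edge {e : Fin D.m} {k : ℕ} (hk : TorsionBound h.cube.d (h.cube.x e) k)
    (f : Fin D.m) : TorsionBound h.cube.d (h.cube.x f) k := by
  have key : ∀ e f, Relation.EqvGen D.Opposite e f →
      (TorsionBound h.cube.d (h.cube.x e) k ↔ TorsionBound h.cube.d (h.cube.x f) k) := by
    intro e f hef
    induction hef with
    | rel e f hef =>
      obtain ⟨c, i, rfl, rfl⟩ := hef
      refine ⟨h.cube.torsionBound_opposite c i, fun h' => ?_⟩
      have := h.cube.torsionBound_opposite c (i + 2) h'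
      rwa [add_assoc, show (2 : Fin 4) + 2 = 0 from rfl, add_zero] at this
    | refl e => rfl
    | symm e f _ ih => exact ih.symm
    | trans e f g _ _ ih1 ih2 => exact ih1.trans ih2
  exact (key e f (h.one_component e f)).1 hk

/-- Rotating the four positions by one step exchanges the two resolutions, so the cube of the
changed diagram is the rotated cube once `c` is put first. -/
theorem torsionBound_of_crossingChange (c : Fin D.n) (h' : (D.crossingChange c).IsKnotDiagram)
    {k : ℕ} (hk : ∀ e, TorsionBound h'.cube.d (h'.cube.x e) k) (e : Fin D.m) :
    TorsionBound h.cube.d (h.cube.x e) (k + 1) := by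
  obtain ⟨n, ε, hε⟩ := Cube.exists_equiv_zero c
  have heq : (h.cube.reindex ε).rotate = h'.cube.reindex ε := by
    refine Cube.ext_of_eq (fun v => ?_) fun d i => ?_
    · ext σ
      refine forall_congr' fun d => ?_
      obtain ⟨d, rfl⟩ := ε.surjective d
      cases d using Fin.cases with
      | zero =>
        change Respects _ (D.ends (ε 0)) σ ↔
          Respects (v (ε.symm (ε 0))) ((D.crossingChange c).ends (ε 0)) σ
        have h1 : ∀ i, (D.crossingChange c).ends (ε 0) i = D.ends (ε 0) (i + 1) := fun i =>
          if_pos hε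
        simp only [Function.comp_apply, Equiv.symm_apply_apply, Fin.cons_zero]
        cases v 0 <;> simp only [Respects, Bool.not_true, Bool.not_false, h1]
        · exact ⟨fun h => ⟨h.2, h.1.symm⟩, fun h => ⟨h.2.symm, h.1⟩⟩
        · exact ⟨fun h => ⟨h.1.symm, h.2⟩, fun h => ⟨h.1.symm, h.2⟩⟩
      | succ d =>
        change Respects _ (D.ends (ε d.succ)) σ ↔
          Respects (v (ε.symm (ε d.succ))) ((D.crossingChange c).ends (ε d.succ)) σ
        have h1 : ε d.succ ≠ c := fun h1 => Fin.succ_ne_zero d (ε.injective (h1.trans hε.symm))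
        simp only [Function.comp_apply, Equiv.symm_apply_apply, Fin.cons_succ]
        have h2 : (D.crossingChange c).ends (ε d.succ) = D.ends (ε d.succ) :=
          funext fun i => if_neg h1
        rw [h2]
        rfl
    · cases d using Fin.cases with
      | zero => exact (if_pos hε).symm
      | succ d =>
        exact (if_neg fun h1 => Fin.succ_ne_zero d (ε.injective (h1.trans hε.symm))).symm
  refine h.torsionBound_of_edge (e := D.ends c 0) ?_ e
  have h1 := (h'.cube.torsionBound_reindex_iff ε (D.ends c 0) k).2 (hk _)
  rw [← heq] at h1
  rw [← h.cube.torsionBound_reindex_iff ε, ← hε]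
  rw [← hε] at h1
  exact (h.cube.reindex ε).torsionBound_of_rotate h1

end PDCode.IsKnotDiagram

end

/-! ### Pullbacks along maps of sign vectors -/

noncomputable section

open scoped Polynomial

namespace Cube

variable {E E' : Type*} {n : ℕ}

/-- Restriction to `U` of the pullback of a function of signs. -/
def pullbackFun (φ : (E' → Bool) → E → Bool) (U : Set (E' → Bool)) :
    SignFun E →ₗ[ℚ] SignFun E' where
  toFun f := U.indicator (f ∘ φ)
  map_add' f g := Set.indicator_add' U (f ∘ φ) (g ∘ φ)
  map_smul' r f := Set.indicator_const_smul U r (f ∘ φ)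

/-- The weights of saddles correspond to each other under maps of sign vectors. -/
theorem saddleWeight_comp_eq {A B : Set (E → Bool)} {A' B' : Set (E' → Bool)} {p : E} {p' : E'}
    {φ ψ : (E' → Bool) → E → Bool} (hAB : Xor (A ⊆ B) (B ⊆ A)) (hAB' : Xor (A' ⊆ B') (B' ⊆ A'))
    (hA : ∀ σ ∈ A', φ σ ∈ A) (hB : ∀ σ ∈ B', ψ σ ∈ B) (hA' : ∀ σ ∈ A', φ σ ∈ B → σ ∈ B')
    (hB' : ∀ σ ∈ B', ψ σ ∈ A → σ ∈ A') (hAB'' : ∀ σ ∈ A', σ ∈ B' → ψ σ ∈ A)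
    (hp : ∀ σ ∈ A', σ ∈ B' → ψ σ p = σ p') {σ : E' → Bool} (hσ : σ ∈ B') :
    saddleWeight A B p (ψ σ) = saddleWeight A' B' p' σ := by
  classical
  -- For either pair exactly one inclusion holds. It is therefore enough that each inclusion for
  -- `A`, `B` implies the same one for `A'`, `B'`.
  have hm : B ⊆ A ↔ B' ⊆ A' := by
    have h1 : B ⊆ A → B' ⊆ A' := fun h σ hσ => hB' σ hσ (h (hB σ hσ))
    have h2 : A ⊆ B → A' ⊆ B' := fun h σ hσ => hA' σ hσ (h (hA σ hσ))
    refine ⟨h1, fun h => ?_⟩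
    rcases hAB with h3 | h3
    · rcases hAB' with h4 | h4
      · exact absurd h h4.2
      · exact absurd (h2 h3.1) h4.2
    · exact h3.1
  by_cases hσA : σ ∈ A'
  · rw [saddleWeight_of_mem _ (hAB'' σ hσA hσ) (hB σ hσ), saddleWeight_of_mem _ hσA hσ, edgeVar,
      edgeVar, hp σ hσA hσ, if_congr hm rfl rfl]
  · rw [saddleWeight_eq_zero _ fun h => hσA h.1, saddleWeight_eq_zero _ fun h =>
      hσA (hB' σ hσ h.1)]

/-- A map of sign vectors along which the functions for one cube pull back to those for another. -/
structure IsMorphism (Q : Cube E n) (Q' : Cube E' n) (φ : (E' → Bool) → E → Bool) : Prop where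
  subst : IsSignSubst φ
  mem : ∀ v, ∀ σ ∈ Q'.S v, φ σ ∈ Q.S v
  respects : ∀ v, ∀ σ ∈ Q'.S v, ∀ c b, Respects b (Q.q c) (φ σ) → Respects b (Q'.q c) σ
  marker : ∀ v, ∀ σ ∈ Q'.S v, ∀ c, (∀ i, σ (Q'.q c i) = σ (Q'.q c 0)) →
    φ σ (Q.q c 0) = σ (Q'.q c 0)

namespace IsMorphism

variable {Q : Cube E n} {Q' : Cube E' n} {φ : (E' → Bool) → E → Bool} (h : IsMorphism Q Q' φ)

/-- The map of chain modules. -/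
def pullback : Q.space →ₗ[ℚ] Q'.space :=
  fiberMap (fun v => pullbackFun φ (Q'.S v)) fun v _ hf =>
    indicator_comp_mem_vertexSpace h.subst (h.mem v) hf

theorem pullback_apply (F : Q.space) {v : Fin n → Bool} {σ : E' → Bool} (hσ : σ ∈ Q'.S v) :
    (h.pullback F).1 v σ = F.1 v (φ σ) :=
  Set.indicator_of_mem hσ _

theorem pullback_d (F : Q.space) : h.pullback (Q.d F) = Q'.d (h.pullback F) := by
  refine fiberMap_d _ (fun v c hv f _ => ?_) F
  set u := Function.update v c false with hu
  have huv : v = Function.update u c (!u c) := by simp [hu, ← hv]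
  have key : ∀ (b : Bool) (w : Fin n → Bool), ∀ σ ∈ Q'.S w,
      φ σ ∈ Q.S (Function.update w c b) → σ ∈ Q'.S (Function.update w c b) := fun b w σ hσ hφ =>
    Q'.flip hσ c b (h.respects w σ hσ c b (by simpa using Q.respects hφ c))
  have hw : ∀ σ ∈ Q'.S v, Q.weight v c (φ σ) = Q'.weight v c σ := fun σ hσ => by
    refine saddleWeight_comp_eq (φ := φ) ?_ ?_ (h.mem u) (h.mem v) ?_ (key _ v)
      (fun σ hσ _ => h.mem u σ hσ) ?_ hσ
    · have := Q.one u c; rwa [← huv] at this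
    · have := Q'.one u c; rwa [← huv] at this
    · intro σ hσ hφ
      rw [huv] at hφ ⊢
      exact key _ u σ hσ hφ
    · intro σ hσu hσv
      have h1 := Q'.respects hσu c
      have h2 := Q'.respects hσv c
      rw [huv, Function.update_self] at h2
      exact h.marker u σ hσu c (h1.eq_of_not h2)
  funext σ
  change (Q'.S v).indicator _ σ = Q'.weight v c σ * (Q'.S u).indicator _ σ
  by_cases hσ : σ ∈ Q'.S v
  · rw [Set.indicator_of_mem hσ, ← hw σ hσ]
    change Q.weight v c (φ σ) * f (φ σ) = _
    by_cases hσu : σ ∈ Q'.S u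
    · rw [Set.indicator_of_mem hσu]; rfl
    · rw [hw σ hσ, weight, saddleWeight_eq_zero _ fun h => hσu h.1, zero_mul, zero_mul]
  · rw [Set.indicator_of_notMem hσ, weight, saddleWeight_eq_zero _ fun h => hσ h.2, zero_mul]

theorem pullback_x {e : E} {e' : E'} (he : ∀ v, ∀ σ ∈ Q'.S v, φ σ e = σ e') (F : Q.space) :
    h.pullback (Q.x e F) = Q'.x e' (h.pullback F) := by
  refine space_ext fun v σ hσ => ?_
  rw [h.pullback_apply _ hσ]
  change edgeVar e (φ σ) * F.1 v (φ σ) = edgeVar e' σ * (h.pullback F).1 v σ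
  rw [h.pullback_apply _ hσ, edgeVar, edgeVar, he v σ hσ]

end IsMorphism

theorem isSignSubst_comp (f : E → E') : IsSignSubst fun σ : E' → Bool => σ ∘ f :=
  fun e => ⟨f e, false, fun σ => by simp⟩

theorem IsMorphism.of_subset {Q Q' : Cube E n} (hS : ∀ v, Q'.S v ⊆ Q.S v)
    (hq : ∀ c i, Q.q c i = Q'.q c i) : IsMorphism Q Q' fun σ => σ where
  subst e := ⟨e, false, fun σ => by simp⟩
  mem v σ hσ := hS v hσ
  respects v σ _ c b := (Respects.congr fun i => by rw [hq]).1
  marker v σ _ c _ := by rw [hq]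

/-- Mutually inverse maps of edges, up to identifications on the circles, give an isomorphism. -/
def transferEquiv {Q : Cube E n} {Q' : Cube E' n} {f : E → E'} {j : E' → E}
    (hf : IsMorphism Q Q' fun σ => σ ∘ f) (hj : IsMorphism Q' Q fun σ => σ ∘ j)
    (hjf : ∀ v, ∀ σ ∈ Q.S v, ∀ e, σ (j (f e)) = σ e)
    (hfj : ∀ v, ∀ σ ∈ Q'.S v, ∀ e, σ (f (j e)) = σ e) : Q.space ≃ₗ[ℚ] Q'.space :=
  LinearEquiv.ofLinearMap hf.pullback hj.pullback
    (LinearMap.ext fun F => space_ext fun v σ hσ => by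
      rw [LinearMap.comp_apply, hf.pullback_apply _ hσ, hj.pullback_apply _ (hf.mem v σ hσ)]
      exact congrArg (F.1 v) (funext fun e => hfj v σ hσ e))
    (LinearMap.ext fun F => space_ext fun v σ hσ => by
      rw [LinearMap.comp_apply, hj.pullback_apply _ hσ, hf.pullback_apply _ (hj.mem v σ hσ)]
      exact congrArg (F.1 v) (funext fun e => hjf v σ hσ e))

theorem torsionBound_transfer_iff {Q : Cube E n} {Q' : Cube E' n} {f : E → E'} {j : E' → E}
    (hf : IsMorphism Q Q' fun σ => σ ∘ f) (hj : IsMorphism Q' Q fun σ => σ ∘ j)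
    (hjf : ∀ v, ∀ σ ∈ Q.S v, ∀ e, σ (j (f e)) = σ e)
    (hfj : ∀ v, ∀ σ ∈ Q'.S v, ∀ e, σ (f (j e)) = σ e) (e : E) (k : ℕ) :
    TorsionBound Q.d (Q.x e) k ↔ TorsionBound Q'.d (Q'.x (f e)) k :=
  TorsionBound.equiv_iff (transferEquiv hf hj hjf hfj) hf.pullback_d
    (hf.pullback_x fun _ _ _ => rfl)

/-! ### A circle in a resolution -/

/-- The edges in `G` form a circle in the resolutions of the cube `W` that meets none of the
crossings, and in the cube `U` this circle is attached to the edge `p`. -/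
structure IsAttached (W U : Cube E n) (G : Set E) (g p : E) : Prop where
  mem_g : g ∈ G
  notMem_p : p ∉ G
  q_eq : ∀ c i, U.q c i = W.q c i
  notMem_q : ∀ c i, W.q c i ∉ G
  const : ∀ v, ∀ σ ∈ W.S v, ∀ e ∈ G, σ e = σ g
  reset : ∀ v, ∀ σ ∈ W.S v, ∀ τ : E → Bool, (∀ e ∉ G, τ e = σ e) → (∀ e ∈ G, τ e = τ g) → τ ∈ W.S v
  mem_iff : ∀ v σ, σ ∈ U.S v ↔ σ ∈ W.S v ∧ σ g = σ p

open Classical in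
/-- The sign vector with the values on `G` replaced by that of `p`, up to the sign `b`. -/
def resetOn (G : Set E) (p : E) (b : Bool) (σ : E → Bool) : E → Bool :=
  fun e => if e ∈ G then xor b (σ p) else σ e

theorem resetOn_of_mem {G : Set E} {e : E} (he : e ∈ G) (p : E) (b : Bool) (σ : E → Bool) :
    resetOn G p b σ e = xor b (σ p) := if_pos he

theorem resetOn_of_notMem {G : Set E} {e : E} (he : e ∉ G) (p : E) (b : Bool) (σ : E → Bool) :
    resetOn G p b σ e = σ e := if_neg he

theorem resetOn_congr {σ τ : E → Bool} {e e' : E} {b b' : Bool} (he : xor b (σ e) = xor b' (τ e'))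
    (hστ : ∀ a ∉ G, σ a = τ a) : resetOn G e b σ = resetOn G e' b' τ := by
  funext a
  by_cases ha : a ∈ G
  · rw [resetOn_of_mem ha, resetOn_of_mem ha, he]
  · rw [resetOn_of_notMem ha, resetOn_of_notMem ha, hστ a ha]

theorem isSignSubst_resetOn (G : Set E) (p : E) (b : Bool) : IsSignSubst (resetOn G p b) := by
  intro e
  by_cases he : e ∈ G
  · exact ⟨p, b, resetOn_of_mem he p b⟩
  · exact ⟨e, false, fun σ => by rw [resetOn_of_notMem he, Bool.false_xor]⟩

/-- Flipping the circle changes the sign of `X_g` alone, so the difference is twice the part odd in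
`X_g`. The operation obeys a twisted product rule, which reduces it to the generators. The quotient
being polynomial makes `ε` below well defined. -/
theorem exists_div_of_mem_edgePoly {G : Set E} {g : E} {p : SignFun E}
    (hp : p ∈ edgePoly E) : ∃ q ∈ edgePoly E, ∀ σ : E → Bool, (∀ e ∈ G, σ e = σ g) →
      p σ - p (resetOn G g true σ) = 2 * edgeVar g σ * q σ := by
  induction hp using Algebra.adjoin_induction with
  | mem p hp =>
    rcases hp with rfl | ⟨e, rfl⟩
    · exact ⟨0, zero_mem _, fun σ _ => by simp⟩
    · by_cases he : e ∈ G
      · refine ⟨1, one_mem _, fun σ hσ => ?_⟩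
        simp only [edgeVar, resetOn_of_mem he, hσ e he, Bool.true_xor, boolSign_not, Pi.one_apply]
        ring
      · exact ⟨0, zero_mem _, fun σ _ => by simp [edgeVar, resetOn_of_notMem he]⟩
  | algebraMap r => exact ⟨0, zero_mem _, fun σ _ => by simp⟩
  | add p q _ _ h1 h2 =>
    obtain ⟨p', hp', h1⟩ := h1
    obtain ⟨q', hq', h2⟩ := h2
    refine ⟨p' + q', add_mem hp' hq', fun σ hσ => ?_⟩
    simp only [Pi.add_apply]
    linear_combination h1 σ hσ + h2 σ hσ
  | mul p q hp hq h1 h2 =>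
    obtain ⟨p', hp', h1⟩ := h1
    obtain ⟨q', hq', h2⟩ := h2
    refine ⟨p * q' + p' * (q ∘ resetOn G g true), add_mem (mul_mem hp hq')
      (mul_mem hp' ((isSignSubst_resetOn G g true).comp_mem_edgePoly hq)), fun σ hσ => ?_⟩
    simp only [Pi.add_apply, Pi.mul_apply, Function.comp_apply]
    linear_combination p σ * h2 σ hσ + q (resetOn G g true σ) * h1 σ hσ

theorem two_mul_edgeVar_ne_zero (g : E) (σ : E → Bool) : 2 * edgeVar g σ ≠ 0 := by
  have : boolSign (σ g) ≠ 0 := fun h => by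
    have := boolSign_mul_self (σ g)
    simp [h] at this
  simp [edgeVar, this]

/-- The coefficient of the variable of `g`. -/
def coeffFun (G : Set E) (g : E) (U : Set (E → Bool)) : SignFun E →ₗ[ℚ] SignFun E where
  -- Division by `2 X_g` written out: multiply by the sign of `g`, halve, and divide by `√t`.
  toFun f := U.indicator fun σ =>
    Polynomial.divX ((1 / 2 : ℚ) • (boolSign (σ g) * (f σ - f (resetOn G g true σ))))
  map_add' f f' := by
    rw [← Set.indicator_add']
    congr 1
    funext σ
    simp only [Pi.add_apply, ← Polynomial.divX_add, ← smul_add, ← mul_add]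
    congr 3
    ring
  map_smul' r f := by
    refine Eq.trans (congrArg _ (funext fun σ => ?_)) (Set.indicator_const_smul U r _)
    simp only [Pi.smul_apply, ← smul_sub, mul_smul_comm, smul_comm _ r]
    rw [Polynomial.smul_eq_C_mul r, Polynomial.divX_C_mul, Polynomial.smul_eq_C_mul r]

theorem coeffFun_apply (G : Set E) (g : E) (U : Set (E → Bool)) (f : SignFun E) :
    coeffFun G g U f = U.indicator fun σ =>
      Polynomial.divX ((1 / 2 : ℚ) • (boolSign (σ g) * (f σ - f (resetOn G g true σ)))) := rfl

theorem coeffFun_eq {G : Set E} {g : E} {U : Set (E → Bool)} {f : SignFun E} {q : SignFun E}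
    {σ : E → Bool} (hσ : σ ∈ U)
    (h : f σ - f (resetOn G g true σ) = 2 * edgeVar g σ * q σ) : coeffFun G g U f σ = q σ := by
  rw [coeffFun_apply, Set.indicator_of_mem hσ]
  have h1 : (1 / 2 : ℚ) • (boolSign (σ g) * (f σ - f (resetOn G g true σ))) = Polynomial.X * q σ := by
    have h2 : boolSign (σ g) * (f σ - f (resetOn G g true σ)) = (2 : ℚ) • (Polynomial.X * q σ) := by
      rw [h, edgeVar, two_smul]
      linear_combination 2 * Polynomial.X * q σ * boolSign_mul_self (σ g)
    rw [h2, smul_smul]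
    norm_num
  rw [h1]
  ext i
  rw [Polynomial.coeff_divX, Polynomial.coeff_X_mul]

/-- The values lie in an integral domain, where `±√t` is nonzero. This gives the bound for the
unknot and allows identities to be checked after multiplication by a variable. -/
theorem x_injective (Q : Cube E n) (e : E) : Function.Injective (Q.x e) := by
  refine (injective_iff_map_eq_zero _).2 fun F hF => space_ext fun v σ _ => ?_
  have h1 : edgeVar e σ * F.1 v σ = 0 := congrFun (congrFun (congrArg Subtype.val hF) v) σ
  have h2 := two_mul_edgeVar_ne_zero e σ
  exact (mul_eq_zero.1 h1).resolve_left fun h3 => h2 (by rw [h3, mul_zero])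

namespace IsAttached

variable {W U : Cube E n} {G : Set E} {g p : E} (h : IsAttached W U G g p)

include h

theorem mem_of_mem {v : Fin n → Bool} {σ : E → Bool} (hσ : σ ∈ U.S v) : σ ∈ W.S v :=
  ((h.mem_iff v σ).1 hσ).1

theorem reset_mem {v : Fin n → Bool} {σ : E → Bool} (hσ : σ ∈ W.S v) (e : E) (b : Bool) :
    resetOn G e b σ ∈ W.S v :=
  h.reset v σ hσ _ (fun _ he => resetOn_of_notMem he _ _ _) fun _ he => by
    rw [resetOn_of_mem he, resetOn_of_mem h.mem_g]

theorem reset_mem' {v : Fin n → Bool} {σ : E → Bool} (hσ : σ ∈ W.S v) :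
    resetOn G p false σ ∈ U.S v :=
  (h.mem_iff _ _).2 ⟨h.reset_mem hσ p false, by
    rw [resetOn_of_mem h.mem_g, resetOn_of_notMem h.notMem_p, Bool.false_xor]⟩

theorem resetOn_eq {v : Fin n → Bool} {σ : E → Bool} (hσ : σ ∈ W.S v) {e : E} {b : Bool}
    (he : σ g = xor b (σ e)) : resetOn G e b σ = σ := by
  funext a
  by_cases ha : a ∈ G
  · rw [resetOn_of_mem ha, ← he, h.const v σ hσ a ha]
  · exact resetOn_of_notMem ha _ _ _

theorem isMorphism_ι : IsMorphism U W (resetOn G p false) where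
  subst := isSignSubst_resetOn G p false
  mem v σ hσ := h.reset_mem' hσ
  respects v σ _ c b := (Respects.congr fun i => by
    rw [h.q_eq, resetOn_of_notMem (h.notMem_q c i)]).1
  marker v σ _ c _ := by rw [h.q_eq, resetOn_of_notMem (h.notMem_q c 0)]

theorem isMorphism_π : IsMorphism W U (resetOn G p true) where
  subst := isSignSubst_resetOn G p true
  mem v σ hσ := h.reset_mem (h.mem_of_mem hσ) _ _
  respects v σ _ c b := (Respects.congr fun i => by
    rw [h.q_eq, resetOn_of_notMem (h.notMem_q c i)]).1
  marker v σ _ c _ := by rw [h.q_eq, resetOn_of_notMem (h.notMem_q c 0)]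

theorem isMorphism_ρ : IsMorphism W U fun σ => σ :=
  IsMorphism.of_subset (fun _ _ => h.mem_of_mem) fun c i => (h.q_eq c i).symm

/-- Functions on the sign vectors of `U` as functions not depending on the circle. -/
def ι : U.space →ₗ[ℚ] W.space := h.isMorphism_ι.pullback

/-- Restriction to the opposite sign on the circle. -/
def π : W.space →ₗ[ℚ] U.space := h.isMorphism_π.pullback

/-- Restriction. -/
def ρ : W.space →ₗ[ℚ] U.space := h.isMorphism_ρ.pullback

/-- The coefficient of the variable of the circle. -/
def ε : W.space →ₗ[ℚ] U.space :=
  fiberMap (fun v => coeffFun G g (U.S v)) fun v f hf => by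
    obtain ⟨a, ha, rfl⟩ := hf
    obtain ⟨q, hq, hq'⟩ := exists_div_of_mem_edgePoly (G := G) (g := g) ha
    refine ⟨q, hq, funext fun σ => ?_⟩
    by_cases hσ : σ ∈ U.S v
    · rw [Set.indicator_of_mem hσ]
      refine coeffFun_eq hσ ?_
      have hσW := h.mem_of_mem hσ
      rw [Set.indicator_of_mem hσW, Set.indicator_of_mem (h.reset_mem hσW _ _)]
      exact hq' σ (h.const v σ hσW)
    · rw [Set.indicator_of_notMem hσ]
      rw [coeffFun_apply, Set.indicator_of_notMem hσ]

/-- The split that creates the circle. -/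
def β : U.space →ₗ[ℚ] W.space := (W.x g + W.x p) ∘ₗ h.ι

theorem ι_apply (F : U.space) {v : Fin n → Bool} {σ : E → Bool} (hσ : σ ∈ W.S v) :
    (h.ι F).1 v σ = F.1 v (resetOn G p false σ) := h.isMorphism_ι.pullback_apply F hσ

theorem π_apply (F : W.space) {v : Fin n → Bool} {σ : E → Bool} (hσ : σ ∈ U.S v) :
    (h.π F).1 v σ = F.1 v (resetOn G p true σ) := h.isMorphism_π.pullback_apply F hσ

theorem ρ_apply (F : W.space) {v : Fin n → Bool} {σ : E → Bool} (hσ : σ ∈ U.S v) :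
    (h.ρ F).1 v σ = F.1 v σ := h.isMorphism_ρ.pullback_apply F hσ

theorem ε_apply (F : W.space) {v : Fin n → Bool} {σ : E → Bool} (hσ : σ ∈ U.S v) :
    2 * edgeVar g σ * (h.ε F).1 v σ = F.1 v σ - F.1 v (resetOn G g true σ) := by
  obtain ⟨a, ha, haF⟩ := mem_space.1 F.2 v
  obtain ⟨q, hq, hq'⟩ := exists_div_of_mem_edgePoly (G := G) (g := g) ha
  have hσW := h.mem_of_mem hσ
  have h1 : F.1 v σ - F.1 v (resetOn G g true σ) = 2 * edgeVar g σ * q σ := by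
    rw [haF, Set.indicator_of_mem hσW, Set.indicator_of_mem (h.reset_mem hσW _ _)]
    exact hq' σ (h.const v σ hσW)
  rw [h1]
  congr 1
  exact coeffFun_eq hσ h1

theorem β_apply (F : U.space) {v : Fin n → Bool} {σ : E → Bool} (hσ : σ ∈ U.S v) :
    (h.β F).1 v σ = 2 * edgeVar g σ * F.1 v σ := by
  have hσW := h.mem_of_mem hσ
  have hgp := ((h.mem_iff _ _).1 hσ).2
  change edgeVar g σ * (h.ι F).1 v σ + edgeVar p σ * (h.ι F).1 v σ = _
  rw [h.ι_apply F hσW, h.resetOn_eq hσW (by simpa using hgp), edgeVar, edgeVar, hgp]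
  ring

theorem β_apply_of_notMem (F : U.space) {v : Fin n → Bool} {σ : E → Bool} (hσ : σ ∉ U.S v) :
    (h.β F).1 v σ = 0 := by
  by_cases hσW : σ ∈ W.S v
  · have hgp : σ g = !σ p := Bool.eq_not_iff.2 fun hgp => hσ ((h.mem_iff _ _).2 ⟨hσW, hgp⟩)
    change edgeVar g σ * (h.ι F).1 v σ + edgeVar p σ * (h.ι F).1 v σ = _
    rw [edgeVar, edgeVar, hgp, boolSign_not]
    ring
  · exact apply_of_notMem _ hσW

/-- This recognises a split from its values: `2 X_p` times the function where the circle has the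
sign of `p`, and zero elsewhere. -/
theorem eq_β_apply {F : U.space} {H : W.space}
    (hH : ∀ v, ∀ σ ∈ U.S v, H.1 v σ = 2 * edgeVar p σ * F.1 v σ)
    (hH' : ∀ v, ∀ σ ∉ U.S v, H.1 v σ = 0) : H = h.β F := by
  refine space_ext fun v σ _ => ?_
  by_cases hσ : σ ∈ U.S v
  · rw [hH v σ hσ, h.β_apply F hσ, edgeVar, edgeVar, ((h.mem_iff _ _).1 hσ).2]
  · rw [hH' v σ hσ, h.β_apply_of_notMem F hσ]

theorem eq_β {b : U.space →ₗ[ℚ] W.space}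
    (hb : ∀ F v, ∀ σ ∈ U.S v, (b F).1 v σ = 2 * edgeVar p σ * F.1 v σ)
    (hb' : ∀ F v, ∀ σ ∉ U.S v, (b F).1 v σ = 0) : b = h.β :=
  LinearMap.ext fun F => h.eq_β_apply (hb F) (hb' F)

theorem eq_ρ {m : W.space →ₗ[ℚ] U.space} (hm : ∀ F v, ∀ σ ∈ U.S v, (m F).1 v σ = F.1 v σ) :
    m = h.ρ :=
  LinearMap.ext fun F => space_ext fun v σ hσ => by rw [hm F v σ hσ, h.ρ_apply F hσ]

theorem ι_d (F : U.space) : W.d (h.ι F) = h.ι (U.d F) := (h.isMorphism_ι.pullback_d F).symm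

theorem π_d (F : W.space) : h.π (W.d F) = U.d (h.π F) := h.isMorphism_π.pullback_d F

theorem ρ_d (F : W.space) : h.ρ (W.d F) = U.d (h.ρ F) := h.isMorphism_ρ.pullback_d F

/-- Up to the injective factor `2 X_g`, the coefficient map is a difference of two pullbacks, from
which it inherits compatibility with the differential and with the action. -/
theorem x_ε (F : W.space) : (2 : ℚ) • U.x g (h.ε F) = h.ρ F - h.π F := by
  refine space_ext fun v σ hσ => ?_
  change (2 : ℚ) • (edgeVar g σ * (h.ε F).1 v σ) = (h.ρ F).1 v σ - (h.π F).1 v σ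
  rw [h.ρ_apply F hσ, h.π_apply F hσ, two_smul, ← two_mul, ← mul_assoc, h.ε_apply F hσ]
  rw [resetOn_congr (σ := σ) (τ := σ) (e := g) (e' := p) (b := true) (b' := true)
    (by rw [((h.mem_iff _ _).1 hσ).2]) fun _ _ => rfl]

omit h in
theorem eq_of_two_smul_x {F G : U.space} (hFG : (2 : ℚ) • U.x g F = (2 : ℚ) • U.x g G) : F = G :=
  x_injective U g (smul_right_injective _ two_ne_zero hFG)

theorem ε_d (F : W.space) : h.ε (W.d F) = U.d (h.ε F) :=
  eq_of_two_smul_x (g := g) (by rw [h.x_ε, h.ρ_d, h.π_d, ← map_sub, ← h.x_ε, map_smul, d_x])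


theorem x_ι {e : E} (he : e ∉ G) (F : U.space) : W.x e (h.ι F) = h.ι (U.x e F) :=
  (h.isMorphism_ι.pullback_x (fun _ _ _ => resetOn_of_notMem he _ _ _) F).symm

theorem x_π {e : E} (he : e ∉ G) (F : W.space) : h.π (W.x e F) = U.x e (h.π F) :=
  h.isMorphism_π.pullback_x (fun _ _ _ => resetOn_of_notMem he _ _ _) F

theorem x_ρ (e : E) (F : W.space) : h.ρ (W.x e F) = U.x e (h.ρ F) :=
  h.isMorphism_ρ.pullback_x (fun _ _ _ => rfl) F

theorem ε_x {e : E} (he : e ∉ G) (F : W.space) : h.ε (W.x e F) = U.x e (h.ε F) :=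
  eq_of_two_smul_x (g := g) (by
    rw [h.x_ε, h.x_ρ, h.x_π he, ← map_sub, ← h.x_ε, map_smul, U.x_comm])

theorem ρ_ι (F : U.space) : h.ρ (h.ι F) = F :=
  space_ext fun v σ hσ => by
    rw [h.ρ_apply _ hσ, h.ι_apply _ (h.mem_of_mem hσ), h.resetOn_eq (h.mem_of_mem hσ)]
    simpa using ((h.mem_iff _ _).1 hσ).2

theorem π_ι (F : U.space) : h.π (h.ι F) = F :=
  space_ext fun v σ hσ => by
    have hσW := h.mem_of_mem hσ
    have h1 : resetOn G p false (resetOn G p true σ) = resetOn G p false σ :=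
      resetOn_congr (by rw [resetOn_of_notMem h.notMem_p]) fun a ha => resetOn_of_notMem ha _ _ _
    rw [h.π_apply _ hσ, h.ι_apply _ (h.reset_mem hσW _ _), h1, h.resetOn_eq hσW]
    simpa using ((h.mem_iff _ _).1 hσ).2

theorem ε_apply_eq (F : W.space) {v : Fin n → Bool} {σ : E → Bool} (hσ : σ ∈ U.S v)
    {q : ℚ[X]} (hq : F.1 v σ - F.1 v (resetOn G g true σ) = 2 * edgeVar g σ * q) :
    (h.ε F).1 v σ = q :=
  mul_left_cancel₀ (two_mul_edgeVar_ne_zero g σ) ((h.ε_apply F hσ).trans hq)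

theorem resetOn_notMem {v : Fin n → Bool} {σ : E → Bool} (hσ : σ ∈ U.S v) :
    resetOn G g true σ ∉ U.S v := fun h' => by
  have h1 := ((h.mem_iff _ _).1 h').2
  rw [resetOn_of_mem h.mem_g, resetOn_of_notMem h.notMem_p, ((h.mem_iff _ _).1 hσ).2] at h1
  simp at h1

/-- The coefficient of the variable of a circle vanishes on functions not depending on it. -/
theorem ε_ι {U' : Cube E n} {p' : E} (h' : IsAttached W U' G g p') (F : U'.space) :
    h.ε (h'.ι F) = 0 :=
  space_ext fun v σ hσ => by
    have hσW := h.mem_of_mem hσ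
    refine h.ε_apply_eq _ hσ ?_
    have h1 : resetOn G p' false (resetOn G g true σ) = resetOn G p' false σ :=
      resetOn_congr (by rw [resetOn_of_notMem h'.notMem_p]) fun a ha => resetOn_of_notMem ha _ _ _
    rw [h'.ι_apply _ hσW, h'.ι_apply _ (h.reset_mem hσW _ _), h1, sub_self]
    exact (mul_zero _).symm

/-- The coefficient of the variable of the circle in a split off another edge. -/
theorem ε_β_apply {U' : Cube E n} {p' : E} (h' : IsAttached W U' G g p') (F : U'.space)
    {v : Fin n → Bool} {σ : E → Bool} (hσ : σ ∈ U.S v) :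
    (h.ε (h'.β F)).1 v σ = F.1 v (resetOn G p' false σ) := by
  have hσW := h.mem_of_mem hσ
  refine h.ε_apply_eq _ hσ ?_
  have h1 : resetOn G p' false (resetOn G g true σ) = resetOn G p' false σ :=
    resetOn_congr (by rw [resetOn_of_notMem h'.notMem_p]) fun a ha => resetOn_of_notMem ha _ _ _
  change edgeVar g σ * (h'.ι F).1 v σ + edgeVar p' σ * (h'.ι F).1 v σ -
    (edgeVar g _ * (h'.ι F).1 v _ + edgeVar p' _ * (h'.ι F).1 v _) = _
  rw [h'.ι_apply _ hσW, h'.ι_apply _ (h.reset_mem hσW _ _), h1, edgeVar, edgeVar, edgeVar, edgeVar,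
    resetOn_of_mem h.mem_g, resetOn_of_notMem h'.notMem_p, Bool.true_xor, boolSign_not]
  ring

theorem ε_β (F : U.space) : h.ε (h.β F) = F :=
  space_ext fun v σ hσ => by
    refine h.ε_apply_eq _ hσ ?_
    rw [h.β_apply F hσ, h.β_apply_of_notMem F (h.resetOn_notMem hσ), sub_zero]

theorem π_β (F : U.space) : h.π (h.β F) = 0 :=
  space_ext fun v σ hσ => by
    have h1 : resetOn G p true σ = resetOn G g true σ :=
      resetOn_congr (by rw [((h.mem_iff _ _).1 hσ).2]) fun _ _ => rfl
    rw [h.π_apply _ hσ, h1, h.β_apply_of_notMem F (h.resetOn_notMem hσ)]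
    rfl

theorem β_ε_apply (F : W.space) {v : Fin n → Bool} {σ : E → Bool} (hσ : σ ∈ U.S v) :
    (h.β (h.ε F)).1 v σ = F.1 v σ - F.1 v (resetOn G g true σ) := by
  rw [h.β_apply _ hσ, h.ε_apply _ hσ]

theorem resetOn_true_eq {v : Fin n → Bool} {σ : E → Bool} (hσ : σ ∈ W.S v) (hU : σ ∉ U.S v) :
    resetOn G g true σ = resetOn G p false σ :=
  resetOn_congr (by
    rw [Bool.true_xor, Bool.false_xor, Bool.not_eq_eq_eq_not]
    exact Bool.eq_not_iff.2 fun h' => hU ((h.mem_iff _ _).2 ⟨hσ, h'⟩)) fun _ _ => rfl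

/-- The term `ι (π F)` is the function independent of the circle that agrees with `F` where the
circle and `p` have opposite signs. The remainder vanishes there, hence is a multiple of the weight
of the split. -/
theorem β_ε_add_ι_π (F : W.space) : h.β (h.ε F) + h.ι (h.π F) = F :=
  space_ext fun v σ hσ => by
    change (h.β (h.ε F)).1 v σ + (h.ι (h.π F)).1 v σ = _
    have h2 : resetOn G p true (resetOn G p false σ) = resetOn G p true σ :=
      resetOn_congr (by rw [resetOn_of_notMem h.notMem_p]) fun a ha => resetOn_of_notMem ha _ _ _
    rw [h.ι_apply _ hσ, h.π_apply _ (h.reset_mem' hσ), h2]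
    by_cases hU : σ ∈ U.S v
    · have h1 : resetOn G p true σ = resetOn G g true σ :=
        resetOn_congr (by rw [((h.mem_iff _ _).1 hU).2]) fun _ _ => rfl
      rw [h.β_ε_apply _ hU, h1, sub_add_cancel]
    · rw [h.β_apply_of_notMem _ hU, zero_add, h.resetOn_eq hσ]
      rw [Bool.true_xor]
      exact Bool.eq_not_iff.2 fun h' => hU ((h.mem_iff _ _).2 ⟨hσ, h'⟩)

/-- A circle attached to one edge or to another. -/
theorem β_ε_add_ι_ρ {U' : Cube E n} {p' : E} (h' : IsAttached W U' G g p') (F : W.space) :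
    h.β (h.ε F) + h'.ι (h'.ρ F) = F + h'.ι (h'.ρ (h.β (h.ε F))) :=
  -- Equivalently `(1 - ι' ρ')(1 - β ε) = 0`: the function `F - β (ε F)` does not depend on the
  -- circle, and on such functions `ι' ρ'` is the identity.
  space_ext fun v σ hσ => by
    change (h.β (h.ε F)).1 v σ + (h'.ι (h'.ρ F)).1 v σ =
      F.1 v σ + (h'.ι (h'.ρ (h.β (h.ε F)))).1 v σ
    rw [h'.ι_apply _ hσ, h'.ι_apply _ hσ, h'.ρ_apply _ (h'.reset_mem' hσ),
      h'.ρ_apply _ (h'.reset_mem' hσ)]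
    by_cases hU' : σ ∈ U'.S v
    · rw [h'.resetOn_eq hσ (by simpa using ((h'.mem_iff _ _).1 hU').2)]
      ring
    · rw [← h'.resetOn_true_eq hσ hU']
      by_cases hU : σ ∈ U.S v
      · rw [h.β_ε_apply _ hU, h.β_apply_of_notMem _ (h.resetOn_notMem hU)]
        ring
      · have h1 : resetOn G g true σ ∈ U.S v := by
          rw [h.resetOn_true_eq hσ hU]; exact h.reset_mem' hσ
        have h2 : resetOn G g true (resetOn G g true σ) = σ := by
          refine Eq.trans (resetOn_congr (τ := σ) (e' := g) (b' := false) ?_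
            fun a ha => resetOn_of_notMem ha _ _ _) (h.resetOn_eq hσ (by simp))
          rw [resetOn_of_mem h.mem_g]
          simp
        rw [h.β_ε_apply _ h1, h2, h.β_apply_of_notMem _ hU]
        ring

/-- The kernel of the merge of the circle. -/
def κ : U.space →ₗ[ℚ] W.space := (W.x g - W.x p) ∘ₗ h.ι

theorem κ_apply (F : U.space) {v : Fin n → Bool} {σ : E → Bool} (hσ : σ ∈ W.S v) :
    (h.κ F).1 v σ = (edgeVar g σ - edgeVar p σ) * F.1 v (resetOn G p false σ) := by
  change edgeVar g σ * (h.ι F).1 v σ - edgeVar p σ * (h.ι F).1 v σ = _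
  rw [h.ι_apply F hσ, sub_mul]

theorem κ_d (F : U.space) : W.d (h.κ F) = h.κ (U.d F) := by
  simp [κ, d_x, h.ι_d]

theorem x_κ {e : E} (he : e ∉ G) (F : U.space) : W.x e (h.κ F) = h.κ (U.x e F) := by
  simp only [κ, LinearMap.comp_apply, LinearMap.sub_apply, map_sub, ← h.x_ι he]
  rw [W.x_comm e g, W.x_comm e p]

theorem ρ_κ (F : U.space) : h.ρ (h.κ F) = 0 :=
  space_ext fun v σ hσ => by
    rw [h.ρ_apply _ hσ, h.κ_apply _ (h.mem_of_mem hσ), edgeVar, edgeVar,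
      ((h.mem_iff _ _).1 hσ).2, sub_self, zero_mul]
    rfl

theorem κ_of_notMem (F : U.space) {v : Fin n → Bool} {σ : E → Bool} (hσ : σ ∈ W.S v)
    (hU : σ ∉ U.S v) : (h.κ F).1 v σ = 2 * edgeVar g σ * F.1 v (resetOn G p false σ) := by
  have hgp : σ p = !σ g := Bool.eq_not_iff.2 fun hgp => hU ((h.mem_iff _ _).2 ⟨hσ, hgp.symm⟩)
  rw [h.κ_apply _ hσ, edgeVar, edgeVar, hgp, boolSign_not]
  ring

theorem edgeVar_resetOn (σ : E → Bool) : edgeVar g (resetOn G g true σ) = -edgeVar g σ := by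
  rw [edgeVar, edgeVar, resetOn_of_mem h.mem_g, Bool.true_xor, boolSign_not, neg_mul]

theorem resetOn_false_resetOn_true {v : Fin n → Bool} {σ : E → Bool} (hσ : σ ∈ U.S v) :
    resetOn G p false (resetOn G g true σ) = σ :=
  Eq.trans (resetOn_congr (τ := σ) (e' := g) (b' := false)
    (by rw [resetOn_of_notMem h.notMem_p, ((h.mem_iff _ _).1 hσ).2])
    fun a ha => resetOn_of_notMem ha _ _ _) (h.resetOn_eq (h.mem_of_mem hσ) (by simp))

theorem ε_κ (F : U.space) : h.ε (h.κ F) = F :=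
  space_ext fun v σ hσ => by
    have hσW := h.mem_of_mem hσ
    refine h.ε_apply_eq _ hσ ?_
    have h1 := congrFun (congrFun (congrArg Subtype.val (h.ρ_κ F)) v) σ
    rw [h.ρ_apply _ hσ] at h1
    rw [h1, h.κ_of_notMem F (h.reset_mem hσW _ _) (h.resetOn_notMem hσ),
      h.resetOn_false_resetOn_true hσ, h.edgeVar_resetOn]
    change 0 - _ = _
    ring

/-- A function is linear in `X_g`. Writing it as a multiple of `X_g - X_p` plus its value at `X_g =
X_p` splits off the kernel of the merge. -/
theorem κ_ε_add_ι_ρ (F : W.space) : h.κ (h.ε F) + h.ι (h.ρ F) = F :=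
  space_ext fun v σ hσ => by
    change (h.κ (h.ε F)).1 v σ + (h.ι (h.ρ F)).1 v σ = _
    rw [h.ι_apply _ hσ, h.ρ_apply _ (h.reset_mem' hσ)]
    by_cases hU : σ ∈ U.S v
    · rw [h.κ_apply _ hσ, h.resetOn_eq hσ (by simpa using ((h.mem_iff _ _).1 hU).2), edgeVar,
        edgeVar, ((h.mem_iff _ _).1 hU).2, sub_self, zero_mul, zero_add]
    · rw [h.κ_of_notMem _ hσ hU, ← h.resetOn_true_eq hσ hU]
      have h1 : resetOn G g true σ ∈ U.S v := by
        rw [h.resetOn_true_eq hσ hU]; exact h.reset_mem' hσ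
      have h2 : resetOn G g true (resetOn G g true σ) = σ := by
        refine Eq.trans (resetOn_congr (τ := σ) (e' := g) (b' := false) ?_
          fun a ha => resetOn_of_notMem ha _ _ _) (h.resetOn_eq hσ (by simp))
        rw [resetOn_of_mem h.mem_g]
        simp
      have h3 := h.ε_apply F h1
      rw [h2, h.edgeVar_resetOn] at h3
      linear_combination -h3

/-- The cone of the merge of the circle retracts to the cube in which it is attached. -/
def mergeRetract {e : E} (he : e ∉ G) :
    DeformationRetract (coneD W.d U.d h.ρ) ((W.x e).prodMap (U.x e)) U.d (U.x e) :=
  DeformationRetract.ofMerge h.ρ h.ι h.κ h.ε h.ι_d h.κ_d h.ε_d (h.x_ι he) (h.x_κ he) (h.ε_x he)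
    h.ρ_ι h.ρ_κ h.ε_κ (h.ε_ι h) h.κ_ε_add_ι_ρ

/-- The cone of the split of the circle retracts to the cube in which it is attached. -/
def splitRetract {e : E} (he : e ∉ G) :
    DeformationRetract (coneD U.d W.d h.β) ((U.x e).prodMap (W.x e)) (-U.d) (U.x e) :=
  DeformationRetract.ofSplit h.β h.ι h.ε h.π h.ι_d h.ε_d h.π_d (h.x_ι he) (h.ε_x he) (h.x_π he)
    h.ε_β h.π_β h.π_ι (h.ε_ι h) h.β_ε_add_ι_π

end IsAttached

end Cube

end

/-! ### Removing kinks and bigons from a cube -/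

noncomputable section

namespace Cube

variable {E E' : Type*} {n : ℕ}

theorem saddleWeight_eq_one {U V : Set (E → Bool)} (p : E) {σ : E → Bool} (h : V ⊆ U)
    (hσ : σ ∈ V) : saddleWeight U V p σ = 1 := by
  rw [saddleWeight_of_mem p (h hσ) hσ, if_pos h]

theorem saddleWeight_eq_two_mul {U V : Set (E → Bool)} {p p' : E} {σ : E → Bool}
    (h : Xor (U ⊆ V) (V ⊆ U)) (hUV : U ⊆ V) (hσ : σ ∈ U) (hp : σ p = σ p') :
    saddleWeight U V p σ = 2 * edgeVar p' σ := by
  have h1 : ¬V ⊆ U := fun h1 => h.elim (fun h => h.2 h1) fun h => h.2 hUV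
  rw [saddleWeight_of_mem p hσ (hUV hσ), if_neg h1, edgeVar, edgeVar, hp]

section

variable (Q : Cube E (n + 1)) {G : Set E} {g p : E}

/-- Attaching the circle adds a condition on the sign vectors, so the saddle is a merge and its
weight is `1`. -/
theorem saddle_eq_ρ (h : IsAttached (Q.face false) (Q.face true) G g p) :
    Q.saddle false true = h.ρ :=
  h.eq_ρ fun F w σ hσ => by
    exact (congrArg (· * F.1 w σ) (saddleWeight_eq_one _ (fun τ hτ => h.mem_of_mem hτ) hσ)).trans (one_mul _)

/-- In this direction the condition is dropped and the saddle is a split. The hypothesis on the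
marked end identifies its weight with `2 X_p`. -/
theorem saddle_eq_β (h : IsAttached (Q.face true) (Q.face false) G g p)
    (hp : ∀ w, ∀ σ ∈ Q.S (Fin.cons false w), σ (Q.q 0 0) = σ p) :
    Q.saddle false true = h.β :=
  h.eq_β (fun F w σ hσ => by
    exact congrArg (· * F.1 w σ) (saddleWeight_eq_two_mul (Q.saddle_xor (a := false) rfl w)
      (fun τ hτ => h.mem_of_mem hτ) hσ (hp w σ hσ))) fun F w σ hσ => by
    exact (congrArg (· * F.1 w σ) (saddleWeight_eq_zero _ fun h' => hσ h'.1)).trans (zero_mul _)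

theorem torsionBound_merge_iff (h : IsAttached (Q.face false) (Q.face true) G g p) [Finite E]
    {e : E} (he : e ∉ G) (k : ℕ) :
    TorsionBound Q.d (Q.x e) k ↔ TorsionBound (Q.face true).d ((Q.face true).x e) k := by
  rw [torsionBound_cone_iff, Q.saddle_eq_ρ h]
  refine (h.mergeRetract he).torsionBound_iff (fun a => ?_) (d_x _ e) k
  exact coneD_comm ((Q.face false).d_x e) ((Q.face true).d_x e) (h.x_ρ e) a

theorem torsionBound_split_iff (h : IsAttached (Q.face true) (Q.face false) G g p) [Finite E]
    (hp : ∀ w, ∀ σ ∈ Q.S (Fin.cons false w), σ (Q.q 0 0) = σ p) {e : E} (he : e ∉ G) (k : ℕ) :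
    TorsionBound Q.d (Q.x e) k ↔ TorsionBound (Q.face false).d ((Q.face false).x e) k := by
  rw [torsionBound_cone_iff, ← TorsionBound.neg_iff (d := (Q.face false).d)]
  have h1 := h.splitRetract he
  rw [← Q.saddle_eq_β h hp] at h1
  refine h1.torsionBound_iff (fun a => ?_) (fun a => by simp [d_x]) k
  exact coneD_comm ((Q.face false).d_x e) ((Q.face true).d_x e) (Q.saddle_x _ _ e) a

end

/-! ### Two crossings -/

section

variable (Q : Cube E (n + 2))

/-- The resolutions of all but the first two crossings, at which the resolution is given. -/
abbrev corner (a b : Bool) : Cube E n := (Q.face a).face b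

/-- The saddle maps at the first crossing, with a given resolution of the second. -/
def sideSaddle (b a a' : Bool) : (Q.corner a b).space →ₗ[ℚ] (Q.corner a' b).space :=
  fiberMap (fun w => LinearMap.mulLeft ℚ (saddleWeight (Q.S (Fin.cons a (Fin.cons b w)))
    (Q.S (Fin.cons a' (Fin.cons b w))) (Q.q 0 0))) fun w f hf => by
      have := Q.saddleWeight_mul_mem (Fin.cons a (Fin.cons b w)) 0 a' hf
      rwa [Fin.update_cons_zero] at this

theorem consEquiv_saddle (a a' : Bool) (F : (Q.face a).space) :
    (Q.face a').consEquiv (Q.saddle a a' F) =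
      (Q.sideSaddle false a a').prodMap (Q.sideSaddle true a a') ((Q.face a).consEquiv F) := rfl

theorem sideSaddle_x (b a a' : Bool) (e : E) (F : (Q.corner a b).space) :
    Q.sideSaddle b a a' ((Q.corner a b).x e F) = (Q.corner a' b).x e (Q.sideSaddle b a a' F) :=
  Subtype.ext <| funext fun _ => mul_left_comm _ _ _

theorem sideSaddle_d [Finite E] {a a' : Bool} (ha : a' = !a) (b : Bool) (F : (Q.corner a b).space) :
    Q.sideSaddle b a a' ((Q.corner a b).d F) = (Q.corner a' b).d (Q.sideSaddle b a a' F) := by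
  subst ha
  refine fiberMap_d _ (fun w c hw f _ => ?_) F
  have h := (Q.isResolutionSquare (Fin.cons a (Fin.cons b w))
    (Fin.succ_ne_zero c.succ).symm).saddleWeight_comm a false
  have hw' : Function.update w c true = w := by rw [← hw, Function.update_eq_self]
  simp only [Fin.update_cons_zero, ← Fin.cons_update, Bool.not_false, hw'] at h
  simp only [LinearMap.mulLeft_apply, weight, face_S, face_q]
  rw [← mul_assoc, ← mul_assoc]
  congr 1
  rw [mul_comm, ← h, mul_comm]

theorem saddle_sideSaddle [Finite E] (F : (Q.corner false false).space) :
    (Q.face true).saddle false true (Q.sideSaddle false false true F) =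
      Q.sideSaddle true false true ((Q.face false).saddle false true F) := by
  refine Subtype.ext (funext fun w => ?_)
  have h := (Q.isResolutionSquare (Fin.cons false (Fin.cons false w))
    (Fin.succ_ne_zero 0).symm).saddleWeight_comm false false
  simp only [Fin.update_cons_zero, ← Fin.cons_update, Bool.not_false] at h
  change saddleWeight _ _ _ * (saddleWeight _ _ _ * F.1 w) =
    saddleWeight _ _ _ * (saddleWeight _ _ _ * F.1 w)
  rw [← mul_assoc, ← mul_assoc]
  congr 1
  exact (mul_comm _ _).trans (h.trans (mul_comm _ _))

theorem sideSaddle_xor (b : Bool) (w : Fin n → Bool) :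
    Xor ((Q.corner false b).S w ⊆ (Q.corner true b).S w)
      ((Q.corner true b).S w ⊆ (Q.corner false b).S w) :=
  Q.saddle_xor (a := false) rfl (Fin.cons b w)

/-- Splitting off the first two crossings. -/
def squareEquiv : Q.space ≃ₗ[ℚ] ((Q.corner false false).space × (Q.corner false true).space) ×
    (Q.corner true false).space × (Q.corner true true).space :=
  Q.consEquiv ≪≫ₗ LinearEquiv.prodCongr (Q.face false).consEquiv (Q.face true).consEquiv

theorem squareEquiv_d (F : Q.space) : Q.squareEquiv (Q.d F) =
    squareD (Q.corner false false).d (Q.corner false true).d (Q.corner true false).d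
      (Q.corner true true).d ((Q.face false).saddle false true) (Q.sideSaddle false false true)
      (Q.sideSaddle true false true) ((Q.face true).saddle false true) (Q.squareEquiv F) := by
  have h : ∀ a : (Q.face false).space × (Q.face true).space,
      LinearEquiv.prodCongr (Q.face false).consEquiv (Q.face true).consEquiv
        (coneD (Q.face false).d (Q.face true).d (Q.saddle false true) a) =
      squareD (Q.corner false false).d (Q.corner false true).d (Q.corner true false).d
        (Q.corner true true).d ((Q.face false).saddle false true) (Q.sideSaddle false false true)
        (Q.sideSaddle true false true) ((Q.face true).saddle false true)
        (LinearEquiv.prodCongr (Q.face false).consEquiv (Q.face true).consEquiv a) := fun a => by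
    refine Prod.ext ((Q.face false).consEquiv_d a.1) ?_
    change (Q.face true).consEquiv (Q.saddle false true a.1 - (Q.face true).d a.2) = _
    rw [map_sub, consEquiv_d, consEquiv_saddle]
    rfl
  rw [squareEquiv, LinearEquiv.trans_apply, consEquiv_d, h, LinearEquiv.trans_apply]

theorem squareEquiv_x (e : E) (F : Q.space) : Q.squareEquiv (Q.x e F) =
    (((Q.corner false false).x e).prodMap ((Q.corner false true).x e)).prodMap
      (((Q.corner true false).x e).prodMap ((Q.corner true true).x e)) (Q.squareEquiv F) := rfl

variable {Q} {G : Set E} {g p p' : E} [Finite E]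

/-- Removing a bigon: a circle splits off in the first direction and is merged in the second. -/
def bigonRetract (hb : IsAttached (Q.corner true false) (Q.corner false false) G g p)
    (hm : IsAttached (Q.corner true false) (Q.corner true true) G g p')
    (hp : ∀ w, ∀ σ ∈ (Q.corner false false).S w, σ (Q.q 0 0) = σ p) {e : E} (he : e ∉ G) :
    DeformationRetract Q.d (Q.x e) (-(Q.corner false true).d) ((Q.corner false true).x e) :=
  have h1 : Q.sideSaddle false false true = hb.β :=
    hb.eq_β (fun F w σ hσ => by
      exact congrArg (· * F.1 w σ) (saddleWeight_eq_two_mul (Q.sideSaddle_xor false w)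
        (fun τ hτ => hb.mem_of_mem hτ) hσ (hp w σ hσ))) fun F w σ hσ => by
      exact (congrArg (· * F.1 w σ) (saddleWeight_eq_zero _ fun h' => hσ h'.1)).trans (zero_mul _)
  have h2 : (Q.face true).saddle false true = hm.ρ := (Q.face true).saddle_eq_ρ hm
  (DeformationRetract.ofSquare hm.ι hb.ε ((Q.face false).saddle_d rfl) (Q.sideSaddle_d rfl true)
    hm.ι_d hb.ε_d ((Q.face false).saddle_x _ _ e) (Q.sideSaddle_x _ _ _ e) (hm.x_ι he)
    (hb.ε_x he) (fun a => by rw [h2, hm.ρ_ι]) (fun a => by rw [h1, hb.ε_β]) (hb.ε_ι hm)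
    (fun a => (Q.saddle_sideSaddle a).symm)
    (fun a => by rw [h1, h2]; exact hb.β_ε_add_ι_ρ hm a)).congr Q.squareEquiv Q.squareEquiv_d
    (Q.squareEquiv_x e)

/-- Removing a bigon: a circle splits off in the second direction and is merged in the first. -/
def bigonRetractSwap (hb : IsAttached (Q.corner false true) (Q.corner false false) G g p)
    (hm : IsAttached (Q.corner false true) (Q.corner true true) G g p')
    (hp : ∀ w, ∀ σ ∈ (Q.corner false false).S w, σ (Q.q 1 0) = σ p) {e : E} (he : e ∉ G) :
    DeformationRetract Q.d (Q.x e) (-(Q.corner true false).d) ((Q.corner true false).x e) :=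
  have h1 : (Q.face false).saddle false true = hb.β := (Q.face false).saddle_eq_β hb hp
  have h2 : Q.sideSaddle true false true = hm.ρ := hm.eq_ρ fun F w σ hσ => by
    exact (congrArg (· * F.1 w σ) (saddleWeight_eq_one _ (fun τ hτ => hm.mem_of_mem hτ) hσ)).trans (one_mul _)
  (DeformationRetract.ofSquare hm.ι hb.ε (Q.sideSaddle_d rfl false) ((Q.face true).saddle_d rfl)
    hm.ι_d hb.ε_d (Q.sideSaddle_x _ _ _ e) ((Q.face true).saddle_x _ _ e) (hm.x_ι he)
    (hb.ε_x he) (fun a => by rw [h2, hm.ρ_ι]) (fun a => by rw [h1, hb.ε_β]) (hb.ε_ι hm)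
    Q.saddle_sideSaddle
    (fun a => by rw [h1, h2]; exact hb.β_ε_add_ι_ρ hm a)).congr (Q.squareEquiv ≪≫ₗ squareSwap)
    (fun F => by rw [LinearEquiv.trans_apply, squareEquiv_d, squareSwap_squareD]; rfl)
    (fun F => by
      rw [LinearEquiv.trans_apply, squareEquiv_x]
      exact Prod.ext rfl (Prod.ext rfl (map_neg _ _).symm))

theorem torsionBound_bigon_iff
    (hb : IsAttached (Q.corner true false) (Q.corner false false) G g p)
    (hm : IsAttached (Q.corner true false) (Q.corner true true) G g p')
    (hp : ∀ w, ∀ σ ∈ (Q.corner false false).S w, σ (Q.q 0 0) = σ p) {e : E} (he : e ∉ G) (k : ℕ) :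
    TorsionBound Q.d (Q.x e) k ↔
      TorsionBound (Q.corner false true).d ((Q.corner false true).x e) k := by
  rw [← TorsionBound.neg_iff (d := (Q.corner false true).d)]
  exact (bigonRetract hb hm hp he).torsionBound_iff (d_x Q e) (fun a => by simp [d_x]) k

end

/-! ### Cubes of all sign vectors constant on the circles -/

/-- The sets of sign vectors are determined by the ends of the crossings. -/
def IsFull (Q : Cube E n) : Prop := ∀ v, Q.S v = resolutionSet Q.q v

theorem IsFull.mem_iff {Q : Cube E n} (hQ : Q.IsFull) {v : Fin n → Bool} {σ : E → Bool} :
    σ ∈ Q.S v ↔ ∀ c, Respects (v c) (Q.q c) σ := by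
  rw [hQ v]; rfl

theorem IsFull.mem_cons_iff {Q : Cube E (n + 1)} (hQ : Q.IsFull) {a : Bool} {w : Fin n → Bool}
    {σ : E → Bool} : σ ∈ Q.S (Fin.cons a w) ↔
      Respects a (Q.q 0) σ ∧ ∀ c : Fin n, Respects (w c) (Q.q c.succ) σ := by
  rw [hQ.mem_iff, Fin.forall_fin_succ]
  rfl

theorem IsFull.reindex {n' : ℕ} {Q : Cube E n} (hQ : Q.IsFull) (ε : Fin n' ≃ Fin n) :
    (Q.reindex ε).IsFull := fun v => by
  ext σ
  change σ ∈ Q.S (v ∘ ε.symm) ↔ ∀ c, Respects (v c) (Q.q (ε c)) σ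
  rw [hQ.mem_iff, ← ε.forall_congr_right]
  simp

/-- Used after a circle has been cancelled: the larger set of edges still contains the erased ones,
but each of these lies on a circle with a retained edge, so renaming edges along `φ` loses nothing.
-/
theorem torsionBound_quotient_iff {U : Cube E n} {Q' : Cube E' n} {φ : E → E'} {ψ : E' → E}
    (hq : ∀ c i, Q'.q c i = φ (U.q c i)) (hφψ : ∀ e, φ (ψ e) = e)
    (hU : ∀ v, ∀ σ ∈ U.S v, ∀ e, σ (ψ (φ e)) = σ e)
    (hφ : ∀ v, ∀ σ ∈ Q'.S v, σ ∘ φ ∈ U.S v) (hψ : ∀ v, ∀ σ ∈ U.S v, σ ∘ ψ ∈ Q'.S v)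
    (e : E) (k : ℕ) :
    TorsionBound U.d (U.x e) k ↔ TorsionBound Q'.d (Q'.x (φ e)) k := by
  refine torsionBound_transfer_iff (j := ψ) ⟨isSignSubst_comp φ, hφ, fun v σ _ c b => ?_,
    fun v σ _ c _ => ?_⟩ ⟨isSignSubst_comp ψ, hψ, fun v σ hσ c b => ?_, fun v σ hσ c _ => ?_⟩ hU
    (fun v σ _ e => by rw [hφψ]) e k
  · exact (Respects.congr fun i => by rw [hq]; rfl).1
  · rw [hq]; rfl
  · exact (Respects.congr fun i => by rw [hq]; exact hU v σ hσ _).1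
  · rw [hq]; exact hU v σ hσ _

section

variable [Finite E] {Q' : Cube E' n} {φ : E → E'} {ψ : E' → E}

/-- One resolution of the kink cuts off `g` as a circle and the other attaches it to `p`. Cancelling
the circle leaves the resolution in which `p`, `g`, `q` form one strand, which is the diagram
without the kink. -/
theorem torsionBound_kink_iff {Q : Cube E (n + 1)} (hQ : Q.IsFull) (hQ' : Q'.IsFull) {g p q : E}
    (h0 : Q.q 0 = ![g, g, p, q] ∨ Q.q 0 = ![p, g, g, q]) (hp : p ≠ g)
    (hqg : q ≠ g) (hg : ∀ (c : Fin n) i, Q.q c.succ i ≠ g) (hq : ∀ c i, Q'.q c i = φ (Q.q c.succ i))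
    (hφψ : ∀ e, φ (ψ e) = e) (hφp : φ p = φ q) (hφg : φ g = φ p)
    (hψφ : ∀ σ : E → Bool, σ p = σ q → ∀ e, e ≠ g → σ (ψ (φ e)) = σ e)
    {e : E} (he : e ≠ g) (k : ℕ) :
    TorsionBound Q.d (Q.x e) k ↔ TorsionBound Q'.d (Q'.x (φ e)) k := by
  have hrest : ∀ {σ τ : E → Bool} {w : Fin n → Bool}, (∀ e, e ≠ g → τ e = σ e) →
      (∀ c, Respects (w c) (Q.q c.succ) σ) → ∀ c, Respects (w c) (Q.q c.succ) τ :=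
    fun hτ h c => (Respects.congr fun i => (hτ _ (hg c i)).symm).1 (h c)
  have hmem : ∀ b, (∀ w, ∀ σ ∈ (Q.face b).S w, σ g = σ p ∧ σ p = σ q) →
      (∀ σ : E → Bool, σ g = σ p → σ p = σ q → Respects b (Q.q 0) σ) →
      (TorsionBound (Q.face b).d ((Q.face b).x e) k ↔ TorsionBound Q'.d (Q'.x (φ e)) k) := by
    intro b hb hb'
    have hU : ∀ w, ∀ σ ∈ (Q.face b).S w, ∀ e, σ (ψ (φ e)) = σ e := by
      intro w σ hσ e
      obtain ⟨h1, h2⟩ := hb w σ hσ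
      by_cases he : e = g
      · rw [he, hφg, hψφ σ h2 p hp, h1]
      · exact hψφ σ h2 e he
    refine torsionBound_quotient_iff hq hφψ hU (fun w σ hσ => ?_) (fun w σ hσ => ?_) e k
    · refine hQ.mem_cons_iff.2 ⟨hb' _ (congrArg σ hφg) (congrArg σ hφp), fun c => ?_⟩
      exact (Respects.congr fun i => congrArg σ (hq c i)).1 (hQ'.mem_iff.1 hσ c)
    · refine hQ'.mem_iff.2 fun c => ?_
      refine (Respects.congr fun i => ?_).1 ((hQ.mem_cons_iff.1 hσ).2 c)
      rw [hq]
      exact (hU w σ hσ _).symm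
  rcases h0 with h0 | h0
  -- For this sign of the kink the `0`-resolution closes up `g`, so the saddle merges the circle.
  · have hA : IsAttached (Q.face false) (Q.face true) {g} g p :=
      { mem_g := rfl
        notMem_p := hp
        q_eq := fun _ _ => rfl
        notMem_q := hg
        const := fun v σ _ e he => congrArg σ he
        reset := fun v σ hσ τ h1 h2 => by
          obtain ⟨h3, h4⟩ := hQ.mem_cons_iff.1 hσ
          refine hQ.mem_cons_iff.2 ⟨?_, hrest h1 h4⟩
          rw [h0] at h3 ⊢
          exact ⟨rfl, ((h1 _ hp).trans h3.2).trans (h1 _ hqg).symm⟩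
        mem_iff := fun v σ => by
          rw [face_S, face_S, hQ.mem_cons_iff, hQ.mem_cons_iff, h0]
          constructor
          · rintro ⟨⟨h1, h2⟩, h3⟩
            exact ⟨⟨⟨rfl, h2.symm.trans h1⟩, h3⟩, h2⟩
          · rintro ⟨⟨⟨h1, h2⟩, h3⟩, h4⟩
            exact ⟨⟨h4.trans h2, h4⟩, h3⟩ }
    rw [Q.torsionBound_merge_iff hA he]
    refine hmem true (fun w σ hσ => ?_) fun σ h1 h2 => ?_
    · have h3 := (hQ.mem_cons_iff.1 hσ).1
      rw [h0] at h3
      exact ⟨h3.2, h3.2.symm.trans h3.1⟩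
    · rw [h0]; exact ⟨h1.trans h2, h1⟩
  -- For the other sign the `1`-resolution closes up `g`, so the saddle splits the circle off.
  · have hA : IsAttached (Q.face true) (Q.face false) {g} g p :=
      { mem_g := rfl
        notMem_p := hp
        q_eq := fun _ _ => rfl
        notMem_q := hg
        const := fun v σ _ e he => congrArg σ he
        reset := fun v σ hσ τ h1 h2 => by
          obtain ⟨h3, h4⟩ := hQ.mem_cons_iff.1 hσ
          refine hQ.mem_cons_iff.2 ⟨?_, hrest h1 h4⟩
          rw [h0] at h3 ⊢
          exact ⟨((h1 _ hp).trans h3.1).trans (h1 _ hqg).symm, rfl⟩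
        mem_iff := fun v σ => by
          rw [face_S, face_S, hQ.mem_cons_iff, hQ.mem_cons_iff, h0]
          constructor
          · rintro ⟨⟨h1, h2⟩, h3⟩
            exact ⟨⟨⟨h1.trans h2, rfl⟩, h3⟩, h1.symm⟩
          · rintro ⟨⟨⟨h1, h2⟩, h3⟩, h4⟩
            exact ⟨⟨h4.symm, h4.trans h1⟩, h3⟩ }
    rw [Q.torsionBound_split_iff hA (fun w σ _ => by rw [h0]; rfl) he]
    refine hmem false (fun w σ hσ => ?_) fun σ h1 h2 => ?_
    · have h3 := (hQ.mem_cons_iff.1 hσ).1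
      rw [h0] at h3
      exact ⟨h3.1.symm, h3.1.trans h3.2⟩
    · rw [h0]; exact ⟨h1.symm, h1.trans h2⟩

/-- Among the four resolutions of the two crossings, `(1, 0)` contains the circle formed by `g` and
`h`. It is attached to `p₁` in `(0, 0)` and to `p₂` in `(1, 1)`. Cancelling these three leaves `(0,
1)`, where the strands `p₁, h, p₂` and `q₁, g, q₂` run side by side. -/
theorem torsionBound_bigon_removal_iff {Q : Cube E (n + 2)} (hQ : Q.IsFull) (hQ' : Q'.IsFull)
    {g h p₁ p₂ q₁ q₂ : E} (h0 : Q.q 0 = ![h, p₁, q₁, g]) (h1 : Q.q 1 = ![q₂, p₂, h, g])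
    (hp₁ : p₁ ∉ ({g, h} : Set E)) (hp₂ : p₂ ∉ ({g, h} : Set E)) (hq₁ : q₁ ∉ ({g, h} : Set E))
    (hq₂ : q₂ ∉ ({g, h} : Set E)) (hg : ∀ (c : Fin n) i, Q.q c.succ.succ i ∉ ({g, h} : Set E))
    (hq : ∀ c i, Q'.q c i = φ (Q.q c.succ.succ i)) (hφψ : ∀ e, φ (ψ e) = e)
    (hφp : φ p₁ = φ p₂) (hφq : φ q₁ = φ q₂) (hφg : φ g = φ q₁) (hφh : φ h = φ p₁)
    (hψφ : ∀ σ : E → Bool, σ p₁ = σ p₂ → σ q₁ = σ q₂ →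
      ∀ e ∉ ({g, h} : Set E), σ (ψ (φ e)) = σ e) {e : E} (he : e ∉ ({g, h} : Set E)) (k : ℕ) :
    TorsionBound Q.d (Q.x e) k ↔ TorsionBound Q'.d (Q'.x (φ e)) k := by
  have hrest : ∀ {σ τ : E → Bool} {w : Fin n → Bool}, (∀ e ∉ ({g, h} : Set E), τ e = σ e) →
      (∀ c, Respects (w c) (Q.q c.succ.succ) σ) → ∀ c, Respects (w c) (Q.q c.succ.succ) τ :=
    fun hτ h c => (Respects.congr fun i => (hτ _ (hg c i)).symm).1 (h c)
  have hmem : ∀ {a b : Bool} {w : Fin n → Bool} {σ : E → Bool}, σ ∈ (Q.corner a b).S w ↔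
      Respects a ![h, p₁, q₁, g] σ ∧ Respects b ![q₂, p₂, h, g] σ ∧
        ∀ c, Respects (w c) (Q.q c.succ.succ) σ := by
    intro a b w σ
    rw [face_S, face_S, hQ.mem_cons_iff, Fin.forall_fin_succ, h0]
    simp only [Fin.cons_zero, Fin.cons_succ, Fin.succ_zero_eq_one, h1]
  have hgG : g ∈ ({g, h} : Set E) := Or.inl rfl
  have hhG : h ∈ ({g, h} : Set E) := Or.inr rfl
  have hreset : ∀ v, ∀ σ ∈ (Q.corner true false).S v, ∀ τ : E → Bool,
      (∀ e ∉ ({g, h} : Set E), τ e = σ e) → (∀ e ∈ ({g, h} : Set E), τ e = τ g) →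
        τ ∈ (Q.corner true false).S v := by
    intro v σ hσ τ t1 t2
    obtain ⟨⟨r1, r2⟩, ⟨r3, r4⟩, r5⟩ := hmem.1 hσ
    refine hmem.2 ⟨⟨t2 h hhG, ?_⟩, ⟨?_, t2 h hhG⟩, hrest t1 r5⟩
    · exact ((t1 _ hp₁).trans r2).trans (t1 _ hq₁).symm
    · exact ((t1 _ hq₂).trans r3).trans (t1 _ hp₂).symm
  have hconst : ∀ v, ∀ σ ∈ (Q.corner true false).S v, ∀ e ∈ ({g, h} : Set E), σ e = σ g := by
    rintro v σ hσ e (rfl | rfl)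
    · rfl
    · exact (hmem.1 hσ).1.1
  have hb : IsAttached (Q.corner true false) (Q.corner false false) {g, h} g p₁ :=
    { mem_g := hgG
      notMem_p := hp₁
      q_eq := fun _ _ => rfl
      notMem_q := hg
      const := hconst
      reset := hreset
      mem_iff := fun v σ => by
        rw [hmem, hmem]
        constructor
        · rintro ⟨⟨r1, r2⟩, ⟨r3, r4⟩, r5⟩
          exact ⟨⟨⟨r4, r1.symm.trans (r4.trans r2.symm)⟩, ⟨r3, r4⟩, r5⟩, r4.symm.trans r1⟩
        · rintro ⟨⟨⟨r1, r2⟩, ⟨r3, r4⟩, r5⟩, r6⟩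
          exact ⟨⟨r1.trans r6, r2.symm.trans r6.symm⟩, ⟨r3, r4⟩, r5⟩ }
  have hm : IsAttached (Q.corner true false) (Q.corner true true) {g, h} g p₂ :=
    { mem_g := hgG
      notMem_p := hp₂
      q_eq := fun _ _ => rfl
      notMem_q := hg
      const := hconst
      reset := hreset
      mem_iff := fun v σ => by
        rw [hmem, hmem]
        constructor
        · rintro ⟨⟨r1, r2⟩, ⟨r3, r4⟩, r5⟩
          exact ⟨⟨⟨r1, r2⟩, ⟨r3.trans (r1.symm.trans r4.symm), r1⟩, r5⟩, r1.symm.trans r4.symm⟩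
        · rintro ⟨⟨⟨r1, r2⟩, ⟨r3, r4⟩, r5⟩, r6⟩
          exact ⟨⟨r1, r2⟩, ⟨r3.trans r6.symm, r6.symm.trans r1.symm⟩, r5⟩ }
  rw [torsionBound_bigon_iff hb hm (fun w σ hσ => by rw [h0]; exact (hmem.1 hσ).1.1) he]
  have hU : ∀ w, ∀ σ ∈ (Q.corner false true).S w, ∀ e, σ (ψ (φ e)) = σ e := by
    intro w σ hσ e
    obtain ⟨⟨r1, r2⟩, ⟨r3, r4⟩, -⟩ := hmem.1 hσ
    have hpp : σ p₁ = σ p₂ := r1.symm.trans r4.symm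
    have hqq : σ q₁ = σ q₂ := r2.trans r3.symm
    by_cases he : e ∈ ({g, h} : Set E)
    · rcases he with rfl | rfl
      · rw [hφg, hψφ σ hpp hqq _ hq₁]; exact r2
      · rw [hφh, hψφ σ hpp hqq _ hp₁]; exact r1.symm
    · exact hψφ σ hpp hqq e he
  refine torsionBound_quotient_iff hq hφψ hU (fun w σ hσ => ?_) (fun w σ hσ => ?_) e k
  · refine hmem.2 ⟨⟨congrArg σ hφh, congrArg σ hφg.symm⟩, ⟨congrArg σ (hφq.symm.trans hφg.symm),
      congrArg σ (hφp.symm.trans hφh.symm)⟩, fun c => ?_⟩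
    exact (Respects.congr fun i => congrArg σ (hq c i)).1 (hQ'.mem_iff.1 hσ c)
  · refine hQ'.mem_iff.2 fun c => ?_
    refine (Respects.congr fun i => ?_).1 ((hmem.1 hσ).2.2 c)
    rw [hq]
    exact (hU w σ hσ _).symm

end

end Cube

end

/-! ### Invariance under isomorphisms and the first two Reidemeister moves -/

noncomputable section

/-- A half turn of the crossing preserves each of the two resolutions. -/
theorem Respects.add_iff {E : Type*} {b : Bool} {q : Fin 4 → E} {σ : E → Bool} {r : Fin 4}
    (hr : r = 0 ∨ r = 2) : Respects b (fun i => q (i + r)) σ ↔ Respects b q σ := by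
  rcases hr with rfl | rfl
  · simp
  · have h1 : (1 : Fin 4) + 2 = 3 := rfl
    have h2 : (2 : Fin 4) + 2 = 0 := rfl
    have h3 : (3 : Fin 4) + 2 = 1 := rfl
    cases b <;> simp only [Respects, zero_add, h1, h2, h3]
    · exact and_comm
    · exact ⟨fun h => ⟨h.2.symm, h.1.symm⟩, fun h => ⟨h.2.symm, h.1.symm⟩⟩

theorem Relation.EqvGen.apply_eq {α β : Type*} {r : α → α → Prop} {f : α → β} {a b : α}
    (h : Relation.EqvGen r a b) (hf : ∀ a b, r a b → f a = f b) : f a = f b :=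
  congrArg (Quot.lift f hf) (Quot.eqvGen_sound h)

namespace PDCode.IsKnotDiagram

variable {D D' : PDCode}

theorem isFull_cube (h : D.IsKnotDiagram) : h.cube.IsFull := fun _ => rfl

/-- A bound on the order of torsion, for the actions of all edges. -/
def HasTorsionBound (h : D.IsKnotDiagram) (k : ℕ) : Prop :=
  ∀ e, TorsionBound h.cube.d (h.cube.x e) k

theorem hasTorsionBound_iff (h : D.IsKnotDiagram) (e : Fin D.m) (k : ℕ) :
    h.HasTorsionBound k ↔ TorsionBound h.cube.d (h.cube.x e) k :=
  ⟨fun h' => h' e, fun h' f => h.torsionBound_of_edge h' f⟩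

theorem hasTorsionBound_iff_of_iso (h : D.IsKnotDiagram) (h' : D'.IsKnotDiagram) (hD : D.Iso D')
    (k : ℕ) : h.HasTorsionBound k ↔ h'.HasTorsionBound k := by
  obtain ⟨κ, ε, r, hr, hends⟩ := hD
  have key : ∀ (σ : Fin D'.m → Bool) c b,
      Respects b (D.ends c) (σ ∘ ε) ↔ Respects b (D'.ends (κ c)) σ := fun σ c b => by
    rw [← Respects.add_iff (q := D'.ends (κ c)) (hr c)]
    exact Respects.congr fun i => congrArg σ (hends c i).symm
  have key' : ∀ (σ : Fin D.m → Bool) c b,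
      Respects b (D'.ends (κ c)) (σ ∘ ε.symm) ↔ Respects b (D.ends c) σ := fun σ c b => by
    rw [← key]
    exact Respects.congr fun i => by simp
  have hv : ∀ (v : Fin D.n → Bool) c, (v ∘ κ.symm) (κ c) = v c := fun v c => by simp
  have hmem : ∀ (v : Fin D.n → Bool) (σ : Fin D'.m → Bool), σ ∈ (h'.cube.reindex κ).S v ↔
      ∀ c, Respects (v c) (D'.ends (κ c)) σ := fun v σ => (h'.isFull_cube.reindex κ).mem_iff
  rw [h.hasTorsionBound_iff ⟨0, h.nonempty⟩, h'.hasTorsionBound_iff (ε ⟨0, h.nonempty⟩),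
    ← h'.cube.torsionBound_reindex_iff κ]
  refine Cube.torsionBound_transfer_iff (j := ε.symm)
    ⟨Cube.isSignSubst_comp ε, fun v σ hσ c => ?_, fun v σ _ c b => (key σ c b).1,
      fun v σ hσ c hc => ?_⟩
    ⟨Cube.isSignSubst_comp ε.symm, fun v σ hσ => ?_, fun v σ _ c b => (key' σ c b).1,
      fun v σ hσ c hc => ?_⟩ (fun v σ _ e => by simp) (fun v σ _ e => by simp) _ k
  · exact (key σ c _).2 ((hmem v σ).1 hσ c)
  · refine Eq.trans (congrArg σ (hends c 0).symm) ?_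
    exact hc _
  · exact (hmem v _).2 fun c => (key' σ c _).2 (hσ c)
  · have h1 := hends c (0 - r c)
    rw [sub_add_cancel] at h1
    change σ (ε.symm (D'.ends (κ c) 0)) = σ (D.ends c 0)
    rw [h1, ε.symm_apply_apply]
    exact hc _

theorem hasTorsionBound_iff_of_reidemeister1 (h : D.IsKnotDiagram) (h' : D'.IsKnotDiagram)
    (hD : D.Reidemeister1 D') (k : ℕ) : h.HasTorsionBound k ↔ h'.HasTorsionBound k := by
  classical
  obtain ⟨c, g, p, q, h0, κ, f, hκ, hrange, hsurj, hf, hends⟩ := hD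
  have hcκ : ∀ i, κ i ≠ c := fun i hi => by
    have : κ i ∈ ({c} : Set (Fin D.n))ᶜ := hrange ▸ ⟨i, rfl⟩
    exact this hi
  -- Two ends of `g` are at the kink. If `p` or `q` were equal to `g`, there would be a third end,
  -- which an edge cannot have.
  obtain ⟨x, y, hxy, hx, hy, hxc, hyc, hpx⟩ : ∃ x y : Fin D.n × Fin 4, x ≠ y ∧
      D.ends x.1 x.2 = g ∧ D.ends y.1 y.2 = g ∧ x.1 = c ∧ y.1 = c ∧
        ((p ≠ g ∧ q ≠ g) ∨ ∃ z : Fin D.n × Fin 4, D.ends z.1 z.2 = g ∧ z ≠ x ∧ z ≠ y) := by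
    rcases h0 with h0 | h0
    · refine ⟨(c, 0), (c, 1), by simp, by simp [h0], by simp [h0], rfl, rfl, ?_⟩
      by_cases hp : p = g
      · exact Or.inr ⟨(c, 2), by simp [h0, hp], by simp, by simp⟩
      · by_cases hq : q = g
        · exact Or.inr ⟨(c, 3), by simp [h0, hq], by simp, by simp⟩
        · exact Or.inl ⟨hp, hq⟩
    · refine ⟨(c, 1), (c, 2), by simp, by simp [h0], by simp [h0], rfl, rfl, ?_⟩
      by_cases hp : p = g
      · exact Or.inr ⟨(c, 0), by simp [h0, hp], by simp, by simp⟩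
      · by_cases hq : q = g
        · exact Or.inr ⟨(c, 3), by simp [h0, hq], by simp, by simp⟩
        · exact Or.inl ⟨hp, hq⟩
  have honly : ∀ z : Fin D.n × Fin 4, D.ends z.1 z.2 = g → z = x ∨ z = y := fun z hz =>
    h.eq_or_eq_of_ends hxy (hx.trans hz.symm) (hy.trans hz.symm)
  obtain ⟨hp, hq⟩ : p ≠ g ∧ q ≠ g := by
    refine hpx.resolve_right ?_
    rintro ⟨z, hz, h1, h2⟩
    exact (honly z hz).elim h1 h2
  have hg : ∀ i j, D.ends (κ i) j ≠ g := fun i j hij => by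
    rcases honly (κ i, j) hij with h1 | h1
    · exact hcκ i ((congrArg Prod.fst h1).trans hxc)
    · exact hcκ i ((congrArg Prod.fst h1).trans hyc)
  choose ψ hψg hψ using hsurj
  let ε : Fin (D'.n + 1) ≃ Fin D.n := Equiv.ofBijective (Fin.cons c κ)
    ⟨Fin.cons_injective_iff.2 ⟨by rintro ⟨i, hi⟩; exact hcκ i hi, hκ⟩, fun d => by
      by_cases hd : d = c
      · exact ⟨0, hd.symm⟩
      · obtain ⟨i, hi⟩ : d ∈ Set.range κ := hrange ▸ hd
        exact ⟨i.succ, hi⟩⟩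
  -- The map `f` is arbitrary on the erased edge, so it is redefined there to follow the strand.
  let φ : Fin D.m → Fin D'.m := fun e => if e = g then f p else f e
  have hφ : ∀ e, e ≠ g → φ e = f e := fun e he => if_neg he
  have hpq : f p = f q := (hf p q hp hq).2 (Relation.EqvGen.rel _ _ ⟨rfl, rfl⟩)
  rw [h.hasTorsionBound_iff p, h'.hasTorsionBound_iff (φ p), ← h.cube.torsionBound_reindex_iff ε]
  refine Cube.torsionBound_kink_iff (h.isFull_cube.reindex ε) h'.isFull_cube (g := g) (p := p)
    (q := q) (ψ := ψ) h0 hp hq hg (fun i j => (hends i j).trans (hφ _ (hg i j)).symm)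
    (fun e => (hφ _ (hψg e)).trans (hψ e)) ?_ ?_ (fun σ hσ e he => ?_) hp k
  · rw [hφ p hp, hφ q hq, hpq]
  · rw [hφ p hp]; exact if_pos rfl
  · rw [hφ e he]
    refine ((hf _ e (hψg _) he).1 (hψ _)).apply_eq ?_
    rintro a b ⟨rfl, rfl⟩
    exact hσ

theorem hasTorsionBound_iff_of_reidemeister2 (h : D.IsKnotDiagram) (h' : D'.IsKnotDiagram)
    (hD : D.Reidemeister2 D') (k : ℕ) : h.HasTorsionBound k ↔ h'.HasTorsionBound k := by
  classical
  obtain ⟨c, d, g, k', p₁, p₂, q₁, q₂, hcd, h0, h1, κ, f, hκ, hrange, hsurj, hf, hends⟩ := hD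
  have hκ' : ∀ i, κ i ≠ c ∧ κ i ≠ d := fun i => by
    have : κ i ∈ ({c, d} : Set (Fin D.n))ᶜ := hrange ▸ ⟨i, rfl⟩
    exact ⟨fun h => this (Or.inl h), fun h => this (Or.inr h)⟩
  have hg : ∀ z : Fin D.n × Fin 4, D.ends z.1 z.2 = g → z = (c, 3) ∨ z = (d, 3) := fun z hz =>
    h.eq_or_eq_of_ends (by simp [hcd]) (by simp [h0, hz]) (by simp [h1, hz])
  have hk : ∀ z : Fin D.n × Fin 4, D.ends z.1 z.2 = k' → z = (c, 0) ∨ z = (d, 2) := fun z hz =>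
    h.eq_or_eq_of_ends (by simp [hcd]) (by simp [h0, hz]) (by simp [h1, hz])
  have hG : ∀ z : Fin D.n × Fin 4, z ≠ (c, 3) → z ≠ (d, 3) → z ≠ (c, 0) → z ≠ (d, 2) →
      D.ends z.1 z.2 ∉ ({g, k'} : Set (Fin D.m)) := by
    rintro z h1 h2 h3 h4 (h5 | h5)
    · exact (hg z h5).elim h1 h2
    · exact (hk z h5).elim h3 h4
  have hp₁ : p₁ ∉ ({g, k'} : Set (Fin D.m)) := by
    simpa [h0] using hG (c, 1) (by simp) (by simp) (by simp) (by simp)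
  have hq₁ : q₁ ∉ ({g, k'} : Set (Fin D.m)) := by
    simpa [h0] using hG (c, 2) (by simp) (by simp) (by simp) (by simp [hcd])
  have hp₂ : p₂ ∉ ({g, k'} : Set (Fin D.m)) := by
    simpa [h1] using hG (d, 1) (by simp) (by simp) (by simp) (by simp)
  have hq₂ : q₂ ∉ ({g, k'} : Set (Fin D.m)) := by
    simpa [h1] using hG (d, 0) (by simp) (by simp) (by simp [hcd.symm]) (by simp)
  have hrest : ∀ i j, D.ends (κ i) j ∉ ({g, k'} : Set (Fin D.m)) := fun i j =>
    hG (κ i, j) (by simp [hκ' i]) (by simp [hκ' i]) (by simp [hκ' i]) (by simp [hκ' i])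
  choose ψ hψg hψ using hsurj
  let ε : Fin (D'.n + 2) ≃ Fin D.n := Equiv.ofBijective (Fin.cons c (Fin.cons d κ : Fin (D'.n + 1) → _))
    ⟨Fin.cons_injective_iff.2 ⟨by
        rintro ⟨i, hi⟩
        cases i using Fin.cases with
        | zero => exact hcd hi.symm
        | succ i => exact (hκ' i).1 hi,
      Fin.cons_injective_iff.2 ⟨by rintro ⟨i, hi⟩; exact (hκ' i).2 hi, hκ⟩⟩, fun a => by
      by_cases hac : a = c
      · exact ⟨0, hac.symm⟩
      by_cases had : a = d
      · exact ⟨1, had.symm⟩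
      · obtain ⟨i, hi⟩ : a ∈ Set.range κ := hrange ▸ fun h => h.elim hac had
        exact ⟨i.succ.succ, hi⟩⟩
  -- On the erased edges `f` carries no information. It is redefined according to the strands in the
  -- surviving resolution, where `g` joins `q₁` and `h` joins `p₁`.
  let φ : Fin D.m → Fin D'.m := fun e => if e = g then f q₁ else if e = k' then f p₁ else f e
  have hφ : ∀ e, e ∉ ({g, k'} : Set (Fin D.m)) → φ e = f e := fun e he =>
    (if_neg fun h => he (Or.inl h)).trans (if_neg fun h => he (Or.inr h))
  have hgk : k' ≠ g := fun hgk => by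
    rcases hg (c, 0) (by simp [h0, hgk]) with h2 | h2 <;> simp at h2
  rw [h.hasTorsionBound_iff p₁, h'.hasTorsionBound_iff (φ p₁),
    ← h.cube.torsionBound_reindex_iff ε]
  refine Cube.torsionBound_bigon_removal_iff (h.isFull_cube.reindex ε) h'.isFull_cube (g := g)
    (h := k') (p₁ := p₁) (p₂ := p₂) (q₁ := q₁) (q₂ := q₂) (ψ := ψ) h0 h1 hp₁ hp₂ hq₁ hq₂ hrest
    (fun i j => (hends i j).trans (hφ _ (hrest i j)).symm)
    (fun e => (hφ _ (hψg e)).trans (hψ e)) ?_ ?_ ?_ ?_ (fun σ hσ hσ' e he => ?_) hp₁ k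
  · rw [hφ p₁ hp₁, hφ p₂ hp₂]
    exact (hf _ _ hp₁ hp₂).2 (Relation.EqvGen.rel _ _ (Or.inl ⟨rfl, rfl⟩))
  · rw [hφ q₁ hq₁, hφ q₂ hq₂]
    exact (hf _ _ hq₁ hq₂).2 (Relation.EqvGen.rel _ _ (Or.inr ⟨rfl, rfl⟩))
  · rw [hφ q₁ hq₁]; exact if_pos rfl
  · rw [hφ p₁ hp₁]; exact (if_neg hgk).trans (if_pos rfl)
  · rw [hφ e he]
    refine ((hf _ e (hψg _) he).1 (hψ _)).apply_eq ?_
    rintro a b (⟨rfl, rfl⟩ | ⟨rfl, rfl⟩)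
    · exact hσ
    · exact hσ'

end PDCode.IsKnotDiagram

end

/-! ### The third Reidemeister move -/

noncomputable section

theorem respects_false_iff {E : Type*} {p q r t : E} {σ : E → Bool} :
    Respects false ![p, q, r, t] σ ↔ σ p = σ q ∧ σ r = σ t := Iff.rfl

theorem respects_true_iff {E : Type*} {p q r t : E} {σ : E → Bool} :
    Respects true ![p, q, r, t] σ ↔ σ p = σ t ∧ σ q = σ r := Iff.rfl

namespace Cube

variable {E : Type*} {n : ℕ}

open Classical in
/-- The map of edges that replaces the edges `s i` by `t i`. -/
def substEdges (s t : Fin 3 → E) (e : E) : E :=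
  if e = s 0 then t 0 else if e = s 1 then t 1 else if e = s 2 then t 2 else e

theorem substEdges_of_ne {s t : Fin 3 → E} {e : E} (he : ∀ i, e ≠ s i) : substEdges s t e = e := by
  simp [substEdges, he]

/-- The cubes of two diagrams that differ by a third Reidemeister move. The first crossings are
`z, x, y` in the one and `z, y, x` in the other; the resolution `a` of `z` makes the other two
crossings bound a bigon. -/
structure IsTriangleMove (Q Q' : Cube E (n + 3)) (a : Bool) (b : Fin 6 → E) (s : Fin 3 → E) :
    Prop where
  full : Q.IsFull
  full' : Q'.IsFull
  s_injective : Function.Injective s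
  b_ne : ∀ i j, b i ≠ s j
  rest_ne : ∀ (c : Fin n) i j, Q.q c.succ.succ.succ i ≠ s j
  rest_eq : ∀ c : Fin n, Q'.q c.succ.succ.succ = Q.q c.succ.succ.succ
  q_x : Q.q 1 = ![b 1, s 0, s 1, b 0]
  q_y : Q.q 2 = ![b 2, b 3, s 2, s 0]
  q_y' : Q'.q 1 = ![s 2, s 0, b 5, b 0]
  q_x' : Q'.q 2 = ![s 1, b 3, b 4, s 0]
  respects_z : ∀ σ, Respects a (Q.q 0) σ ↔ σ (s 1) = σ (s 2) ∧ σ (b 4) = σ (b 5)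
  respects_z_not : ∀ σ, Respects (!a) (Q.q 0) σ ↔ σ (s 1) = σ (b 5) ∧ σ (s 2) = σ (b 4)
  respects_z' : ∀ σ, Respects a (Q'.q 0) σ ↔ σ (s 1) = σ (s 2) ∧ σ (b 1) = σ (b 2)
  respects_z_not' : ∀ σ, Respects (!a) (Q'.q 0) σ ↔ σ (s 1) = σ (b 2) ∧ σ (s 2) = σ (b 1)
  marker : ∀ σ : E → Bool, σ (s 1) = σ (s 2) → σ (Q.q 0 0) = σ (s 1)
  marker' : ∀ σ : E → Bool, σ (s 1) = σ (s 2) → σ (b 1) = σ (s 1) → σ (b 2) = σ (s 1) →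
    σ (Q'.q 0 0) = σ (s 1)

namespace IsTriangleMove

variable {Q Q' : Cube E (n + 3)} {a : Bool} {b : Fin 6 → E} {s : Fin 3 → E}
  (h : IsTriangleMove Q Q' a b s)

theorem comp_zero (_ : IsTriangleMove Q Q' a b s) (σ : E → Bool) (t : Fin 3 → E) :
    (σ ∘ substEdges s t) (s 0) = σ (t 0) := by
  simp [substEdges]

include h

theorem comp_one (σ : E → Bool) (t : Fin 3 → E) : (σ ∘ substEdges s t) (s 1) = σ (t 1) := by
  simp [substEdges, h.s_injective.eq_iff]

theorem comp_two (σ : E → Bool) (t : Fin 3 → E) : (σ ∘ substEdges s t) (s 2) = σ (t 2) := by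
  simp [substEdges, h.s_injective.eq_iff]

theorem comp_b (σ : E → Bool) (t : Fin 3 → E) (i : Fin 6) :
    (σ ∘ substEdges s t) (b i) = σ (b i) :=
  congrArg σ (substEdges_of_ne (h.b_ne i))

theorem rest_comp (σ : E → Bool) (t : Fin 3 → E) (w : Fin n → Bool) :
    (∀ c : Fin n, Respects (w c) (Q.q c.succ.succ.succ) (σ ∘ substEdges s t)) ↔
      ∀ c : Fin n, Respects (w c) (Q.q c.succ.succ.succ) σ :=
  forall_congr' fun c => Respects.congr fun i => congrArg σ (substEdges_of_ne (h.rest_ne c i))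

theorem mem_iff {r x y : Bool} {w : Fin n → Bool} {σ : E → Bool} :
    σ ∈ Q.S (Fin.cons r (Fin.cons x (Fin.cons y w))) ↔ Respects r (Q.q 0) σ ∧
      Respects x ![b 1, s 0, s 1, b 0] σ ∧ Respects y ![b 2, b 3, s 2, s 0] σ ∧
        ∀ c : Fin n, Respects (w c) (Q.q c.succ.succ.succ) σ := by
  rw [h.full.mem_cons_iff, Fin.forall_fin_succ, Fin.forall_fin_succ]
  simp only [Fin.cons_zero, Fin.cons_succ, Fin.succ_zero_eq_one, Fin.succ_one_eq_two, h.q_x, h.q_y]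
  exact Iff.rfl

theorem mem_iff' {r y x : Bool} {w : Fin n → Bool} {σ : E → Bool} :
    σ ∈ Q'.S (Fin.cons r (Fin.cons y (Fin.cons x w))) ↔ Respects r (Q'.q 0) σ ∧
      Respects y ![s 2, s 0, b 5, b 0] σ ∧ Respects x ![s 1, b 3, b 4, s 0] σ ∧
        ∀ c : Fin n, Respects (w c) (Q.q c.succ.succ.succ) σ := by
  rw [h.full'.mem_cons_iff, Fin.forall_fin_succ, Fin.forall_fin_succ]
  simp only [Fin.cons_zero, Fin.cons_succ, Fin.succ_zero_eq_one, Fin.succ_one_eq_two, h.q_x',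
    h.q_y', h.rest_eq]
  exact Iff.rfl

/-- Transfer between the faces in which there is no bigon. -/
theorem isMorphism_face : IsMorphism (Q.face !a) (Q'.face !a)
    fun σ => σ ∘ substEdges s ![s 0, b 5, b 4] := by
  -- With `z` resolved by `!a`, the first diagram has `s 1 = b 5` and `s 2 = b 4`, and the second
  -- has `s 1 = b 2` and `s 2 = b 1`. Under these identifications the crossing `x` of the first
  -- diagram becomes `y` of the second and vice versa, which is why the two are listed in opposite
  -- orders.
  have key : ∀ v, ∀ σ ∈ (Q'.face !a).S v, ∀ (c : Fin (n + 2)) (i : Fin 4),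
      (σ ∘ substEdges s ![s 0, b 5, b 4]) (Q.q c.succ i) = σ (Q'.q c.succ i) := by
    intro v σ hσ c i
    obtain ⟨h1, h2⟩ := (h.respects_z_not' σ).1 (h.full'.mem_cons_iff.1 hσ).1
    cases c using Fin.cases with
    | zero =>
      rw [Fin.succ_zero_eq_one, h.q_x, h.q_y']
      fin_cases i
      · exact (h.comp_b _ _ _).trans h2.symm
      · exact h.comp_zero _ _
      · exact h.comp_one _ _
      · exact h.comp_b _ _ _
    | succ c =>
      cases c using Fin.cases with
      | zero =>
        rw [Fin.succ_zero_eq_one, Fin.succ_one_eq_two, h.q_y, h.q_x']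
        fin_cases i
        · exact (h.comp_b _ _ _).trans h1.symm
        · exact h.comp_b _ _ _
        · exact h.comp_two _ _
        · exact h.comp_zero _ _
      | succ c =>
        rw [h.rest_eq]
        exact congrArg σ (substEdges_of_ne (h.rest_ne c i))
  refine ⟨isSignSubst_comp _, fun v σ hσ => ?_, fun v σ hσ c b => ?_, fun v σ hσ c _ => key v σ hσ c 0⟩
  · refine h.full.mem_cons_iff.2 ⟨(h.respects_z_not _).2 ?_, fun c => ?_⟩
    · simp only [h.comp_one, h.comp_two, h.comp_b]
      exact ⟨rfl, rfl⟩
    · exact (Respects.congr fun i => key v σ hσ c i).2 ((h.full'.mem_cons_iff.1 hσ).2 c)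
  · exact (Respects.congr fun i => key v σ hσ c i).1

theorem isMorphism_face_symm : IsMorphism (Q'.face !a) (Q.face !a)
    fun σ => σ ∘ substEdges s ![s 0, b 2, b 1] := by
  have key : ∀ v, ∀ σ ∈ (Q.face !a).S v, ∀ (c : Fin (n + 2)) (i : Fin 4),
      (σ ∘ substEdges s ![s 0, b 2, b 1]) (Q'.q c.succ i) = σ (Q.q c.succ i) := by
    intro v σ hσ c i
    obtain ⟨h1, h2⟩ := (h.respects_z_not σ).1 (h.full.mem_cons_iff.1 hσ).1
    cases c using Fin.cases with
    | zero =>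
      rw [Fin.succ_zero_eq_one, h.q_x, h.q_y']
      fin_cases i
      · exact h.comp_two _ _
      · exact h.comp_zero _ _
      · exact (h.comp_b _ _ _).trans h1.symm
      · exact h.comp_b _ _ _
    | succ c =>
      cases c using Fin.cases with
      | zero =>
        rw [Fin.succ_zero_eq_one, Fin.succ_one_eq_two, h.q_y, h.q_x']
        fin_cases i
        · exact h.comp_one _ _
        · exact h.comp_b _ _ _
        · exact (h.comp_b _ _ _).trans h2.symm
        · exact h.comp_zero _ _
      | succ c =>
        rw [h.rest_eq]
        exact congrArg σ (substEdges_of_ne (h.rest_ne c i))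
  refine ⟨isSignSubst_comp _, fun v σ hσ => ?_, fun v σ hσ c b => ?_, fun v σ hσ c _ => key v σ hσ c 0⟩
  · refine h.full'.mem_cons_iff.2 ⟨(h.respects_z_not' _).2 ?_, fun c => ?_⟩
    · simp only [h.comp_one, h.comp_two, h.comp_b]
      exact ⟨rfl, rfl⟩
    · exact (Respects.congr fun i => key v σ hσ c i).2 ((h.full.mem_cons_iff.1 hσ).2 c)
  · exact (Respects.congr fun i => key v σ hσ c i).1

theorem apply_substEdges_comp (σ : E → Bool) (t t' : Fin 3 → E) (e : E)
    (h0 : (σ ∘ substEdges s t) (t' 0) = σ (s 0)) (h1 : (σ ∘ substEdges s t) (t' 1) = σ (s 1))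
    (h2 : (σ ∘ substEdges s t) (t' 2) = σ (s 2)) : σ (substEdges s t (substEdges s t' e)) = σ e := by
  by_cases he : ∃ i, e = s i
  · obtain ⟨i, rfl⟩ := he
    fin_cases i
    · exact (h.comp_zero (σ ∘ substEdges s t) t').trans h0
    · exact (h.comp_one (σ ∘ substEdges s t) t').trans h1
    · exact (h.comp_two (σ ∘ substEdges s t) t').trans h2
  · push Not at he
    rw [substEdges_of_ne he, substEdges_of_ne he]

/-- The isomorphism between the faces in which there is no bigon. -/
def faceEquiv : (Q.face !a).space ≃ₗ[ℚ] (Q'.face !a).space :=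
  transferEquiv h.isMorphism_face h.isMorphism_face_symm
    (fun v σ hσ e => by
      obtain ⟨h1, h2⟩ := (h.respects_z_not σ).1 (h.full.mem_cons_iff.1 hσ).1
      refine h.apply_substEdges_comp _ _ _ _ ?_ ?_ ?_
      · exact h.comp_zero _ _
      · exact (h.comp_b _ _ _).trans h1.symm
      · exact (h.comp_b _ _ _).trans h2.symm)
    (fun v σ hσ e => by
      obtain ⟨h1, h2⟩ := (h.respects_z_not' σ).1 (h.full'.mem_cons_iff.1 hσ).1
      refine h.apply_substEdges_comp _ _ _ _ ?_ ?_ ?_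
      · exact h.comp_zero _ _
      · exact (h.comp_b _ _ _).trans h1.symm
      · exact (h.comp_b _ _ _).trans h2.symm)

/-- In the corners that survive the removal of the bigons, the outer ends are joined as `b 0, b 3`,
as `b 1, b 2` and as `b 4, b 5` on both sides. Only the positions of the inner edges differ: in the
first diagram `s 0` lies with `b 1`, in the second with `b 4`. -/
theorem isMorphism_corner : IsMorphism ((Q.face a).corner false true) ((Q'.face a).corner true false)
    fun σ => σ ∘ substEdges s ![b 1, b 0, b 0] := by
  have key : ∀ (σ : E → Bool) (c : Fin n) i,
      (σ ∘ substEdges s ![b 1, b 0, b 0]) (Q.q c.succ.succ.succ i) = σ (Q'.q c.succ.succ.succ i) :=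
    fun σ c i => by
      rw [h.rest_eq]
      exact congrArg σ (substEdges_of_ne (h.rest_ne c i))
  refine ⟨isSignSubst_comp _, fun v σ hσ => ?_, fun v σ _ c b => (Respects.congr (key σ c)).1,
    fun v σ _ c _ => key σ c 0⟩
  have h1 := h.mem_iff'.1 hσ
  refine h.mem_iff.2 ?_
  simp only [h.respects_z, h.respects_z', respects_false_iff, respects_true_iff, h.comp_zero,
    h.comp_one, h.comp_two, h.comp_b, h.rest_comp, Matrix.cons_val] at h1 ⊢
  grind

theorem isMorphism_corner_symm :
    IsMorphism ((Q'.face a).corner true false) ((Q.face a).corner false true)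
      fun σ => σ ∘ substEdges s ![b 4, b 0, b 0] := by
  have key : ∀ (σ : E → Bool) (c : Fin n) i,
      (σ ∘ substEdges s ![b 4, b 0, b 0]) (Q'.q c.succ.succ.succ i) = σ (Q.q c.succ.succ.succ i) :=
    fun σ c i => by
      rw [h.rest_eq]
      exact congrArg σ (substEdges_of_ne (h.rest_ne c i))
  refine ⟨isSignSubst_comp _, fun v σ hσ => ?_, fun v σ _ c b => (Respects.congr (key σ c)).1,
    fun v σ _ c _ => key σ c 0⟩
  have h1 := h.mem_iff.1 hσ
  refine h.mem_iff'.2 ?_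
  simp only [h.respects_z, h.respects_z', respects_false_iff, respects_true_iff, h.comp_zero,
    h.comp_one, h.comp_two, h.comp_b, h.rest_comp, Matrix.cons_val] at h1 ⊢
  grind

/-- The isomorphism between the corners that remain when the bigons are removed. -/
def cornerEquiv : ((Q.face a).corner false true).space ≃ₗ[ℚ]
    ((Q'.face a).corner true false).space :=
  transferEquiv h.isMorphism_corner h.isMorphism_corner_symm
    (fun v σ hσ e => by
      have h1 := h.mem_iff.1 hσ
      simp only [h.respects_z, respects_false_iff, respects_true_iff] at h1
      refine h.apply_substEdges_comp _ _ _ _ ?_ ?_ ?_ <;>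
        simp only [h.comp_b, Matrix.cons_val] <;> grind)
    (fun v σ hσ e => by
      have h1 := h.mem_iff'.1 hσ
      simp only [h.respects_z', respects_false_iff, respects_true_iff] at h1
      refine h.apply_substEdges_comp _ _ _ _ ?_ ?_ ?_ <;>
        simp only [h.comp_b, Matrix.cons_val] <;> grind)

theorem notMem_range (i : Fin 6) : b i ∉ Set.range s := by
  rintro ⟨j, hj⟩
  exact h.b_ne i j hj.symm

/-- The common pattern of the six attachments below: the sides of the triangle form the circle, and
`P` collects the conditions on the outer ends. -/
theorem isAttached_of_mem_iff {U W : Cube E n} {p : Fin 6} (hU : ∀ c, U.q c = Q.q c.succ.succ.succ)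
    (hW : ∀ c, W.q c = Q.q c.succ.succ.succ) (P : (E → Bool) → Prop)
    (hP : ∀ σ τ : E → Bool, (∀ i, τ (b i) = σ (b i)) → P σ → P τ)
    (hmem : ∀ w σ, σ ∈ W.S w ↔ (σ (s 1) = σ (s 0) ∧ σ (s 2) = σ (s 0)) ∧ P σ ∧
      ∀ c : Fin n, Respects (w c) (Q.q c.succ.succ.succ) σ)
    (hmem' : ∀ w σ, σ ∈ U.S w ↔ σ ∈ W.S w ∧ σ (s 0) = σ (b p)) :
    IsAttached W U (Set.range s) (s 0) (b p) where
  mem_g := ⟨0, rfl⟩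
  notMem_p := h.notMem_range p
  q_eq c i := by rw [hU, hW]
  notMem_q c i := by
    rw [hW]
    rintro ⟨j, hj⟩
    exact h.rest_ne c i j hj.symm
  const v σ hσ := by
    rintro _ ⟨i, rfl⟩
    obtain ⟨⟨h1, h2⟩, -⟩ := (hmem v σ).1 hσ
    fin_cases i
    exacts [rfl, h1, h2]
  reset v σ hσ τ h1 h2 := by
    obtain ⟨-, h3, h4⟩ := (hmem v σ).1 hσ
    refine (hmem v τ).2 ⟨⟨h2 _ ⟨1, rfl⟩, h2 _ ⟨2, rfl⟩⟩, hP _ _ (fun i => h1 _ (h.notMem_range i)) h3,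
      fun c => (Respects.congr fun i => (h1 _ ?_).symm).1 (h4 c)⟩
    rintro ⟨j, hj⟩
    exact h.rest_ne c i j hj.symm
  mem_iff := hmem'

theorem mem_bigon {w : Fin n → Bool} {σ : E → Bool} :
    σ ∈ ((Q.face a).corner true false).S w ↔ (σ (s 1) = σ (s 0) ∧ σ (s 2) = σ (s 0)) ∧
      (σ (b 0) = σ (b 1) ∧ σ (b 2) = σ (b 3) ∧ σ (b 4) = σ (b 5)) ∧
        ∀ c : Fin n, Respects (w c) (Q.q c.succ.succ.succ) σ := by
  refine h.mem_iff.trans ?_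
  simp only [h.respects_z, respects_false_iff, respects_true_iff]
  grind

theorem mem_bigon' {w : Fin n → Bool} {σ : E → Bool} :
    σ ∈ ((Q'.face a).corner false true).S w ↔ (σ (s 1) = σ (s 0) ∧ σ (s 2) = σ (s 0)) ∧
      (σ (b 0) = σ (b 5) ∧ σ (b 4) = σ (b 3) ∧ σ (b 1) = σ (b 2)) ∧
        ∀ c : Fin n, Respects (w c) (Q.q c.succ.succ.succ) σ := by
  refine h.mem_iff'.trans ?_
  simp only [h.respects_z', respects_false_iff, respects_true_iff]
  grind

theorem isAttached_split :
    IsAttached ((Q.face a).corner true false) ((Q.face a).corner false false) (Set.range s) (s 0)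
      (b 1) :=
  h.isAttached_of_mem_iff (fun _ => rfl) (fun _ => rfl) _ (fun σ τ h1 h2 => by simpa only [h1] using h2)
    (fun _ _ => h.mem_bigon) fun w σ => by
      rw [h.mem_bigon]
      refine h.mem_iff.trans ?_
      simp only [h.respects_z, respects_false_iff]
      grind

theorem isAttached_merge :
    IsAttached ((Q.face a).corner true false) ((Q.face a).corner true true) (Set.range s) (s 0)
      (b 2) :=
  h.isAttached_of_mem_iff (fun _ => rfl) (fun _ => rfl) _ (fun σ τ h1 h2 => by simpa only [h1] using h2)
    (fun _ _ => h.mem_bigon) fun w σ => by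
      rw [h.mem_bigon]
      refine h.mem_iff.trans ?_
      simp only [h.respects_z, respects_true_iff]
      grind

/-- The saddle at `z` also connects the circle with the other face. This makes the zigzag through
the circle explicitly computable. -/
theorem isAttached_face :
    IsAttached ((Q.face a).corner true false) ((Q.face !a).corner true false) (Set.range s) (s 0)
      (b 4) :=
  h.isAttached_of_mem_iff (fun _ => rfl) (fun _ => rfl) _ (fun σ τ h1 h2 => by simpa only [h1] using h2)
    (fun _ _ => h.mem_bigon) fun w σ => by
      rw [h.mem_bigon]
      refine h.mem_iff.trans ?_
      simp only [h.respects_z_not, respects_false_iff, respects_true_iff]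
      grind

theorem isAttached_split' :
    IsAttached ((Q'.face a).corner false true) ((Q'.face a).corner false false) (Set.range s) (s 0)
      (b 3) :=
  h.isAttached_of_mem_iff (fun _ => h.rest_eq _) (fun _ => h.rest_eq _) _
    (fun σ τ h1 h2 => by simpa only [h1] using h2) (fun _ _ => h.mem_bigon') fun w σ => by
      rw [h.mem_bigon']
      refine h.mem_iff'.trans ?_
      simp only [h.respects_z', respects_false_iff]
      grind

theorem isAttached_merge' :
    IsAttached ((Q'.face a).corner false true) ((Q'.face a).corner true true) (Set.range s) (s 0)
      (b 0) :=
  h.isAttached_of_mem_iff (fun _ => h.rest_eq _) (fun _ => h.rest_eq _) _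
    (fun σ τ h1 h2 => by simpa only [h1] using h2) (fun _ _ => h.mem_bigon') fun w σ => by
      rw [h.mem_bigon']
      refine h.mem_iff'.trans ?_
      simp only [h.respects_z', respects_true_iff]
      grind

theorem isAttached_face' :
    IsAttached ((Q'.face a).corner false true) ((Q'.face !a).corner false true) (Set.range s) (s 0)
      (b 1) :=
  h.isAttached_of_mem_iff (fun _ => h.rest_eq _) (fun _ => h.rest_eq _) _
    (fun σ τ h1 h2 => by simpa only [h1] using h2) (fun _ _ => h.mem_bigon') fun w σ => by
      rw [h.mem_bigon']
      refine h.mem_iff'.trans ?_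
      simp only [h.respects_z_not', respects_false_iff, respects_true_iff]
      grind

end IsTriangleMove

end Cube

end

/-! ### Comparison of the maps between face and corner in the third Reidemeister move -/

noncomputable section

open scoped Polynomial

namespace Cube

variable {E : Type*} {n : ℕ}

section

variable {Q : Cube E (n + 2)} {G : Set E} {g p p' : E} [Finite E]

theorem bigonRetract_retr (hb : IsAttached (Q.corner true false) (Q.corner false false) G g p)
    (hm : IsAttached (Q.corner true false) (Q.corner true true) G g p')
    (hp : ∀ w, ∀ σ ∈ (Q.corner false false).S w, σ (Q.q 0 0) = σ p) {e : E} (he : e ∉ G)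
    (F : Q.space) : (bigonRetract hb hm hp he).retr F = (Q.squareEquiv F).1.2 -
      (Q.face false).saddle false true (hb.ε (Q.squareEquiv F).2.1) := rfl

theorem squareEquiv_bigonRetract_incl
    (hb : IsAttached (Q.corner true false) (Q.corner false false) G g p)
    (hm : IsAttached (Q.corner true false) (Q.corner true true) G g p')
    (hp : ∀ w, ∀ σ ∈ (Q.corner false false).S w, σ (Q.q 0 0) = σ p) {e : E} (he : e ∉ G)
    (F : (Q.corner false true).space) : Q.squareEquiv ((bigonRetract hb hm hp he).incl F) =
      ((0, F), hm.ι (Q.sideSaddle true false true F), 0) :=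
  Q.squareEquiv.apply_symm_apply _

theorem bigonRetractSwap_retr (hb : IsAttached (Q.corner false true) (Q.corner false false) G g p)
    (hm : IsAttached (Q.corner false true) (Q.corner true true) G g p')
    (hp : ∀ w, ∀ σ ∈ (Q.corner false false).S w, σ (Q.q 1 0) = σ p) {e : E} (he : e ∉ G)
    (F : Q.space) : (bigonRetractSwap hb hm hp he).retr F = (Q.squareEquiv F).2.1 -
      Q.sideSaddle false false true (hb.ε (Q.squareEquiv F).1.2) := rfl

theorem squareEquiv_bigonRetractSwap_incl
    (hb : IsAttached (Q.corner false true) (Q.corner false false) G g p)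
    (hm : IsAttached (Q.corner false true) (Q.corner true true) G g p')
    (hp : ∀ w, ∀ σ ∈ (Q.corner false false).S w, σ (Q.q 1 0) = σ p) {e : E} (he : e ∉ G)
    (F : (Q.corner true false).space) : Q.squareEquiv ((bigonRetractSwap hb hm hp he).incl F) =
      ((0, hm.ι ((Q.face true).saddle false true F)), F, 0) := by
  refine (Q.squareEquiv.apply_symm_apply _).trans ?_
  exact Prod.ext rfl (Prod.ext rfl neg_zero)

end

theorem comp_substEdges_of_notMem (σ : E → Bool) {s : Fin 3 → E} (t : Fin 3 → E) {e : E}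
    (he : e ∉ Set.range s) : (σ ∘ substEdges s t) e = σ e :=
  congrArg σ (substEdges_of_ne fun i hi => he ⟨i, hi.symm⟩)

namespace IsTriangleMove

set_option linter.unusedSimpArgs false

variable {Q Q' : Cube E (n + 3)} {a : Bool} {b : Fin 6 → E} {s : Fin 3 → E}
  (h : IsTriangleMove Q Q' a b s)

include h

/-- After the bigon is removed, the map from the face into the corner has a direct part and a part
that zigzags through the circle. The zigzag of the first diagram has the weight of the direct saddle
at `z` in the second. -/
theorem saddleWeight_split {w : Fin n → Bool} {σ : E → Bool}
    (hσ : σ ∈ ((Q'.face a).corner true false).S w) :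
    saddleWeight (((Q.face a).corner false false).S w) (((Q.face a).corner false true).S w)
        (Q.q 2 0) (σ ∘ substEdges s ![b 1, b 0, b 0]) =
      saddleWeight (((Q'.face !a).corner true false).S w) (((Q'.face a).corner true false).S w)
        (Q'.q 0 0) σ := by
  -- The substitution `φ` serves only to compare the types of the two saddles; the weights are
  -- compared along `ψ`.
  refine saddleWeight_comp_eq (φ := fun σ => σ ∘ substEdges s ![b 0, b 0, b 0])
    (ψ := fun σ => σ ∘ substEdges s ![b 1, b 0, b 0])
    (((Q.face a).face false).saddle_xor (a := false) rfl w) (Q'.saddle_xor (a := !a) (by simp) _)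
    (fun σ hσ => h.mem_iff.2 ?_) (fun σ hσ => h.isMorphism_corner.mem w σ hσ)
    (fun σ hσ hσ' => h.mem_iff'.2 ?_) (fun σ hσ hσ' => h.mem_iff'.2 ?_)
    (fun σ hσ hσ' => h.mem_iff.2 ?_) (fun σ hσ hσ' => ?_) hσ
  · have h1 := h.mem_iff'.1 hσ
    simp only [Bool.not_false, Bool.not_not, h.respects_z, h.respects_z_not',
      respects_false_iff, respects_true_iff, h.comp_zero, h.comp_one, h.comp_two, h.comp_b, h.rest_comp, Matrix.cons_val] at h1 ⊢
    grind
  · have h1 := h.mem_iff'.1 hσ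
    have h2 := h.mem_iff.1 hσ'
    simp only [Bool.not_false, Bool.not_not, h.respects_z, h.respects_z', h.respects_z_not',
      respects_false_iff, respects_true_iff, h.comp_zero, h.comp_one, h.comp_two, h.comp_b, h.rest_comp, Matrix.cons_val] at h1 h2 ⊢
    grind
  · have h1 := h.mem_iff'.1 hσ
    have h2 := h.mem_iff.1 hσ'
    simp only [Bool.not_false, Bool.not_not, h.respects_z, h.respects_z', h.respects_z_not',
      respects_false_iff, respects_true_iff, h.comp_zero, h.comp_one, h.comp_two, h.comp_b, h.rest_comp, Matrix.cons_val] at h1 h2 ⊢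
    grind
  · have h1 := h.mem_iff'.1 hσ
    have h2 := h.mem_iff'.1 hσ'
    simp only [Bool.not_false, Bool.not_not, h.respects_z, h.respects_z', h.respects_z_not',
      respects_false_iff, respects_true_iff, h.comp_zero, h.comp_one, h.comp_two, h.comp_b, h.rest_comp, Matrix.cons_val] at h1 h2 ⊢
    grind
  · have h1 := h.mem_iff'.1 hσ
    have h2 := h.mem_iff'.1 hσ'
    rw [h.q_y]
    simp only [Bool.not_false, Bool.not_not, h.respects_z, h.respects_z', h.respects_z_not',
      respects_false_iff, respects_true_iff, h.comp_zero, h.comp_one, h.comp_two, h.comp_b, h.rest_comp, Matrix.cons_val] at h1 h2 ⊢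
    have h3 := h.marker' σ (by grind) (by grind) (by grind)
    grind

/-- Conversely, the direct saddle at `z` in the first diagram has the weight of the zigzag in the
second. -/
theorem saddleWeight_split' {w : Fin n → Bool} {σ : E → Bool}
    (hσ : σ ∈ ((Q'.face a).corner true false).S w) :
    saddleWeight (((Q.face !a).corner false true).S w) (((Q.face a).corner false true).S w)
        (Q.q 0 0) (σ ∘ substEdges s ![b 1, b 0, b 0]) =
      saddleWeight (((Q'.face a).corner false false).S w) (((Q'.face a).corner true false).S w)
        (Q'.q 1 0) σ := by
  refine saddleWeight_comp_eq (φ := fun σ => σ ∘ substEdges s ![b 1, b 5, b 4])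
    (ψ := fun σ => σ ∘ substEdges s ![b 1, b 0, b 0]) (Q.saddle_xor (a := !a) (by simp) _)
    ((Q'.face a).saddle_xor (a := false) rfl (Fin.cons false w))
    (fun σ hσ => h.mem_iff.2 ?_) (fun σ hσ => h.isMorphism_corner.mem w σ hσ)
    (fun σ hσ hσ' => h.mem_iff'.2 ?_) (fun σ hσ hσ' => h.mem_iff'.2 ?_)
    (fun σ hσ hσ' => h.mem_iff.2 ?_) (fun σ hσ hσ' => ?_) hσ
  · have h1 := h.mem_iff'.1 hσ
    simp only [Bool.not_false, Bool.not_not, h.respects_z, h.respects_z', h.respects_z_not,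
      respects_false_iff, respects_true_iff, h.comp_zero, h.comp_one, h.comp_two, h.comp_b, h.rest_comp, Matrix.cons_val] at h1 ⊢
    grind
  · have h1 := h.mem_iff'.1 hσ
    have h2 := h.mem_iff.1 hσ'
    simp only [Bool.not_false, Bool.not_not, h.respects_z, h.respects_z', h.respects_z_not',
      respects_false_iff, respects_true_iff, h.comp_zero, h.comp_one, h.comp_two, h.comp_b, h.rest_comp, Matrix.cons_val] at h1 h2 ⊢
    grind
  · have h1 := h.mem_iff'.1 hσ
    have h2 := h.mem_iff.1 hσ'
    simp only [Bool.not_false, Bool.not_not, h.respects_z, h.respects_z', h.respects_z_not,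
      respects_false_iff, respects_true_iff, h.comp_zero, h.comp_one, h.comp_two, h.comp_b, h.rest_comp, Matrix.cons_val] at h1 h2 ⊢
    grind
  · have h1 := h.mem_iff'.1 hσ
    have h2 := h.mem_iff'.1 hσ'
    simp only [Bool.not_false, Bool.not_not, h.respects_z, h.respects_z', h.respects_z_not,
      respects_false_iff, respects_true_iff, h.comp_zero, h.comp_one, h.comp_two, h.comp_b, h.rest_comp, Matrix.cons_val] at h1 h2 ⊢
    grind
  · have h1 := h.mem_iff'.1 hσ
    have h2 := h.mem_iff'.1 hσ'
    have h3 := h.marker (σ ∘ substEdges s ![b 1, b 0, b 0])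
      (by rw [h.comp_one, h.comp_two]; rfl)
    rw [h.q_y']
    refine h3.trans ?_
    simp only [Bool.not_false, Bool.not_not, h.respects_z, h.respects_z', h.respects_z_not,
      respects_false_iff, respects_true_iff, h.comp_zero, h.comp_one, h.comp_two, h.comp_b, h.rest_comp, Matrix.cons_val] at h1 h2 ⊢
    grind

/-- The counterpart for maps out of the corner: the zigzag of the first diagram against the direct
saddle of the second. -/
theorem saddleWeight_merge {w : Fin n → Bool} {σ : E → Bool}
    (hσ : σ ∈ ((Q'.face !a).corner true false).S w) :
    saddleWeight (((Q.face a).corner false true).S w) (((Q.face a).corner true true).S w)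
        (Q.q 1 0) (σ ∘ substEdges s ![b 2, b 2, b 2]) =
      saddleWeight (((Q'.face a).corner true false).S w) (((Q'.face !a).corner true false).S w)
        (Q'.q 0 0) σ := by
  refine saddleWeight_comp_eq (φ := fun σ => σ ∘ substEdges s ![b 1, b 0, b 0])
    (ψ := fun σ => σ ∘ substEdges s ![b 2, b 2, b 2])
    ((Q.face a).saddle_xor (a := false) rfl (Fin.cons true w)) (Q'.saddle_xor (a := a) rfl _)
    (fun σ hσ => h.isMorphism_corner.mem w σ hσ) (fun σ hσ => h.mem_iff.2 ?_)
    (fun σ hσ hσ' => h.mem_iff'.2 ?_) (fun σ hσ hσ' => h.mem_iff'.2 ?_)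
    (fun σ hσ hσ' => h.mem_iff.2 ?_) (fun σ hσ hσ' => ?_) hσ
  · have h1 := h.mem_iff'.1 hσ
    simp only [Bool.not_false, Bool.not_not, h.respects_z, h.respects_z', h.respects_z_not',
      respects_false_iff, respects_true_iff, h.comp_zero, h.comp_one, h.comp_two, h.comp_b, h.rest_comp, Matrix.cons_val] at h1 ⊢
    grind
  · have h1 := h.mem_iff'.1 hσ
    have h2 := h.mem_iff.1 hσ'
    simp only [Bool.not_false, Bool.not_not, h.respects_z, h.respects_z', h.respects_z_not',
      respects_false_iff, respects_true_iff, h.comp_zero, h.comp_one, h.comp_two, h.comp_b, h.rest_comp, Matrix.cons_val] at h1 h2 ⊢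
    grind
  · have h1 := h.mem_iff'.1 hσ
    have h2 := h.mem_iff.1 hσ'
    simp only [Bool.not_false, Bool.not_not, h.respects_z, h.respects_z', h.respects_z_not',
      respects_false_iff, respects_true_iff, h.comp_zero, h.comp_one, h.comp_two, h.comp_b, h.rest_comp, Matrix.cons_val] at h1 h2 ⊢
    grind
  · have h1 := h.mem_iff'.1 hσ
    have h2 := h.mem_iff'.1 hσ'
    simp only [Bool.not_false, Bool.not_not, h.respects_z, h.respects_z', h.respects_z_not',
      respects_false_iff, respects_true_iff, h.comp_zero, h.comp_one, h.comp_two, h.comp_b, h.rest_comp, Matrix.cons_val] at h1 h2 ⊢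
    grind
  · have h1 := h.mem_iff'.1 hσ
    have h2 := h.mem_iff'.1 hσ'
    rw [h.q_x]
    simp only [Bool.not_false, Bool.not_not, h.respects_z, h.respects_z', h.respects_z_not',
      respects_false_iff, respects_true_iff, h.comp_zero, h.comp_one, h.comp_two, h.comp_b, h.rest_comp, Matrix.cons_val] at h1 h2 ⊢
    have h3 := h.marker' σ (by grind) (by grind) (by grind)
    grind

/-- The direct saddle of the first diagram out of the corner against the zigzag of the second. -/
theorem saddleWeight_merge' {w : Fin n → Bool} {σ : E → Bool}
    (hσ : σ ∈ ((Q'.face a).corner true true).S w) :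
    saddleWeight (((Q.face a).corner false true).S w) (((Q.face !a).corner false true).S w)
        (Q.q 0 0) (σ ∘ substEdges s ![b 1, b 5, b 4]) =
      saddleWeight (((Q'.face a).corner true false).S w) (((Q'.face a).corner true true).S w)
        (Q'.q 2 0) σ := by
  refine saddleWeight_comp_eq (φ := fun σ => σ ∘ substEdges s ![b 1, b 0, b 0])
    (ψ := fun σ => σ ∘ substEdges s ![b 1, b 5, b 4]) (Q.saddle_xor (a := a) rfl _)
    (((Q'.face a).face true).saddle_xor (a := false) rfl w)
    (fun σ hσ => h.isMorphism_corner.mem w σ hσ) (fun σ hσ => h.mem_iff.2 ?_)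
    (fun σ hσ hσ' => h.mem_iff'.2 ?_) (fun σ hσ hσ' => h.mem_iff'.2 ?_)
    (fun σ hσ hσ' => h.mem_iff.2 ?_) (fun σ hσ hσ' => ?_) hσ
  · have h1 := h.mem_iff'.1 hσ
    simp only [Bool.not_false, Bool.not_not, h.respects_z, h.respects_z', h.respects_z_not,
      respects_false_iff, respects_true_iff, h.comp_zero, h.comp_one, h.comp_two, h.comp_b, h.rest_comp, Matrix.cons_val] at h1 ⊢
    grind
  · have h1 := h.mem_iff'.1 hσ
    have h2 := h.mem_iff.1 hσ'
    simp only [Bool.not_false, Bool.not_not, h.respects_z, h.respects_z', h.respects_z_not,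
      respects_false_iff, respects_true_iff, h.comp_zero, h.comp_one, h.comp_two, h.comp_b, h.rest_comp, Matrix.cons_val] at h1 h2 ⊢
    grind
  · have h1 := h.mem_iff'.1 hσ
    have h2 := h.mem_iff.1 hσ'
    simp only [Bool.not_false, Bool.not_not, h.respects_z, h.respects_z', h.respects_z_not,
      respects_false_iff, respects_true_iff, h.comp_zero, h.comp_one, h.comp_two, h.comp_b, h.rest_comp, Matrix.cons_val] at h1 h2 ⊢
    grind
  · have h1 := h.mem_iff'.1 hσ
    have h2 := h.mem_iff'.1 hσ'
    simp only [Bool.not_false, Bool.not_not, h.respects_z, h.respects_z', h.respects_z_not,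
      respects_false_iff, respects_true_iff, h.comp_zero, h.comp_one, h.comp_two, h.comp_b, h.rest_comp, Matrix.cons_val] at h1 h2 ⊢
    grind
  · have h1 := h.mem_iff'.1 hσ
    have h2 := h.mem_iff'.1 hσ'
    rw [h.q_x']
    simp only [Bool.not_false, Bool.not_not, h.respects_z, h.respects_z', h.respects_z_not,
      respects_false_iff, respects_true_iff, h.comp_zero, h.comp_one, h.comp_two, h.comp_b, h.rest_comp, Matrix.cons_val] at h1 h2 ⊢
    have h3 := h.marker (σ ∘ substEdges s ![b 1, b 5, b 4])
      (by rw [h.comp_one, h.comp_two]; simp only [Matrix.cons_val]; grind)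
    refine h3.trans ?_
    rw [h.comp_one]
    simp only [Matrix.cons_val]
    grind

theorem comp_ext {σ τ : E → Bool} {t : Fin 3 → E} (h' : ∀ e ∉ Set.range s, τ e = σ e)
    (h0 : τ (s 0) = σ (t 0)) (h1 : τ (s 1) = σ (t 1)) (h2 : τ (s 2) = σ (t 2)) :
    τ = σ ∘ substEdges s t := by
  funext e
  by_cases he : e ∈ Set.range s
  · obtain ⟨i, rfl⟩ := he
    fin_cases i
    · exact h0.trans (h.comp_zero σ t).symm
    · exact h1.trans (h.comp_one σ t).symm
    · exact h2.trans (h.comp_two σ t).symm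
  · rw [h' e he, comp_substEdges_of_notMem _ _ he]

theorem marker_split (σ : E → Bool) : σ ((Q.face a).q 0 0) = σ (b 1) := by
  rw [face_q, Fin.succ_zero_eq_one, h.q_x]
  rfl

theorem marker_split' {w : Fin n → Bool} {σ : E → Bool}
    (hσ : σ ∈ ((Q'.face a).corner false false).S w) : σ ((Q'.face a).q 1 0) = σ (b 3) := by
  have h1 := h.mem_iff'.1 hσ
  rw [face_q, Fin.succ_one_eq_two, h.q_x']
  exact h1.2.2.1.1

theorem retr_saddle_eq_β (F : (Q.face !a).space) :
    ((Q.face a).squareEquiv (Q.saddle (!a) a F)).2.1 =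
      h.isAttached_face.β ((Q.face !a).squareEquiv F).2.1 := by
  refine h.isAttached_face.eq_β_apply (fun w σ hσ => ?_) fun w σ hσ => ?_
  · refine congrArg (· * F.1 _ σ) (saddleWeight_eq_two_mul (p' := b 4)
      (Q.saddle_xor (a := !a) (by simp) _) (fun τ hτ => h.isAttached_face.mem_of_mem hτ) hσ ?_)
    have h1 := h.mem_bigon.1 (h.isAttached_face.mem_of_mem hσ)
    have h2 := ((h.isAttached_face.mem_iff _ _).1 hσ).2
    rw [h.marker σ (h1.1.1.trans h1.1.2.symm), h1.1.1, h2]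
  · exact (congrArg (· * F.1 _ σ) (saddleWeight_eq_zero _ fun h' => hσ h'.1)).trans (zero_mul _)

theorem retr_saddle_eq_β' (F : (Q'.face !a).space) :
    ((Q'.face a).squareEquiv (Q'.saddle (!a) a F)).1.2 =
      h.isAttached_face'.β ((Q'.face !a).squareEquiv F).1.2 := by
  refine h.isAttached_face'.eq_β_apply (fun w σ hσ => ?_) fun w σ hσ => ?_
  · refine congrArg (· * F.1 _ σ) (saddleWeight_eq_two_mul (p' := b 1)
      (Q'.saddle_xor (a := !a) (by simp) _) (fun τ hτ => h.isAttached_face'.mem_of_mem hτ) hσ ?_)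
    have h1 := h.mem_bigon'.1 (h.isAttached_face'.mem_of_mem hσ)
    have h2 := ((h.isAttached_face'.mem_iff _ _).1 hσ).2
    have h3 := h.marker' σ (h1.1.1.trans h1.1.2.symm) (h2.symm.trans h1.1.1.symm)
      (h1.2.1.2.2.symm.trans (h2.symm.trans h1.1.1.symm))
    rw [h3, h1.1.1, h2]
  · exact (congrArg (· * F.1 _ σ) (saddleWeight_eq_zero _ fun h' => hσ h'.1)).trans (zero_mul _)

variable [Finite E]

/-- The retraction that removes the bigon of the first diagram. -/
def retract : DeformationRetract (Q.face a).d ((Q.face a).x (b 0))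
    (-((Q.face a).corner false true).d) (((Q.face a).corner false true).x (b 0)) :=
  bigonRetract h.isAttached_split h.isAttached_merge (fun _ σ _ => h.marker_split σ)
    (h.notMem_range 0)

/-- The retraction that removes the bigon of the second diagram. -/
def retract' : DeformationRetract (Q'.face a).d ((Q'.face a).x (b 0))
    (-((Q'.face a).corner true false).d) (((Q'.face a).corner true false).x (b 0)) :=
  bigonRetractSwap h.isAttached_split' h.isAttached_merge' (fun _ _ hσ => h.marker_split' hσ)
    (h.notMem_range 0)

/-- The direct term minus the zigzag. The saddle at `z` splits off the circle at `b 4` and `ε` takes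
the coefficient of its variable, which leaves only the resetting of the circle to the sign of `b 4`.
-/
theorem retract_retr_apply (F : (Q.face !a).space) (w : Fin n → Bool) (τ : E → Bool) :
    (h.retract.retr (Q.saddle (!a) a F)).1 w τ =
      saddleWeight (((Q.face !a).corner false true).S w) (((Q.face a).corner false true).S w)
        (Q.q 0 0) τ * F.1 (Fin.cons false (Fin.cons true w)) τ -
      saddleWeight (((Q.face a).corner false false).S w) (((Q.face a).corner false true).S w)
        (Q.q 2 0) τ * F.1 (Fin.cons true (Fin.cons false w)) (resetOn (Set.range s) (b 4) false τ) := by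
  rw [retract, bigonRetract_retr, h.retr_saddle_eq_β]
  refine congrArg₂ (fun p q : ℚ[X] => p - q) rfl ?_
  by_cases hτ : τ ∈ ((Q.face a).corner false false).S w
  · exact congrArg (_ * ·) (h.isAttached_split.ε_β_apply h.isAttached_face _ hτ)
  · have h0 := saddleWeight_eq_zero (V := ((Q.face a).corner false true).S w) (Q.q 2 0)
      fun h' : τ ∈ _ ∧ τ ∈ _ => hτ h'.1
    exact (congrArg (· * _) h0).trans ((zero_mul _).trans
      ((congrArg (· * _) h0).trans (zero_mul _)).symm)

theorem retract'_retr_apply (F : (Q'.face !a).space) (w : Fin n → Bool) (τ : E → Bool) :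
    (h.retract'.retr (Q'.saddle (!a) a F)).1 w τ =
      saddleWeight (((Q'.face !a).corner true false).S w) (((Q'.face a).corner true false).S w)
        (Q'.q 0 0) τ * F.1 (Fin.cons true (Fin.cons false w)) τ -
      saddleWeight (((Q'.face a).corner false false).S w) (((Q'.face a).corner true false).S w)
        (Q'.q 1 0) τ * F.1 (Fin.cons false (Fin.cons true w)) (resetOn (Set.range s) (b 1) false τ) := by
  rw [retract', bigonRetractSwap_retr, h.retr_saddle_eq_β']
  refine congrArg₂ (fun p q : ℚ[X] => p - q) rfl ?_
  by_cases hτ : τ ∈ ((Q'.face a).corner false false).S w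
  · exact congrArg (_ * ·) (h.isAttached_split'.ε_β_apply h.isAttached_face' _ hτ)
  · have h0 := saddleWeight_eq_zero (V := ((Q'.face a).corner true false).S w) (Q'.q 1 0)
      fun h' : τ ∈ _ ∧ τ ∈ _ => hτ h'.1
    exact (congrArg (· * _) h0).trans ((zero_mul _).trans
      ((congrArg (· * _) h0).trans (zero_mul _)).symm)

/-- The equivalences exchange the direct term and the zigzag. These enter the retraction with
opposite signs, hence the minus sign. -/
theorem cornerEquiv_retr (F : (Q.face !a).space) :
    h.cornerEquiv (h.retract.retr (Q.saddle (!a) a F)) =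
      -h.retract'.retr (Q'.saddle (!a) a (h.faceEquiv F)) := by
  refine space_ext fun w σ hσ => ?_
  have e0 : (h.cornerEquiv (h.retract.retr (Q.saddle (!a) a F))).1 w σ =
      (h.retract.retr (Q.saddle (!a) a F)).1 w (σ ∘ substEdges s ![b 1, b 0, b 0]) :=
    h.isMorphism_corner.pullback_apply _ hσ
  change _ = -(h.retract'.retr (Q'.saddle (!a) a (h.faceEquiv F))).1 w σ
  rw [e0, h.retract_retr_apply, h.retract'_retr_apply]
  have h1 := h.mem_iff'.1 hσ
  have e1 : saddleWeight (((Q.face a).corner false false).S w) (((Q.face a).corner false true).S w)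
        (Q.q 2 0) (σ ∘ substEdges s ![b 1, b 0, b 0]) * F.1 (Fin.cons true (Fin.cons false w))
          (resetOn (Set.range s) (b 4) false (σ ∘ substEdges s ![b 1, b 0, b 0])) =
      saddleWeight (((Q'.face !a).corner true false).S w) (((Q'.face a).corner true false).S w)
        (Q'.q 0 0) σ * (h.faceEquiv F).1 (Fin.cons true (Fin.cons false w)) σ := by
    rw [h.saddleWeight_split hσ]
    by_cases hσ' : σ ∈ ((Q'.face !a).corner true false).S w
    · have h2 := h.mem_iff'.1 hσ'
      simp only [h.respects_z', h.respects_z_not', respects_false_iff, respects_true_iff] at h1 h2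
      refine congrArg (_ * ·) (Eq.trans ?_ (h.isMorphism_face.pullback_apply F hσ').symm)
      refine congrArg (F.1 _) (h.comp_ext (fun e he => ?_) ?_ ?_ ?_)
      · rw [resetOn_of_notMem he, comp_substEdges_of_notMem _ _ he]
      all_goals
        rw [resetOn_of_mem (Set.mem_range_self _), Bool.false_xor, h.comp_b]
        simp only [Matrix.cons_val] <;> grind
    · rw [saddleWeight_eq_zero _ fun h' => hσ' h'.1, zero_mul, zero_mul]
  have e2 : saddleWeight (((Q.face !a).corner false true).S w) (((Q.face a).corner false true).S w)
        (Q.q 0 0) (σ ∘ substEdges s ![b 1, b 0, b 0]) * F.1 (Fin.cons false (Fin.cons true w))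
          (σ ∘ substEdges s ![b 1, b 0, b 0]) =
      saddleWeight (((Q'.face a).corner false false).S w) (((Q'.face a).corner true false).S w)
        (Q'.q 1 0) σ * (h.faceEquiv F).1 (Fin.cons false (Fin.cons true w))
          (resetOn (Set.range s) (b 1) false σ) := by
    rw [h.saddleWeight_split' hσ]
    by_cases hσ' : σ ∈ ((Q'.face a).corner false false).S w
    · have h2 := h.mem_iff'.1 hσ'
      have h3 : resetOn (Set.range s) (b 1) false σ ∈ ((Q'.face !a).corner false true).S w :=
        h.isAttached_face'.reset_mem' (h.isAttached_split'.mem_of_mem hσ')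
      simp only [h.respects_z', h.respects_z_not', respects_false_iff, respects_true_iff] at h1 h2
      refine congrArg (_ * ·) (Eq.trans ?_ (h.isMorphism_face.pullback_apply F h3).symm)
      refine congrArg (F.1 _) (Eq.symm (h.comp_ext (fun e he => ?_) ?_ ?_ ?_))
      · rw [comp_substEdges_of_notMem _ _ he, resetOn_of_notMem he]
      · rw [h.comp_zero]
        exact (resetOn_of_mem (Set.mem_range_self 0) _ _ _).trans (Bool.false_xor _)
      · rw [h.comp_one]
        refine (resetOn_of_notMem (h.notMem_range 5) _ _ _).trans ?_
        simp only [Matrix.cons_val]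
        grind
      · rw [h.comp_two]
        refine (resetOn_of_notMem (h.notMem_range 4) _ _ _).trans ?_
        simp only [Matrix.cons_val]
        grind
    · rw [saddleWeight_eq_zero _ fun h' => hσ' h'.1, zero_mul, zero_mul]
  rw [e1, e2]
  exact (neg_sub _ _).symm

theorem squareEquiv_incl (F : ((Q.face a).corner false true).space) :
    (Q.face a).squareEquiv (h.retract.incl F) =
      ((0, F), h.isAttached_merge.ι ((Q.face a).sideSaddle true false true F), 0) :=
  squareEquiv_bigonRetract_incl _ _ _ _ F

theorem squareEquiv_incl' (F : ((Q'.face a).corner true false).space) :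
    (Q'.face a).squareEquiv (h.retract'.incl F) =
      ((0, h.isAttached_merge'.ι (((Q'.face a).face true).saddle false true F)), F, 0) :=
  squareEquiv_bigonRetractSwap_incl _ _ _ _ F

/-- The inclusion of the corner has a direct component and a zigzag component, in the two mixed
resolutions of `x` and `y`, and zero in the others. The equivalences again exchange the two, now
without a sign. -/
theorem faceEquiv_incl (F : ((Q.face a).corner false true).space) :
    h.faceEquiv (Q.saddle a (!a) (h.retract.incl F)) =
      Q'.saddle a (!a) (h.retract'.incl (h.cornerEquiv F)) := by
  have hI := h.squareEquiv_incl F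
  have hI' := h.squareEquiv_incl' (h.cornerEquiv F)
  set I := h.retract.incl F with hIdef
  set I' := h.retract'.incl (h.cornerEquiv F) with hIdef'
  clear_value I I'
  have i00 : ∀ w, I.1 (Fin.cons false (Fin.cons false w)) = 0 := fun w =>
    congrFun (congrArg (fun p => p.1.1.1) hI) w
  have i01 : ∀ w, I.1 (Fin.cons false (Fin.cons true w)) = F.1 w := fun w =>
    congrFun (congrArg (fun p => p.1.2.1) hI) w
  have i10 : ∀ w, I.1 (Fin.cons true (Fin.cons false w)) =
      (h.isAttached_merge.ι ((Q.face a).sideSaddle true false true F)).1 w := fun w =>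
    congrFun (congrArg (fun p => p.2.1.1) hI) w
  have i11 : ∀ w, I.1 (Fin.cons true (Fin.cons true w)) = 0 := fun w =>
    congrFun (congrArg (fun p => p.2.2.1) hI) w
  have i00' : ∀ w, I'.1 (Fin.cons false (Fin.cons false w)) = 0 := fun w =>
    congrFun (congrArg (fun p => p.1.1.1) hI') w
  have i01' : ∀ w, I'.1 (Fin.cons false (Fin.cons true w)) =
      (h.isAttached_merge'.ι (((Q'.face a).face true).saddle false true (h.cornerEquiv F))).1 w :=
    fun w => congrFun (congrArg (fun p => p.1.2.1) hI') w
  have i10' : ∀ w, I'.1 (Fin.cons true (Fin.cons false w)) = (h.cornerEquiv F).1 w := fun w =>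
    congrFun (congrArg (fun p => p.2.1.1) hI') w
  have i11' : ∀ w, I'.1 (Fin.cons true (Fin.cons true w)) = 0 := fun w =>
    congrFun (congrArg (fun p => p.2.2.1) hI') w
  refine space_ext fun v σ hσ => ?_
  have e0 : (h.faceEquiv (Q.saddle a (!a) I)).1 v σ =
      saddleWeight (Q.S (Fin.cons a v)) (Q.S (Fin.cons (!a) v)) (Q.q 0 0)
        (σ ∘ substEdges s ![s 0, b 5, b 4]) * I.1 v (σ ∘ substEdges s ![s 0, b 5, b 4]) :=
    h.isMorphism_face.pullback_apply _ hσ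
  have hψ := h.isMorphism_face.mem v σ hσ
  change _ = saddleWeight (Q'.S (Fin.cons a v)) (Q'.S (Fin.cons (!a) v)) (Q'.q 0 0) σ * I'.1 v σ
  rw [e0]
  clear e0 hI hI' hIdef hIdef'
  cases v using Fin.consCases with | _ p v
  cases v using Fin.consCases with | _ q w
  cases p <;> cases q
  · rw [i00, i00']
    exact (mul_zero _).trans (mul_zero _).symm
  -- Direct in the first diagram and zigzag in the second, where the final saddle at `z` merges the
  -- circle and has weight `1`.
  · have hσ' := h.mem_iff'.1 hσ
    have hW : σ ∈ ((Q'.face a).corner false true).S w := h.isAttached_face'.mem_of_mem hσ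
    have hτ := h.isAttached_merge'.reset_mem' hW
    rw [i01, i01', h.isAttached_merge'.ι_apply _ hW]
    have h1 : saddleWeight (Q'.S (Fin.cons a (Fin.cons false (Fin.cons true w))))
        (Q'.S (Fin.cons (!a) (Fin.cons false (Fin.cons true w)))) (Q'.q 0 0) σ = 1 :=
      saddleWeight_eq_one _ (fun τ hτ => h.isAttached_face'.mem_of_mem hτ) hσ
    set τ := resetOn (Set.range s) (b 0) false σ with hτdef
    have hτb : ∀ i, τ (b i) = σ (b i) := fun i => resetOn_of_notMem (h.notMem_range i) _ _ _
    have hτs : ∀ i, τ (s i) = σ (b 0) := fun i =>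
      (resetOn_of_mem (Set.mem_range_self i) _ _ _).trans (Bool.false_xor _)
    have h2 : σ ∘ substEdges s ![s 0, b 5, b 4] = τ ∘ substEdges s ![b 1, b 5, b 4] := by
      refine h.comp_ext (fun e he => ?_) ?_ ?_ ?_
      · rw [comp_substEdges_of_notMem _ _ he]
        exact (resetOn_of_notMem he _ _ _).symm
      · rw [h.comp_zero]
        exact (((h.isAttached_face'.mem_iff _ _).1 hσ).2).trans (hτb 1).symm
      · rw [h.comp_one]
        exact (hτb 5).symm
      · rw [h.comp_two]
        exact (hτb 4).symm
    have h3 := h.saddleWeight_merge' hτ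
    rw [h1, one_mul, h2]
    refine (congrArg (· * _) h3).trans ?_
    change _ = saddleWeight _ _ _ τ * (h.cornerEquiv F).1 w τ
    by_cases hτE : τ ∈ ((Q'.face a).corner true false).S w
    · refine congrArg (_ * ·) (Eq.trans ?_ (h.isMorphism_corner.pullback_apply F hτE).symm)
      have h4 := h.mem_iff'.1 hτE
      have h5 := h.mem_iff'.1 hτ
      simp only [h.respects_z', respects_false_iff, respects_true_iff] at h4 h5
      refine congrArg (F.1 _) (h.comp_ext (fun e he => ?_) ?_ ?_ ?_)
      · rw [comp_substEdges_of_notMem _ _ he]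
      · rw [h.comp_zero]
        rfl
      all_goals
        simp only [h.comp_one, h.comp_two, Matrix.cons_val]
        grind
    · have h4 := saddleWeight_eq_zero (V := ((Q'.face a).corner true true).S w) (Q'.q 2 0)
        fun h' : τ ∈ _ ∧ τ ∈ _ => hτE h'.1
      rw [h4, zero_mul]
      exact ((congrArg (· * _) h4).trans (zero_mul _)).symm
  -- The roles are reversed: the zigzag is in the first diagram.
  · have hψW := h.isAttached_face.mem_of_mem hψ
    rw [i10, i10']
    have h1 : saddleWeight (Q.S (Fin.cons a (Fin.cons true (Fin.cons false w))))
        (Q.S (Fin.cons (!a) (Fin.cons true (Fin.cons false w)))) (Q.q 0 0)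
        (σ ∘ substEdges s ![s 0, b 5, b 4]) = 1 :=
      saddleWeight_eq_one _ (fun τ hτ => h.isAttached_face.mem_of_mem hτ) hψ
    rw [h1, one_mul, h.isAttached_merge.ι_apply _ hψW]
    have h2 : resetOn (Set.range s) (b 2) false (σ ∘ substEdges s ![s 0, b 5, b 4]) =
        σ ∘ substEdges s ![b 2, b 2, b 2] := by
      have h6 : ∀ i, resetOn (Set.range s) (b 2) false (σ ∘ substEdges s ![s 0, b 5, b 4]) (s i) =
          σ (b 2) := fun i => by
        rw [resetOn_of_mem (Set.mem_range_self _), Bool.false_xor, h.comp_b]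
      refine h.comp_ext (fun e he => ?_) (h6 0) (h6 1) (h6 2)
      rw [resetOn_of_notMem he, comp_substEdges_of_notMem _ _ he]
    rw [h2]
    have h3 := h.saddleWeight_merge hσ
    refine (congrArg (· * _) h3).trans ?_
    by_cases hσE : σ ∈ ((Q'.face a).corner true false).S w
    · refine congrArg (_ * ·) (Eq.trans ?_ (h.isMorphism_corner.pullback_apply F hσE).symm)
      have h4 := h.mem_iff'.1 hσE
      have h5 := h.mem_iff'.1 hσ
      simp only [h.respects_z', h.respects_z_not', respects_false_iff, respects_true_iff] at h4 h5
      refine congrArg (F.1 _) (h.comp_ext (fun e he => ?_) ?_ ?_ ?_)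
      · rw [comp_substEdges_of_notMem _ _ he]
      all_goals
        simp only [h.comp_zero, h.comp_one, h.comp_two, Matrix.cons_val]
        grind
    · have h4 := saddleWeight_eq_zero (V := ((Q'.face !a).corner true false).S w) (Q'.q 0 0)
        fun h' : σ ∈ _ ∧ σ ∈ _ => hσE h'.1
      exact ((congrArg (· * _) h4).trans (zero_mul _)).trans
        ((congrArg (· * _) h4).trans (zero_mul _)).symm
  · rw [i11, i11']
    exact (mul_zero _).trans (mul_zero _).symm

end IsTriangleMove

end Cube

end

/-! ### Torsion bounds under the third Reidemeister move -/

noncomputable section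

namespace Cube

variable {E : Type*} {n : ℕ}

namespace IsTriangleMove

variable {Q Q' : Cube E (n + 3)} {a : Bool} {b : Fin 6 → E} {s : Fin 3 → E}
  (h : IsTriangleMove Q Q' a b s)

include h

theorem faceEquiv_d (F : (Q.face !a).space) :
    h.faceEquiv ((Q.face !a).d F) = (Q'.face !a).d (h.faceEquiv F) :=
  h.isMorphism_face.pullback_d F

theorem faceEquiv_x (F : (Q.face !a).space) :
    h.faceEquiv ((Q.face !a).x (b 0) F) = (Q'.face !a).x (b 0) (h.faceEquiv F) :=
  h.isMorphism_face.pullback_x (fun _ σ _ => h.comp_b σ _ 0) F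

theorem cornerEquiv_d (F : ((Q.face a).corner false true).space) :
    h.cornerEquiv (((Q.face a).corner false true).d F) =
      ((Q'.face a).corner true false).d (h.cornerEquiv F) :=
  h.isMorphism_corner.pullback_d F

theorem cornerEquiv_x (F : ((Q.face a).corner false true).space) :
    h.cornerEquiv (((Q.face a).corner false true).x (b 0) F) =
      ((Q'.face a).corner true false).x (b 0) (h.cornerEquiv F) :=
  h.isMorphism_corner.pullback_x (fun _ σ _ => h.comp_b σ _ 0) F

variable [Finite E]

omit h in
-- The bigon appears in the `1`-resolution of `z`, that is, in the target of the cone.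
theorem torsionBound_iff_of_true (h : IsTriangleMove Q Q' true b s) (k : ℕ) :
    TorsionBound Q.d (Q.x (b 0)) k ↔ TorsionBound Q'.d (Q'.x (b 0)) k := by
  rw [torsionBound_cone_iff, torsionBound_cone_iff (Q := Q')]
  rw [(h.retract.coneRight _ _ (Q.saddle false true) (Q.saddle_d rfl)
      (Q.saddle_x _ _ _)).torsionBound_iff
        (coneD_comm (d_x _ _) (d_x _ _) (Q.saddle_x _ _ _))
        (coneD_comm (d_x _ _) (fun F => by simp [d_x]) fun F => by
          rw [LinearMap.comp_apply, LinearMap.comp_apply, saddle_x, h.retract.retr_x]),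
    (h.retract'.coneRight _ _ (Q'.saddle false true) (Q'.saddle_d rfl)
      (Q'.saddle_x _ _ _)).torsionBound_iff
        (coneD_comm (d_x _ _) (d_x _ _) (Q'.saddle_x _ _ _))
        (coneD_comm (d_x _ _) (fun F => by simp [d_x]) fun F => by
          rw [LinearMap.comp_apply, LinearMap.comp_apply, saddle_x, h.retract'.retr_x])]
  -- Negating the equivalence of corners absorbs the sign of `cornerEquiv_retr`.
  refine TorsionBound.equiv_iff (LinearEquiv.prodCongr h.faceEquiv
    (h.cornerEquiv ≪≫ₗ LinearEquiv.neg ℚ)) (fun F => Prod.ext (h.faceEquiv_d F.1) ?_)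
    (fun F => Prod.ext (h.faceEquiv_x F.1) ?_)
  · change -h.cornerEquiv (h.retract.retr (Q.saddle false true F.1) -
      -((Q.face true).corner false true).d F.2) =
      h.retract'.retr (Q'.saddle false true (h.faceEquiv F.1)) -
        -((Q'.face true).corner true false).d (-h.cornerEquiv F.2)
    have h1 : h.cornerEquiv (h.retract.retr (Q.saddle false true F.1)) =
      -h.retract'.retr (Q'.saddle false true (h.faceEquiv F.1)) := h.cornerEquiv_retr F.1
    rw [map_sub, h1, map_neg, h.cornerEquiv_d, map_neg]
    abel
  · exact (congrArg Neg.neg (h.cornerEquiv_x F.2)).trans (map_neg _ _).symm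

omit h in
-- The bigon appears in the `0`-resolution of `z`, that is, in the source of the cone.
theorem torsionBound_iff_of_false (h : IsTriangleMove Q Q' false b s) (k : ℕ) :
    TorsionBound Q.d (Q.x (b 0)) k ↔ TorsionBound Q'.d (Q'.x (b 0)) k := by
  rw [torsionBound_cone_iff, torsionBound_cone_iff (Q := Q')]
  rw [(h.retract.coneLeft _ _ (Q.saddle false true) (Q.saddle_d rfl)
      (Q.saddle_x _ _ _)).torsionBound_iff
        (coneD_comm (d_x _ _) (d_x _ _) (Q.saddle_x _ _ _))
        (coneD_comm (fun F => by simp [d_x]) (d_x _ _) fun F => by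
          rw [LinearMap.comp_apply, LinearMap.comp_apply, ← h.retract.x_incl, saddle_x]),
    (h.retract'.coneLeft _ _ (Q'.saddle false true) (Q'.saddle_d rfl)
      (Q'.saddle_x _ _ _)).torsionBound_iff
        (coneD_comm (d_x _ _) (d_x _ _) (Q'.saddle_x _ _ _))
        (coneD_comm (fun F => by simp [d_x]) (d_x _ _) fun F => by
          rw [LinearMap.comp_apply, LinearMap.comp_apply, ← h.retract'.x_incl, saddle_x])]
  obtain ⟨T, hT⟩ : ∃ T : (Q.face true).space ≃ₗ[ℚ] (Q'.face true).space, T = h.faceEquiv := ⟨_, rfl⟩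
  have hd : ∀ F, T ((Q.face true).d F) = (Q'.face true).d (T F) := fun F => by
    rw [hT]; exact h.faceEquiv_d F
  have hx : ∀ F, T ((Q.face true).x (b 0) F) = (Q'.face true).x (b 0) (T F) := fun F => by
    rw [hT]; exact h.faceEquiv_x F
  have hI : ∀ F, T (Q.saddle false true (h.retract.incl F)) =
      Q'.saddle false true (h.retract'.incl (h.cornerEquiv F)) := fun F => by
    rw [hT]; exact h.faceEquiv_incl F
  refine TorsionBound.equiv_iff (LinearEquiv.prodCongr h.cornerEquiv T)
    (fun F => Prod.ext ?_ ?_) (fun F => Prod.ext (h.cornerEquiv_x F.1) (hx F.2))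
  · change h.cornerEquiv (-((Q.face false).corner false true).d F.1) =
      -((Q'.face false).corner true false).d (h.cornerEquiv F.1)
    rw [map_neg, h.cornerEquiv_d]
  · change T (Q.saddle false true (h.retract.incl F.1) - (Q.face true).d F.2) =
      Q'.saddle false true (h.retract'.incl (h.cornerEquiv F.1)) - (Q'.face true).d (T F.2)
    rw [map_sub, hd, hI]

theorem torsionBound_iff (k : ℕ) :
    TorsionBound Q.d (Q.x (b 0)) k ↔ TorsionBound Q'.d (Q'.x (b 0)) k := by
  cases a
  · exact h.torsionBound_iff_of_false k
  · exact h.torsionBound_iff_of_true k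

end IsTriangleMove

/-! ### Relabelling the edges -/

section Relabel

variable {E' : Type*} (Q : Cube E' n) (ε : E ≃ E')

/-- The cube with the edges relabelled. -/
def relabel : Cube E n where
  S v := (fun σ : E → Bool => σ ∘ ε.symm) ⁻¹' Q.S v
  q c i := ε.symm (Q.q c i)
  respects h c := (Respects.congr fun _ => rfl).1 (Q.respects h c)
  flip h c b h' := Q.flip h c b ((Respects.congr fun _ => rfl).1 h')
  comb h h' f := Q.comb h h' f
  one v c := by
    have h : Function.Surjective fun σ : E → Bool => σ ∘ ε.symm := fun σ =>
      ⟨σ ∘ ε, funext fun e => by simp⟩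
    rw [h.preimage_subset_preimage_iff, h.preimage_subset_preimage_iff]
    exact Q.one v c

theorem torsionBound_relabel_iff (e : E) (k : ℕ) :
    TorsionBound (Q.relabel ε).d ((Q.relabel ε).x e) k ↔ TorsionBound Q.d (Q.x (ε e)) k := by
  have hε : ∀ σ : E' → Bool, (σ ∘ ε) ∘ ε.symm = σ := fun σ => funext fun e => by simp
  refine torsionBound_transfer_iff (f := ε) (j := ε.symm)
    ⟨isSignSubst_comp _, fun v σ hσ => ?_, fun v σ _ c b => (Respects.congr fun i => ?_).1,
      fun v σ _ c _ => ?_⟩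
    ⟨isSignSubst_comp _, fun v σ hσ => hσ, fun v σ _ c b => (Respects.congr fun i => rfl).1,
      fun v σ _ c _ => rfl⟩
    (fun v σ _ e => by simp) (fun v σ _ e => by simp) e k
  · change (σ ∘ ε) ∘ ε.symm ∈ Q.S v
    rwa [hε]
  · exact congrFun (hε σ) _
  · exact congrFun (hε σ) _

variable {Q} in
theorem IsFull.relabel (hQ : Q.IsFull) : (Q.relabel ε).IsFull := fun v => by
  ext σ
  refine Iff.trans (hQ.mem_iff (σ := σ ∘ ε.symm)) (forall_congr' fun c => ?_)
  exact Respects.congr fun i => rfl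

end Relabel

end Cube

theorem Fin.exists_equiv_of_injective {n k : ℕ} (f : Fin k → Fin n) (hf : Function.Injective f) :
    ∃ (n' : ℕ) (ε : Fin (n' + k) ≃ Fin n), ∀ i : Fin k, ε ⟨i, by omega⟩ = f i := by
  classical
  obtain ⟨n', rfl⟩ := Nat.exists_eq_add_of_le' (by simpa using Fintype.card_le_of_injective f hf)
  obtain ⟨g, hg⟩ := Finset.exists_equiv_extend_of_card_eq (α := Fin (n' + k)) (t := Finset.univ)
    (s := Finset.univ.filter fun i => i.1 < k)
    (f := fun i => if h : i.1 < k then f ⟨i, h⟩ else i) (by simp) (Finset.subset_univ _) (by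
      intro i hi j hj hij
      simp only [Finset.coe_filter, Finset.mem_univ, true_and] at hi hj
      have hi' : i.1 < k := hi
      have hj' : j.1 < k := hj
      simp only [hi', hj', dif_pos] at hij
      exact Fin.ext (congrArg (fun l : Fin k => l.1) (hf hij)))
  refine ⟨n', g.trans (Equiv.subtypeUnivEquiv fun _ => Finset.mem_univ _), fun i => ?_⟩
  refine (hg ⟨i, by omega⟩ (by simp)).trans ?_
  simp

namespace PDCode.IsKnotDiagram

variable {D D' : PDCode}

/-- Each side of the triangle has its two ends `P j` and `P' j` at the crossings of the triangle, so
no other position can carry it. The map `t` treats both cases for the crossing `z` at once. -/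
theorem triangle_edges (h : D.IsKnotDiagram) {x y z : Fin D.n} {b : Fin 6 → Fin D.m}
    {s : Fin 3 → Fin D.m} (hxy : x ≠ y) (hxz : x ≠ z) (hyz : y ≠ z)
    (hx : D.ends x = ![b 1, s 0, s 1, b 0]) (hy : D.ends y = ![b 2, b 3, s 2, s 0])
    (t : Fin 4 → Fin 4) (ht : Function.Injective t)
    (hz : ∀ i, D.ends z (t i) = ![s 1, s 2, b 4, b 5] i) :
    Function.Injective s ∧ (∀ i j, b i ≠ s j) ∧
      ∀ c, c ≠ x → c ≠ y → c ≠ z → ∀ i j, D.ends c i ≠ s j := by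
  obtain ⟨P, hP⟩ : ∃ P : Fin 3 → Fin D.n × Fin 4, P = ![(x, 1), (x, 2), (y, 2)] := ⟨_, rfl⟩
  obtain ⟨P', hP'⟩ : ∃ P' : Fin 3 → Fin D.n × Fin 4, P' = ![(y, 3), (z, t 0), (z, t 1)] := ⟨_, rfl⟩
  obtain ⟨B, hB⟩ : ∃ B : Fin 6 → Fin D.n × Fin 4,
      B = ![(x, 3), (x, 0), (y, 0), (y, 1), (z, t 2), (z, t 3)] := ⟨_, rfl⟩
  have hPP' : ∀ i j, P i ≠ P' j := by
    intro i j
    rw [hP, hP']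
    fin_cases i <;> fin_cases j <;> simp [hxy, hxz, hyz]
  have hPs : ∀ i, D.ends (P i).1 (P i).2 = s i := by
    intro i
    rw [hP]
    fin_cases i <;> simp [hx, hy]
  have hPs' : ∀ i, D.ends (P' i).1 (P' i).2 = s i := by
    intro i
    rw [hP']
    fin_cases i <;> simp [hy, hz]
  have hBb : ∀ i, D.ends (B i).1 (B i).2 = b i := by
    intro i
    rw [hB]
    fin_cases i <;> simp [hx, hy, hz]
  have key : ∀ j (w : Fin D.n × Fin 4), D.ends w.1 w.2 = s j → w = P j ∨ w = P' j := fun j w hw =>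
    h.eq_or_eq_of_ends (hPP' j j) ((hPs j).trans hw.symm) ((hPs' j).trans hw.symm)
  refine ⟨fun i j hij => ?_, fun i j hij => ?_, fun c hcx hcy hcz i j hij => ?_⟩
  · by_contra hne
    have hinj : P i ≠ P j := by
      rw [hP]
      revert hne
      fin_cases i <;> fin_cases j <;> simp [hxy, hxy.symm]
    exact (key j (P i) ((hPs i).trans hij)).elim hinj (hPP' i j)
  · have h1 : B i ≠ P j := by
      rw [hB, hP]
      fin_cases i <;> fin_cases j <;> simp [hxy, hxz.symm, hyz.symm, hxy.symm]
    have h2 : B i ≠ P' j := by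
      rw [hB, hP']
      fin_cases i <;> fin_cases j <;> simp [hxy, hxz, hyz, hyz.symm, ht.eq_iff]
    exact (key j (B i) ((hBb i).trans hij)).elim h1 h2
  · have h1 : (c, i) ≠ P j := by
      rw [hP]
      fin_cases j <;> simp [hcx, hcy]
    have h2 : (c, i) ≠ P' j := by
      rw [hP']
      fin_cases j <;> simp [hcy, hcz]
    exact (key j (c, i) hij).elim h1 h2

theorem hasTorsionBound_iff_of_reidemeister3 (h : D.IsKnotDiagram) (h' : D'.IsKnotDiagram)
    (hD : D.Reidemeister3 D') (k : ℕ) : h.HasTorsionBound k ↔ h'.HasTorsionBound k := by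
  obtain ⟨κ, ε, x, y, z, b, s, hxy, hxz, hyz, hx, hx', hy, hy', hz, hrest⟩ := hD
  obtain ⟨t, ht, hzt⟩ : ∃ t : Fin 4 → Fin 4, Function.Injective t ∧
      ∀ i, D.ends z (t i) = ![s 1, s 2, b 4, b 5] i := by
    rcases hz with hz | hz
    · refine ⟨![3, 0, 1, 2], by decide, fun i => ?_⟩
      rw [hz.1]
      fin_cases i <;> rfl
    · exact ⟨id, fun _ _ => id, fun i => by rw [hz.1]; rfl⟩
  obtain ⟨hs, hbs, hrs⟩ := h.triangle_edges hxy hxz hyz hx hy t ht hzt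
  obtain ⟨n, η, hη⟩ := Fin.exists_equiv_of_injective ![z, x, y] (by
    intro i j
    fin_cases i <;> fin_cases j <;> simp [hxy, hxz, hyz, hxy.symm, hxz.symm, hyz.symm])
  have h0 : η 0 = z := hη 0
  have h1 : η 1 = x := hη 1
  have h2 : η 2 = y := hη 2
  have v2 : 2 % (n + 1 + 1 + 1) = 2 := Nat.mod_eq_of_lt (by omega)
  have hne : ∀ c : Fin n, η c.succ.succ.succ ≠ x ∧ η c.succ.succ.succ ≠ y ∧
      η c.succ.succ.succ ≠ z := fun c => by
    rw [← h0, ← h1, ← h2]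
    simp only [ne_eq, η.injective.eq_iff, Fin.ext_iff]
    simp [v2]
  -- The order of `x` and `y` is exchanged, in accordance with the isomorphism of the faces without
  -- a bigon.
  let η' : Fin (n + 3) ≃ Fin D'.n := (Equiv.swap 1 2).trans (η.trans κ)
  have h0' : η' 0 = κ z := congrArg κ ((congrArg η (Equiv.swap_apply_of_ne_of_ne
    (by simp) (by simp [Fin.ext_iff, v2]))).trans h0)
  have h1' : η' 1 = κ y := congrArg κ ((congrArg η (Equiv.swap_apply_left _ _)).trans h2)
  have h2' : η' 2 = κ x := congrArg κ ((congrArg η (Equiv.swap_apply_right _ _)).trans h1)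
  have h3' : ∀ c : Fin n, η' c.succ.succ.succ = κ (η c.succ.succ.succ) := fun c =>
    congrArg κ (congrArg η (Equiv.swap_apply_of_ne_of_ne (by simp [Fin.ext_iff])
      (by simp [Fin.ext_iff, v2])))
  set Q := h.cube.reindex η with hQ
  set Q' := (h'.cube.reindex η').relabel ε with hQ'
  have hq' : ∀ c (p : Fin 4 → Fin D.m), D'.ends (η' c) = ε ∘ p → Q'.q c = p := fun c p hp =>
    funext fun i => ε.symm_apply_eq.2 (congrFun hp i)
  have hq0 : Q.q 0 = D.ends z := congrArg D.ends h0
  have main : ∀ a : Bool,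
      (∀ σ, Respects a (Q.q 0) σ ↔ σ (s 1) = σ (s 2) ∧ σ (b 4) = σ (b 5)) →
      (∀ σ, Respects (!a) (Q.q 0) σ ↔ σ (s 1) = σ (b 5) ∧ σ (s 2) = σ (b 4)) →
      (∀ σ, Respects a (Q'.q 0) σ ↔ σ (s 1) = σ (s 2) ∧ σ (b 1) = σ (b 2)) →
      (∀ σ, Respects (!a) (Q'.q 0) σ ↔ σ (s 1) = σ (b 2) ∧ σ (s 2) = σ (b 1)) →
      (Q.q 0 0 = s 1 ∨ Q.q 0 0 = s 2) → (Q'.q 0 0 = b 1 ∨ Q'.q 0 0 = b 2) →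
      Cube.IsTriangleMove Q Q' a b s := fun a r1 r2 r3 r4 m1 m2 =>
    { full := h.isFull_cube.reindex η
      full' := (h'.isFull_cube.reindex η').relabel ε
      s_injective := hs
      b_ne := hbs
      rest_ne := fun c => hrs _ (hne c).1 (hne c).2.1 (hne c).2.2
      rest_eq := fun c => hq' _ _ ((congrArg D'.ends (h3' c)).trans
        (hrest _ (hne c).1 (hne c).2.1 (hne c).2.2))
      q_x := (congrArg D.ends h1).trans hx
      q_y := (congrArg D.ends h2).trans hy
      q_y' := hq' _ _ ((congrArg D'.ends h1').trans hy')
      q_x' := hq' _ _ ((congrArg D'.ends h2').trans hx')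
      respects_z := r1
      respects_z_not := r2
      respects_z' := r3
      respects_z_not' := r4
      marker := fun σ hσ => by rcases m1 with m1 | m1 <;> rw [m1]; exact hσ.symm
      marker' := fun σ hσ hσ1 hσ2 => by rcases m2 with m2 | m2 <;> rw [m2] <;> assumption }
  -- Which of the strands `L`, `N` is the upper one at `z` decides which resolution of `z` creates
  -- the bigon.
  obtain ⟨a, ha⟩ : ∃ a, Cube.IsTriangleMove Q Q' a b s := by
    rcases hz with ⟨hz, hz'⟩ | ⟨hz, hz'⟩
    · have hz0 := hq0.trans hz
      have hz0' := hq' 0 _ ((congrArg D'.ends h0').trans hz')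
      refine ⟨true, main true ?_ ?_ ?_ ?_ ?_ ?_⟩
      all_goals
        first | rw [hz0] | rw [hz0']
        simp [respects_false_iff, respects_true_iff] <;> grind
    · have hz0 := hq0.trans hz
      have hz0' := hq' 0 _ ((congrArg D'.ends h0').trans hz')
      refine ⟨false, main false ?_ ?_ ?_ ?_ ?_ ?_⟩
      all_goals
        first | rw [hz0] | rw [hz0']
        simp [respects_false_iff, respects_true_iff] <;> grind
  rw [h.hasTorsionBound_iff (b 0), h'.hasTorsionBound_iff (ε (b 0)),
    ← h.cube.torsionBound_reindex_iff η, ← h'.cube.torsionBound_reindex_iff η',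
    ← Cube.torsionBound_relabel_iff _ ε]
  exact ha.torsionBound_iff k

end PDCode.IsKnotDiagram

end

/-! ### The bound by the unknotting number -/

noncomputable section

open PDCode.IsKnotDiagram

namespace KnotDiagram

/-- A bound on the order of torsion in the Lee complex of a knot diagram. -/
def HasTorsionBound (D : KnotDiagram) (k : ℕ) : Prop := D.isKnotDiagram.HasTorsionBound k

theorem _root_.ReidemeisterMove.hasTorsionBound_iff {D D' : KnotDiagram}
    (h : ReidemeisterMove D D') (k : ℕ) : D.HasTorsionBound k ↔ D'.HasTorsionBound k := by
  rcases h with h | h | h | h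
  · exact hasTorsionBound_iff_of_iso _ _ h k
  · exact hasTorsionBound_iff_of_reidemeister1 _ _ h k
  · exact hasTorsionBound_iff_of_reidemeister2 _ _ h k
  · exact hasTorsionBound_iff_of_reidemeister3 _ _ h k

theorem hasTorsionBound_iff_of_knot_eq {D D' : KnotDiagram} (h : D.knot = D'.knot) (k : ℕ) :
    D.HasTorsionBound k ↔ D'.HasTorsionBound k :=
  iff_of_eq ((Quot.eqvGen_exact h).apply_eq fun _ _ h' => propext (h'.hasTorsionBound_iff k))

/-- Without crossings the differential vanishes, and the variable acts injectively, so there is no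
torsion. -/
theorem hasTorsionBound_circle : circle.HasTorsionBound 0 := by
  intro e F _ hF
  obtain ⟨n, G, hG⟩ := hF
  have hd : circle.isKnotDiagram.cube.d G = 0 :=
    Cube.space_ext fun v σ _ => by rw [Cube.d_apply]; rfl
  rw [hd] at hG
  have hinj : Function.Injective (circle.isKnotDiagram.cube.x e ^ n) := by
    rw [Module.End.coe_pow]
    exact (Cube.x_injective _ e).iterate n
  exact ⟨0, by rw [hinj (hG.trans (map_zero _).symm), map_zero, map_zero]⟩

end KnotDiagram

/-- The bound is carried backwards from the unknot, rising by one at each crossing change.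
Invariance allows the diagram to be replaced before each of them. -/
theorem Knot.UnknotsIn.hasTorsionBound {K : Knot} {k : ℕ} (hK : K.UnknotsIn k) {D : KnotDiagram}
    (hD : D.knot = K) : D.HasTorsionBound k := by
  induction k generalizing K D with
  | zero =>
    obtain ⟨s, rfl, hs, -⟩ := hK
    exact (KnotDiagram.hasTorsionBound_iff_of_knot_eq (hD.trans hs) 0).2
      KnotDiagram.hasTorsionBound_circle
  | succ k ih =>
    obtain ⟨s, rfl, hs, hstep⟩ := hK
    obtain ⟨D₁, D₂, c, h₁, h₂, h₃⟩ := hstep 0 k.succ_pos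
    have hk : D₂.HasTorsionBound k :=
      ih ⟨fun i => s (i + 1), rfl, hs, fun i hi => hstep (i + 1) (Nat.succ_lt_succ hi)⟩ h₂
    rw [KnotDiagram.hasTorsionBound_iff_of_knot_eq (hD.trans h₁.symm)]
    obtain ⟨C, hC⟩ := D₂
    obtain rfl : C = _ := h₃
    exact fun e => D₁.isKnotDiagram.torsionBound_of_crossingChange c hC hk e

end

theorem mainTheorem1 (K : Knot) (D : KnotDiagram) (hD : D.knot = K) (e : Fin D.code.m) :
    D.uX e ≤ K.unknottingNumber :=
  le_iInf₂ fun _ hk => D.isKnotDiagram.maxTorsionOrder_le (hk.hasTorsionBound hD e)
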